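/- **Setting.** Let $\Sigma$ be a connected Riemann surface, $n\ge 3$, and $\underline{\mathbb C}^{n+2}=\Sigma\times(\mathbb R^{n+1,1})^{\mathbb C}$ the trivial bundle with the complex bilinear extension $(\cdot,\cdot)$ of the Lorentz metric, with trivial flat connection $d$. For $u,v\in\mathbb C^{n+2}$ let $u\wedge v$ be the endomorphism $w\mapsto (u,w)v-(v,w)u$. For a non-degenerate smooth subbundle $V\subset\underline{\mathbb C}^{n+2}$ let $\mathcal D_V$ be the sum of the connections induced by $d$ on $V$ and $V^\perp$, $\mathcal N_V=d-\mathcal D_V$, and $\rho=\pi_V-\pi_{V^\perp}$. For a smooth $1$-form $q$ with values in $\wedge^2V\oplus\wedge^2V^\perp$ and $\mu\in\mathbb C\setminus\{0\}$ set $$d^{\mu,q}_V=\mathcal D_V+\mu^{-1}\mathcal N_V^{1,0}+\mu\,\mathcal N_V^{0,1}+(\mu^{-2}-1)q^{1,0}+(\mu^2-1)q^{0,1},\qquad q_\mu=\mu^{-2}q^{1,0}+\mu^{2}q^{0,1}.$$ $V$ is *$q$-constrained harmonic* if $d^{\mu,q}_V$ is flat for all $\mu\in\mathbb C\setminus\{0\}$.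 A *surface* is a pair $(\Lambda^{1,0},\Lambda^{0,1})$ of isotropic rank $2$ subbundles with $\Lambda:=\Lambda^{1,0}\cap\Lambda^{0,1}$ of rank $1$, $d^{1,0}\Gamma\Lambda\subset\Omega^{1,0}\Lambda^{1,0}$ and $d^{0,1}\Gamma\Lambda\subset\Omega^{0,1}\Lambda^{0,1}$; a non-degenerate rank $4$ subbundle $V$ is a *central sphere congruence* of it if $\Lambda^{1,0}+\Lambda^{0,1}\subset V$ and $\mathcal N_V^{1,0}\Lambda^{0,1}=0=\mathcal N_V^{0,1}\Lambda^{1,0}$. The surface is *constrained Willmore with central sphere congruence $V$ and multiplier $q$* if moreover $V$ is $q$-constrained harmonic, $q^{1,0}$ takes values in $\wedge^2\Lambda^{0,1}$ and $q^{0,1}$ in $\wedge^2\Lambda^{1,0}$. *Spectral deformation.* Let $\phi^\lambda:(\underline{\mathbb C}^{n+2},d^{\lambda,q}_V)\to(\underline{\mathbb C}^{n+2},d)$ be an isometry of bundles preserving connections, $\lambda\neq0$. The spectral deformation of parameter $\lambda$, corresponding to $q$, takes $V$ to $\phi^\lambda V$, $q$ to $\mathrm{Ad}_{\phi^\lambda}q_\lambda$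 and $(\Lambda^{1,0},\Lambda^{0,1})$ to $(\phi^\lambda\Lambda^{1,0},\phi^\lambda\Lambda^{0,1})$. *Bäcklund transformation.* For $\alpha\in\mathbb C\setminus\{0,\pm1\}$ and a null line subbundle $L$ with $\rho L\cap L^\perp=\{0\}$, let $p_{\alpha,L}(\mu)$ be $\frac{\alpha-\mu}{\alpha+\mu}$ on $L$, $1$ on $(L\oplus\rho L)^\perp$, $\frac{\alpha+\mu}{\alpha-\mu}$ on $\rho L$, and $q_{\alpha,L}(\mu)$ be $\frac{\mu-\alpha}{\mu+\alpha}$ on $L$, $1$ on $(L\oplus\rho L)^\perp$, $\frac{\mu+\alpha}{\mu-\alpha}$ on $\rho L$, extended to $\mu=\infty$. *Bäcklund transformation parameters* to $V$ (with multiplier $q$) are $\alpha,\beta\in\mathbb C\setminus\{0,\pm1\}$ with $\beta\ne\pm\alpha$, a $d^{\alpha,q}_V$-parallel null line subbundle $L^\alpha$ with $\rho L^\alpha\cap(L^\alpha)^\perp=\{0\}$, and a $d^{\beta,q}_V$-parallel null line subbundle $L^\beta$ such that $\hat L:=p_{\alpha,L^\alpha}(\beta)L^\beta$ satisfies $\rho\hat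 L\cap\hat L^\perp=\{0\}$. With $r^*=q_{\beta,\hat L}\,p_{\alpha,L^\alpha}$, the Bäcklund transformation takes $V$ to $V^*=r^*(1)^{-1}V$, $q$ to $q^*=\mathrm{Ad}_{r^*(1)^{-1}}(\mathrm{Ad}_{r^*(0)}q^{1,0}+\mathrm{Ad}_{r^*(\infty)}q^{0,1})$, and $(\Lambda^{1,0},\Lambda^{0,1})$ to $(r^*(1)^{-1}r^*(\infty)\Lambda^{1,0},\ r^*(1)^{-1}r^*(0)\Lambda^{0,1})$. **Theorem (Spectral deformation vs Bäcklund transformation).** Let $V$ be a $q$-constrained harmonic bundle, $\alpha,\beta,L^\alpha,L^\beta$ Bäcklund transformation parameters to $V$, $\lambda\in\mathbb C\setminus\{0,\pm\alpha,\pm\beta\}$, and $\phi^\lambda:(\underline{\mathbb C}^{n+2},d^{\lambda,q}_V)\to(\underline{\mathbb C}^{n+2},d)$ an isometry of bundles preserving connections. Then: 1. $\phi^\lambda V$ is $\mathrm{Ad}_{\phi^\lambda}q_\lambda$-constrained harmonic, and $\frac{\alpha}{\lambda},\frac{\beta}{\lambda},\phi^\lambda L^\alpha,\phi^\lambda L^\beta$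 are Bäcklund transformation parameters to $\phi^\lambda V$ with this multiplier; $V^*$ is $q^*$-constrained harmonic. 2. The Bäcklund transform of parameters $\frac{\alpha}{\lambda},\frac{\beta}{\lambda},\phi^\lambda L^\alpha,\phi^\lambda L^\beta$ of the spectral deformation $\phi^\lambda V$ coincides with the spectral deformation of parameter $\lambda$, corresponding to the multiplier $q^*$, of the Bäcklund transform $V^*$ of parameters $\alpha,\beta,L^\alpha,L^\beta$ of $V$: there is an isometry $\phi^\lambda_*:(\underline{\mathbb C}^{n+2},d^{\lambda,q^*}_{V^*})\to(\underline{\mathbb C}^{n+2},d)$ preserving connections for which the two composite transformations (spectral deformation by $\phi^\lambda$ followed by Bäcklund transformation of parameters $\frac{\alpha}{\lambda},\frac{\beta}{\lambda},\phi^\lambda L^\alpha,\phi^\lambda L^\beta$; Bäcklund transformation of parameters $\alpha,\beta,L^\alpha,L^\beta$ followed by spectral deformation by $\phi^\lambda_*$) agree on $V$, on the multiplier $q$, and on every constrained Willmore surface $(\Lambda^{1,0},\Lambda^{0,1})$ with central sphere congruence $V$ and multiplier $q$. 3. For every isometry $\phi^\lambda_*:(\underline{\mathbb C}^{n+2},d^{\lambda,q^*}_{V^*})\to(\underline{\mathbb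 C}^{n+2},d)$ preserving connections, the same diagram of transformations commutes up to a Möbius transformation: there is a constant $T\in O(\mathbb C^{n+2})$ such that the two composites agree, in the sense of 2, with $T\phi^\lambda_*$ in place of $\phi^\lambda_*$. -/

import Mathlib

open scoped Manifold ContDiff

namespace ConstrainedHarmonic

/-- A Riemann surface is, in particular, a real-analytic surface modelled on `ℂ = ℝ²`. -/
instance instRealManifold {M : Type*} [TopologicalSpace M] [ChartedSpace ℂ M]
    [h : IsManifold 𝓘(ℂ) ω M] : IsManifold 𝓘(ℝ, ℂ) ω M := by
  apply isManifold_of_contDiffOn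
  intro e e' he he'
  have h1 := (mem_groupoid_of_pregroupoid.1
    ((contDiffGroupoid ω 𝓘(ℂ)).compatible he he')).1
  exact ContDiffOn.restrict_scalars ℝ h1

/-! ### Linear algebra of `ℂ^{n+2}` with the complexified Lorentz metric -/

/-- `ℂ^{n+2} = (ℝ^{n+1,1})^ℂ`; its Hermitian norm is used for the topology only. -/
abbrev Amb (n : ℕ) : Type := EuclideanSpace ℂ (Fin (n + 2))

/-- Endomorphisms of `ℂ^{n+2}`. -/
abbrev EndAmb (n : ℕ) : Type := Amb n →L[ℂ] Amb n

/-- The complex bilinear extension of the metric of signature `(n+1,1)` on `ℝ^{n+1,1}`. -/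
noncomputable def metric (n : ℕ) : LinearMap.BilinForm ℂ (Amb n) :=
  LinearMap.mk₂ ℂ (fun u v => ∑ i, (if i = Fin.last (n + 1) then -1 else 1) * (u i * v i))
    (fun u u' v => by simp only [PiLp.add_apply, add_mul, mul_add, Finset.sum_add_distrib])
    (fun c u v => by simp only [PiLp.smul_apply, smul_eq_mul, Finset.mul_sum]; congr! 1; ring)
    (fun u v v' => by simp only [PiLp.add_apply, mul_add, Finset.sum_add_distrib])
    (fun c u v => by simp only [PiLp.smul_apply, smul_eq_mul, Finset.mul_sum]; congr! 1; ring)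

/-- The orthogonal complement. -/
noncomputable def perp {n : ℕ} (W : Submodule ℂ (Amb n)) : Submodule ℂ (Amb n) :=
  (metric n).orthogonal W

/-- A subspace is null (isotropic) if the metric vanishes on it. -/
def IsNull {n : ℕ} (W : Submodule ℂ (Amb n)) : Prop :=
  ∀ u ∈ W, ∀ v ∈ W, metric n u v = 0

/-- A subspace is non-degenerate if it meets its orthogonal complement trivially. -/
def IsNondeg {n : ℕ} (W : Submodule ℂ (Amb n)) : Prop :=
  W ⊓ perp W = ⊥

/-- Elements of the complex orthogonal group `O(ℂ^{n+2})`. -/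
def IsOrth {n : ℕ} (T : EndAmb n) : Prop :=
  ∀ u v, metric n (T u) (T v) = metric n u v

/-- `u ∧ v`, as the endomorphism `w ↦ (u,w) v - (v,w) u`. -/
noncomputable def wedge {n : ℕ} (u v : Amb n) : EndAmb n :=
  LinearMap.toContinuousLinearMap ((metric n u).smulRight v - (metric n v).smulRight u)

/-- `∧² W` as a space of endomorphisms of `ℂ^{n+2}`. -/
noncomputable def wedge2 {n : ℕ} (W : Submodule ℂ (Amb n)) : Submodule ℂ (EndAmb n) :=
  Submodule.span ℂ {A | ∃ u ∈ W, ∃ v ∈ W, A = wedge u v}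

open Classical in
/-- The projection onto `W` along `W'` when `ℂ^{n+2} = W ⊕ W'` (and `0` otherwise). -/
noncomputable def projAlong {n : ℕ} (W W' : Submodule ℂ (Amb n)) : EndAmb n :=
  if h : IsCompl W W' then LinearMap.toContinuousLinearMap (W.projection W' h) else 0

/-- The orthogonal projection `π_W` onto a non-degenerate subspace `W`. -/
noncomputable def orthProj {n : ℕ} (W : Submodule ℂ (Amb n)) : EndAmb n :=
  projAlong W (perp W)

/-- The reflection `ρ = π_W - π_{W^⊥}` across a non-degenerate subspace `W`. -/
noncomputable def reflection {n : ℕ} (W : Submodule ℂ (Amb n)) : EndAmb n :=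
  orthProj W - orthProj (perp W)

/-- The image of a subspace under an endomorphism. -/
noncomputable def img {n : ℕ} (T : EndAmb n) (W : Submodule ℂ (Amb n)) : Submodule ℂ (Amb n) :=
  W.map (T : Amb n →ₗ[ℂ] Amb n)

/-- The inverse of an endomorphism (meaningful for invertible ones). -/
noncomputable def inv {n : ℕ} (T : EndAmb n) : EndAmb n := Ring.inverse T

/-- For null lines `L`, `L'` spanning a non-degenerate plane: the endomorphism equal to
`c` on `L`, to `1` on `(L ⊕ L')^⊥` and to `c⁻¹` on `L'`. -/
noncomputable def boost {n : ℕ} (c : ℂ) (L L' : Submodule ℂ (Amb n)) : EndAmb n :=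
  c • projAlong L (L' ⊔ perp (L ⊔ L')) + orthProj (perp (L ⊔ L')) +
    c⁻¹ • projAlong L' (L ⊔ perp (L ⊔ L'))

/-! ### Bundles, forms and connections over the Riemann surface `M` -/

section Surface

variable {M : Type*} [TopologicalSpace M] [ChartedSpace ℂ M]

/-- Complex structure of the tangent spaces: since the charts are holomorphic, in `T_x M = ℂ` it
is the multiplication by `i`. -/
noncomputable def tangentJ (x : M) : TangentSpace 𝓘(ℝ, ℂ) x →L[ℝ] TangentSpace 𝓘(ℝ, ℂ) x :=
  ContinuousLinearMap.mul ℝ ℂ Complex.I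

/-- The `(1,0)`-part `½ (η - i η ∘ J)` of a form with values in a complex vector space. -/
noncomputable def part10 {W : Type*} [NormedAddCommGroup W] [NormedSpace ℂ W] [NormedSpace ℝ W]
    [IsScalarTower ℝ ℂ W] {x : M} (η : TangentSpace 𝓘(ℝ, ℂ) x →L[ℝ] W) :
    TangentSpace 𝓘(ℝ, ℂ) x →L[ℝ] W :=
  (1 / 2 : ℂ) • (η - Complex.I • η.comp (tangentJ x))

/-- The `(0,1)`-part `½ (η + i η ∘ J)` of a form with values in a complex vector space. -/
noncomputable def part01 {W : Type*} [NormedAddCommGroup W] [NormedSpace ℂ W] [NormedSpace ℝ W]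
    [IsScalarTower ℝ ℂ W] {x : M} (η : TangentSpace 𝓘(ℝ, ℂ) x →L[ℝ] W) :
    TangentSpace 𝓘(ℝ, ℂ) x →L[ℝ] W :=
  (1 / 2 : ℂ) • (η + Complex.I • η.comp (tangentJ x))

/-- Vector fields on `M`. -/
abbrev VecField (M : Type*) [TopologicalSpace M] [ChartedSpace ℂ M] : Type _ :=
  ∀ x : M, TangentSpace 𝓘(ℝ, ℂ) x

/-- `1`-forms on `M` with values in `End(ℂ^{n+2})`. -/
abbrev EndForm (M : Type*) [TopologicalSpace M] [ChartedSpace ℂ M] (n : ℕ) : Type _ :=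
  ∀ x : M, TangentSpace 𝓘(ℝ, ℂ) x →L[ℝ] EndAmb n

/-- Families of subspaces of `ℂ^{n+2}` parametrised by `M`. -/
abbrev Bdl (M : Type*) (n : ℕ) : Type _ := M → Submodule ℂ (Amb n)

/-- Operators taking sections of the trivial bundle `M × ℂ^{n+2}` to `ℂ^{n+2}`-valued `1`-forms. -/
abbrev Conn (M : Type*) [TopologicalSpace M] [ChartedSpace ℂ M] (n : ℕ) : Type _ :=
  (M → Amb n) → ∀ x : M, TangentSpace 𝓘(ℝ, ℂ) x →L[ℝ] Amb n

/-- Smooth sections of the trivial bundle `M × ℂ^{n+2}`. -/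
def SmoothSec {n : ℕ} (s : M → Amb n) : Prop := ContMDiff 𝓘(ℝ, ℂ) 𝓘(ℝ, Amb n) ∞ s

/-- Smooth sections of `End(M × ℂ^{n+2})`. -/
def SmoothEnd {n : ℕ} (φ : M → EndAmb n) : Prop := ContMDiff 𝓘(ℝ, ℂ) 𝓘(ℝ, EndAmb n) ∞ φ

/-- Smooth vector fields. -/
def SmoothVec [IsManifold 𝓘(ℂ) ω M] (X : VecField M) : Prop :=
  ContMDiff 𝓘(ℝ, ℂ) 𝓘(ℝ, ℂ).tangent ∞ (fun x => (⟨x, X x⟩ : TangentBundle 𝓘(ℝ, ℂ) M))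

/-- Smooth `1`-forms: those that are smooth on smooth vector fields. -/
def SmoothForm [IsManifold 𝓘(ℂ) ω M] {n : ℕ} (η : EndForm M n) : Prop :=
  ∀ X : VecField M, SmoothVec X → SmoothEnd fun x => η x (X x)

/-- Smooth subbundles of rank `r` of the trivial bundle: locally spanned by smooth frames. -/
def IsSubbundle {n : ℕ} (r : ℕ) (V : Bdl M n) : Prop :=
  ∀ x₀ : M, ∃ U : Set M, IsOpen U ∧ x₀ ∈ U ∧ ∃ s : Fin r → M → Amb n,
    (∀ i, ContMDiffOn 𝓘(ℝ, ℂ) 𝓘(ℝ, Amb n) ∞ (s i) U) ∧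
    ∀ x ∈ U, LinearIndependent ℂ (fun i => s i x) ∧
      V x = Submodule.span ℂ (Set.range fun i => s i x)

/-- The trivial flat connection `d`. -/
noncomputable def triv {n : ℕ} : Conn M n := fun s x => mvfderiv 𝓘(ℝ, ℂ) s x

/-- The sum `𝒟_V` of the connections induced by `d` on `V` and `V^⊥`. -/
noncomputable def calD {n : ℕ} (V : Bdl M n) : Conn M n := fun s x =>
  ((orthProj (V x)).restrictScalars ℝ).comp (triv (fun y => orthProj (V y) (s y)) x) +
  ((orthProj (perp (V x))).restrictScalars ℝ).comp
    (triv (fun y => orthProj (perp (V y)) (s y)) x)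

/-- `𝒩_V = d - 𝒟_V`. -/
noncomputable def calN {n : ℕ} (V : Bdl M n) : Conn M n := fun s x => triv s x - calD V s x

/-- The action of an endomorphism-valued form on a vector. -/
noncomputable def formApply {n : ℕ} {x : M} (η : TangentSpace 𝓘(ℝ, ℂ) x →L[ℝ] EndAmb n)
    (v : Amb n) : TangentSpace 𝓘(ℝ, ℂ) x →L[ℝ] Amb n :=
  ((ContinuousLinearMap.apply ℂ (Amb n) v).restrictScalars ℝ).comp η

/-- `d^{μ,q}_V = 𝒟_V + μ⁻¹ 𝒩_V^{1,0} + μ 𝒩_V^{0,1} + (μ⁻² - 1) q^{1,0} + (μ² - 1) q^{0,1}`. -/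
noncomputable def specConn {n : ℕ} (V : Bdl M n) (q : EndForm M n) (μ : ℂ) : Conn M n :=
  fun s x => calD V s x + μ⁻¹ • part10 (calN V s x) + μ • part01 (calN V s x) +
    ((μ ^ 2)⁻¹ - 1) • formApply (part10 (q x)) (s x) +
    (μ ^ 2 - 1) • formApply (part01 (q x)) (s x)

/-- Flatness: vanishing of the curvature
`R(X,Y)s = ∇_X ∇_Y s - ∇_Y ∇_X s - ∇_{[X,Y]} s`. -/
def IsFlat [IsManifold 𝓘(ℂ) ω M] {n : ℕ} (D : Conn M n) : Prop :=
  ∀ X Y : VecField M, SmoothVec X → SmoothVec Y → ∀ s : M → Amb n, SmoothSec s → ∀ x : M,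
    D (fun y => D s y (Y y)) x (X x) - D (fun y => D s y (X y)) x (Y x) -
      D s x (VectorField.mlieBracket 𝓘(ℝ, ℂ) X Y x) = 0

/-- A subbundle `L` is parallel if covariant derivatives of sections of `L` take values in `L`. -/
def IsParallel {n : ℕ} (D : Conn M n) (L : Bdl M n) : Prop :=
  ∀ s : M → Amb n, SmoothSec s → (∀ x, s x ∈ L x) → ∀ x X, D s x X ∈ L x

/-- `φ : (M × ℂ^{n+2}, D) → (M × ℂ^{n+2}, d)` is an isometry of bundles preserving connections. -/
structure IsGauge {n : ℕ} (D : Conn M n) (φ : M → EndAmb n) : Prop where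
  smooth : SmoothEnd φ
  orth : ∀ x, IsOrth (φ x)
  preserves : ∀ s : M → Amb n, SmoothSec s → ∀ x X,
    triv (fun y => φ y (s y)) x X = φ x (D s x X)

/-- `V` is a `q`-constrained harmonic bundle (with respect to `d`). -/
structure IsConstrainedHarmonic [IsManifold 𝓘(ℂ) ω M] {n : ℕ} (V : Bdl M n) (q : EndForm M n) :
    Prop where
  subbundle : ∃ r, IsSubbundle r V
  nondeg : ∀ x, IsNondeg (V x)
  smooth : SmoothForm q
  values : ∀ x X, q x X ∈ wedge2 (V x) ⊔ wedge2 (perp (V x))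
  flat : ∀ μ : ℂ, μ ≠ 0 → IsFlat (specConn V q μ)

/-- `(Λ^{1,0}, Λ^{0,1})` is a (complexified) surface. -/
structure IsSurface {n : ℕ} (Λ10 Λ01 : Bdl M n) : Prop where
  subbundle10 : IsSubbundle 2 Λ10
  subbundle01 : IsSubbundle 2 Λ01
  null10 : ∀ x, IsNull (Λ10 x)
  null01 : ∀ x, IsNull (Λ01 x)
  inter : IsSubbundle 1 fun x => Λ10 x ⊓ Λ01 x
  deriv10 : ∀ s : M → Amb n, SmoothSec s → (∀ x, s x ∈ Λ10 x ⊓ Λ01 x) →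
    ∀ x X, part10 (triv s x) X ∈ Λ10 x
  deriv01 : ∀ s : M → Amb n, SmoothSec s → (∀ x, s x ∈ Λ10 x ⊓ Λ01 x) →
    ∀ x X, part01 (triv s x) X ∈ Λ01 x

/-- `V` is a central sphere congruence of the surface `(Λ^{1,0}, Λ^{0,1})`. -/
structure IsCentralSphereCongruence {n : ℕ} (V Λ10 Λ01 : Bdl M n) : Prop where
  subbundle : IsSubbundle 4 V
  nondeg : ∀ x, IsNondeg (V x)
  le : ∀ x, Λ10 x ⊔ Λ01 x ≤ V x
  calN10 : ∀ s : M → Amb n, SmoothSec s → (∀ x, s x ∈ Λ01 x) → ∀ x, part10 (calN V s x) = 0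
  calN01 : ∀ s : M → Amb n, SmoothSec s → (∀ x, s x ∈ Λ10 x) → ∀ x, part01 (calN V s x) = 0

/-- `(Λ^{1,0}, Λ^{0,1})` is a constrained Willmore surface admitting `V` as a `q`-constrained
harmonic central sphere congruence, with `q^{1,0}` in `∧² Λ^{0,1}` and `q^{0,1}` in
`∧² Λ^{1,0}`. -/
structure IsConstrainedWillmore [IsManifold 𝓘(ℂ) ω M] {n : ℕ} (V : Bdl M n) (q : EndForm M n)
    (Λ10 Λ01 : Bdl M n) : Prop where
  surface : IsSurface Λ10 Λ01
  central : IsCentralSphereCongruence V Λ10 Λ01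
  harmonic : IsConstrainedHarmonic V q
  mult10 : ∀ x X, part10 (q x) X ∈ wedge2 (Λ01 x)
  mult01 : ∀ x X, part01 (q x) X ∈ wedge2 (Λ10 x)

/-! ### Transformations -/

/-- The image of a bundle under a section of `End(M × ℂ^{n+2})`. -/
noncomputable def mapB {n : ℕ} (φ : M → EndAmb n) (V : Bdl M n) : Bdl M n :=
  fun x => img (φ x) (V x)

/-- `Ad_T η` for a form `η` at a point, `(Ad_T η)(X) = T ∘ η(X) ∘ T⁻¹`. -/
noncomputable def adAt {n : ℕ} {x : M} (T : EndAmb n)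
    (η : TangentSpace 𝓘(ℝ, ℂ) x →L[ℝ] EndAmb n) : TangentSpace 𝓘(ℝ, ℂ) x →L[ℝ] EndAmb n :=
  ((ContinuousLinearMap.mulLeftRight ℂ (EndAmb n) T (inv T)).restrictScalars ℝ).comp η

/-- `Ad_φ η`. -/
noncomputable def adForm {n : ℕ} (φ : M → EndAmb n) (η : EndForm M n) : EndForm M n :=
  fun x => adAt (φ x) (η x)

/-- `q_λ = λ⁻² q^{1,0} + λ² q^{0,1}`. -/
noncomputable def qScale {n : ℕ} (l : ℂ) (q : EndForm M n) : EndForm M n :=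
  fun x => (l ^ 2)⁻¹ • part10 (q x) + l ^ 2 • part01 (q x)

/-- `p_{α,L}(μ)` for `μ ∈ ℂ ∪ {∞}`, with respect to the reflection across `V`: it is
`(α - μ)/(α + μ)` on `L`, `1` on `(L ⊕ ρL)^⊥` and `(α + μ)/(α - μ)` on `ρL`;
for `μ = ∞` the scalars on `L` and `ρL` are both `-1`. -/
noncomputable def pMap {n : ℕ} (V : Bdl M n) (α : ℂ) (L : Bdl M n) (μ : OnePoint ℂ) :
    M → EndAmb n :=
  fun x => boost (OnePoint.elim μ (-1) fun m => (α - m) / (α + m)) (L x)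
    (img (reflection (V x)) (L x))

/-- `q_{α,L}(μ)` for `μ ∈ ℂ ∪ {∞}`: it is `(μ - α)/(μ + α)` on `L`, `1` on `(L ⊕ ρL)^⊥` and
`(μ + α)/(μ - α)` on `ρL`; for `μ = ∞` it is the identity. -/
noncomputable def qMap {n : ℕ} (V : Bdl M n) (α : ℂ) (L : Bdl M n) (μ : OnePoint ℂ) :
    M → EndAmb n :=
  fun x => boost (OnePoint.elim μ 1 fun m => (m - α) / (m + α)) (L x)
    (img (reflection (V x)) (L x))

/-- `L̂ = p_{α,L^α}(β) L^β`. -/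
noncomputable def hatL {n : ℕ} (V : Bdl M n) (α β : ℂ) (Lα Lβ : Bdl M n) : Bdl M n :=
  mapB (pMap V α Lα (β : OnePoint ℂ)) Lβ

/-- `r*(μ) = q_{β,L̂}(μ) p_{α,L^α}(μ)`, for `μ ∈ ℂ ∪ {∞}`. -/
noncomputable def rStar {n : ℕ} (V : Bdl M n) (α β : ℂ) (Lα Lβ : Bdl M n) (μ : OnePoint ℂ) :
    M → EndAmb n :=
  fun x => qMap V β (hatL V α β Lα Lβ) μ x * pMap V α Lα μ x

/-- `r*(1)⁻¹`. -/
noncomputable def rStarOneInv {n : ℕ} (V : Bdl M n) (α β : ℂ) (Lα Lβ : Bdl M n) : M → EndAmb n :=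
  fun x => inv (rStar V α β Lα Lβ ((1 : ℂ) : OnePoint ℂ) x)

/-- `α, β, L^α, L^β` are Bäcklund transformation parameters to the `q`-constrained harmonic
bundle `V`. -/
structure IsBacklundParams {n : ℕ} (V : Bdl M n) (q : EndForm M n) (α β : ℂ) (Lα Lβ : Bdl M n) :
    Prop where
  α_ne : α ≠ -1 ∧ α ≠ 0 ∧ α ≠ 1
  β_ne : β ≠ -1 ∧ β ≠ 0 ∧ β ≠ 1
  ne : β ≠ α ∧ β ≠ -α
  lineα : IsSubbundle 1 Lα
  lineβ : IsSubbundle 1 Lβ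
  nullα : ∀ x, IsNull (Lα x)
  nullβ : ∀ x, IsNull (Lβ x)
  parallelα : IsParallel (specConn V q α) Lα
  parallelβ : IsParallel (specConn V q β) Lβ
  transα : ∀ x, img (reflection (V x)) (Lα x) ⊓ perp (Lα x) = ⊥
  transβ : ∀ x, img (reflection (V x)) (hatL V α β Lα Lβ x) ⊓ perp (hatL V α β Lα Lβ x) = ⊥

/-- The Bäcklund transform `V* = r*(1)⁻¹ V`. -/
noncomputable def backV {n : ℕ} (V : Bdl M n) (α β : ℂ) (Lα Lβ : Bdl M n) : Bdl M n :=
  mapB (rStarOneInv V α β Lα Lβ) V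

/-- `q* = Ad_{r*(1)⁻¹} (Ad_{r*(0)} q^{1,0} + Ad_{r*(∞)} q^{0,1})`. -/
noncomputable def backQ {n : ℕ} (V : Bdl M n) (q : EndForm M n) (α β : ℂ) (Lα Lβ : Bdl M n) :
    EndForm M n :=
  adForm (rStarOneInv V α β Lα Lβ) fun x =>
    adAt (rStar V α β Lα Lβ ((0 : ℂ) : OnePoint ℂ) x) (part10 (q x)) +
    adAt (rStar V α β Lα Lβ OnePoint.infty x) (part01 (q x))

/-- `(Λ*)^{1,0} = r*(1)⁻¹ r*(∞) Λ^{1,0}`. -/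
noncomputable def back10 {n : ℕ} (V : Bdl M n) (α β : ℂ) (Lα Lβ : Bdl M n) (Λ10 : Bdl M n) :
    Bdl M n :=
  mapB (rStarOneInv V α β Lα Lβ) (mapB (rStar V α β Lα Lβ OnePoint.infty) Λ10)

/-- `(Λ*)^{0,1} = r*(1)⁻¹ r*(0) Λ^{0,1}`. -/
noncomputable def back01 {n : ℕ} (V : Bdl M n) (α β : ℂ) (Lα Lβ : Bdl M n) (Λ01 : Bdl M n) :
    Bdl M n :=
  mapB (rStarOneInv V α β Lα Lβ) (mapB (rStar V α β Lα Lβ ((0 : ℂ) : OnePoint ℂ)) Λ01)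

/-- The two composite transformations agree, when the spectral deformations of parameter `l` of
`V` and of its Bäcklund transform are realised by `φ` and `ψ`: as bundles, as multipliers, and as
transformations of the constrained Willmore surfaces with central sphere congruence `V` and
multiplier `q`. -/
structure Permutes [IsManifold 𝓘(ℂ) ω M] {n : ℕ} (V : Bdl M n) (q : EndForm M n) (α β : ℂ)
    (Lα Lβ : Bdl M n) (l : ℂ) (φ ψ : M → EndAmb n) : Prop where
  bundle : backV (mapB φ V) (α / l) (β / l) (mapB φ Lα) (mapB φ Lβ) =
    mapB ψ (backV V α β Lα Lβ)
  multiplier : backQ (mapB φ V) (adForm φ (qScale l q)) (α / l) (β / l) (mapB φ Lα) (mapB φ Lβ) =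
    adForm ψ (qScale l (backQ V q α β Lα Lβ))
  surface : ∀ Λ10 Λ01 : Bdl M n, IsConstrainedWillmore V q Λ10 Λ01 →
    back10 (mapB φ V) (α / l) (β / l) (mapB φ Lα) (mapB φ Lβ) (mapB φ Λ10) =
      mapB ψ (back10 V α β Lα Lβ Λ10) ∧
    back01 (mapB φ V) (α / l) (β / l) (mapB φ Lα) (mapB φ Lβ) (mapB φ Λ01) =
      mapB ψ (back01 V α β Lα Lβ Λ01)

end Surface

end ConstrainedHarmonic

/-! Everything takes place in the loop of connections d^{μ,q}_V = d + A_μ, where A_μ is `connForm`.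
Since 𝒩_V = -½ρ dρ anticommutes with ρ while q commutes with it, conjugation by ρ exchanges
d^{μ,q}_V and d^{-μ,q}_V.

The heart of the matter is that r(μ) = r*(1)⁻¹ r*(μ) carries d^{μ,q}_V to d^{μ,q*}_{V*} for μ ≠ 0,
±α, ±β (`intertwines_back`). It is a composite of two steps, each using one null line. Let L be
d^{α,q}_V-parallel and p(μ) = p_{α,L}(μ). Gauging d^{μ,q}_V by p(μ) could create poles at μ = ±α,
but L is parallel at α and ρL at -α, and this cancels them. The dressed connection is thus d + B +
(μ⁻¹-1)C^{1,0} + (μ-1)C^{0,1} plus the terms of the multiplier q^{1,0} + Ad_{p(∞)} q^{0,1}, with B =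
p(1) d(p(1)⁻¹) (`IsDressing.identity`, `dressed_connForm`). Gauging further by p(1)⁻¹ removes B and
turns C into 𝒩 of p(1)⁻¹V. The latter is forced by the value at μ = -1, where p(-1) = p(1)⁻¹ = ρ
p(1) ρ and q drops out (`poleForm_eq`). Flatness of the new loop follows from the gauge away from
±α, and at ±α by continuity in μ.

The second step uses the line p(1)⁻¹L̂ = p(1)⁻¹p(β)L^β, which is parallel because p(1)⁻¹p(μ) is the
gauge of the first step at μ = β. The scalars of q_{β,L̂} are those of p_{β,L̂} with the opposite
sign, and the sign change is an orthogonal involution preserving V, so the two steps compose to V*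
and q*.

Spectral deformation rescales the parameter: φ^λ carries d^{λμ,q}_V to the connection of parameter μ
of φ^λ V (`intertwines_spectral`). As p_{α/λ}(μ) and p_α(λμ) have equal scalars, the r* of the
deformed data at μ is φ^λ r*(λμ) (φ^λ)⁻¹ (`rStar_mapB`), and 0 and ∞ are fixed by μ ↦ λμ. So φ^λ_* =
φ^λ r*(λ)⁻¹ r*(1) trivialises d^{λ,q*}_{V*} and makes both composites equal (`isGauge_back`,
`Permutes.of_eq`). Two trivialisations of one connection over a connected base differ by a constant
orthogonal map (`IsGauge.exists_eq_mul`), which gives the last assertion. -/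

namespace ConstrainedHarmonic

/-! ### Smooth sections, the Leibniz rule, and smoothness of J -/

section Calculus

variable {M : Type*} [TopologicalSpace M] [ChartedSpace ℂ M] {n : ℕ}

theorem SmoothEnd.mul {φ ψ : M → EndAmb n} (hφ : SmoothEnd φ) (hψ : SmoothEnd ψ) :
    SmoothEnd fun x => φ x * ψ x := by
  have h : ContDiff ℝ ∞ fun p : EndAmb n × EndAmb n => p.1 * p.2 := contDiff_fst.mul contDiff_snd
  exact h.comp_contMDiff (hφ.prodMk_space hψ)

theorem SmoothEnd.add {φ ψ : M → EndAmb n} (hφ : SmoothEnd φ) (hψ : SmoothEnd ψ) :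
    SmoothEnd fun x => φ x + ψ x := ContMDiff.add hφ hψ

theorem SmoothEnd.sub {φ ψ : M → EndAmb n} (hφ : SmoothEnd φ) (hψ : SmoothEnd ψ) :
    SmoothEnd fun x => φ x - ψ x := ContMDiff.sub hφ hψ

theorem SmoothEnd.const (T : EndAmb n) : SmoothEnd fun _ : M => T := contMDiff_const

theorem SmoothEnd.const_smul {φ : M → EndAmb n} (hφ : SmoothEnd φ) (c : ℂ) :
    SmoothEnd fun x => c • φ x := by
  have h : ContDiff ℝ ∞ fun p : EndAmb n => c • p := contDiff_id.const_smul c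
  exact h.comp_contMDiff hφ

theorem SmoothEnd.apply {φ : M → EndAmb n} {s : M → Amb n} (hφ : SmoothEnd φ)
    (hs : SmoothSec s) : SmoothSec fun x => φ x (s x) := by
  have h : ContDiff ℝ ∞ fun p : EndAmb n × Amb n => p.1 p.2 :=
    (isBoundedBilinearMap_apply (𝕜 := ℂ) (E := Amb n) (F := Amb n)).contDiff.restrict_scalars ℝ
  exact h.comp_contMDiff (hφ.prodMk_space hs)

theorem SmoothSec.add {s t : M → Amb n} (hs : SmoothSec s) (ht : SmoothSec t) :
    SmoothSec fun x => s x + t x := ContMDiff.add hs ht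

theorem SmoothSec.const_smul {s : M → Amb n} (hs : SmoothSec s) (c : ℂ) :
    SmoothSec fun x => c • s x := by
  have h : ContDiff ℝ ∞ fun p : Amb n => c • p := contDiff_id.const_smul c
  exact h.comp_contMDiff hs

theorem SmoothEnd.inv {φ : M → EndAmb n} (hφ : SmoothEnd φ) (hu : ∀ x, IsUnit (φ x)) :
    SmoothEnd fun x => inv (φ x) := by
  intro x
  obtain ⟨u, hu⟩ := hu x
  have h : ContDiffAt ℝ ∞ (Ring.inverse : EndAmb n → EndAmb n) (φ x) := by
    rw [← hu]; exact contDiffAt_ringInverse ℝ u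
  exact h.comp_contMDiffAt (hφ x)

theorem SmoothEnd.mdifferentiableAt {φ : M → EndAmb n} (hφ : SmoothEnd φ) (x : M) :
    MDifferentiableAt 𝓘(ℝ, ℂ) 𝓘(ℝ, EndAmb n) φ x :=
  (hφ x).mdifferentiableAt (by simp)

theorem SmoothSec.mdifferentiableAt {s : M → Amb n} (hs : SmoothSec s) (x : M) :
    MDifferentiableAt 𝓘(ℝ, ℂ) 𝓘(ℝ, Amb n) s x :=
  (hs x).mdifferentiableAt (by simp)

/-- The exterior derivative of a section of `End(M × ℂ^{n+2})`. -/
noncomputable def dEnd (φ : M → EndAmb n) : EndForm M n := fun x => mvfderiv 𝓘(ℝ, ℂ) φ x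

/-- The Leibniz rule, computed in the preferred chart at x. It serves both for products of
endomorphisms and for their evaluation on sections. -/
theorem mvfderiv_bilinear {E F G : Type*} [NormedAddCommGroup E] [NormedSpace ℝ E]
    [NormedAddCommGroup F] [NormedSpace ℝ F] [NormedAddCommGroup G] [NormedSpace ℝ G]
    {B : E × F → G} (hB : IsBoundedBilinearMap ℝ B) {f : M → E} {g : M → F} {x : M}
    (hf : MDifferentiableAt 𝓘(ℝ, ℂ) 𝓘(ℝ, E) f x) (hg : MDifferentiableAt 𝓘(ℝ, ℂ) 𝓘(ℝ, F) g x)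
    (X : TangentSpace 𝓘(ℝ, ℂ) x) :
    mvfderiv 𝓘(ℝ, ℂ) (fun y => B (f y, g y)) x X =
      B (mvfderiv 𝓘(ℝ, ℂ) f x X, g x) + B (f x, mvfderiv 𝓘(ℝ, ℂ) g x X) := by
  set e := extChartAt 𝓘(ℝ, ℂ) x
  have h1 : HasFDerivWithinAt (fun z => (f (e.symm z), g (e.symm z))) _ _ _ :=
    hf.hasMFDerivAt.2.prodMk hg.hasMFDerivAt.2
  have h2 := HasFDerivAt.comp_hasFDerivWithinAt (f := fun z => (f (e.symm z), g (e.symm z)))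
    (e x) (hB.hasFDerivAt (f (e.symm (e x)), g (e.symm (e x)))) h1
  have h3 : HasMFDerivAt 𝓘(ℝ, ℂ) 𝓘(ℝ, G) (fun y => B (f y, g y)) x _ :=
    ⟨hB.continuous.continuousAt.comp (hf.continuousAt.prodMk hg.continuousAt), h2⟩
  have h4 : mvfderiv 𝓘(ℝ, ℂ) (fun y => B (f y, g y)) x X =
      mfderiv 𝓘(ℝ, ℂ) 𝓘(ℝ, G) (fun y => B (f y, g y)) x X := rfl
  -- The chart computation is based at `e.symm (e x)`, which has to be identified with x.
  have h5 : e.symm (e x) = x := extChartAt_to_inv x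
  rw [h4, h3.mfderiv, h5, add_comm]
  rfl

theorem isBoundedBilinearMap_apply_real :
    IsBoundedBilinearMap ℝ fun p : EndAmb n × Amb n => p.1 p.2 where
  add_left _ _ _ := rfl
  smul_left _ _ _ := rfl
  add_right _ _ _ := map_add _ _ _
  smul_right c T v := T.map_smul_of_tower c v
  bound := (isBoundedBilinearMap_apply (𝕜 := ℂ) (E := Amb n) (F := Amb n)).bound

theorem dEnd_mul {φ ψ : M → EndAmb n} (hφ : SmoothEnd φ) (hψ : SmoothEnd ψ) (x : M)
    (X : TangentSpace 𝓘(ℝ, ℂ) x) :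
    dEnd (fun y => φ y * ψ y) x X = dEnd φ x X * ψ x + φ x * dEnd ψ x X :=
  mvfderiv_bilinear (ContinuousLinearMap.mul ℝ (EndAmb n)).isBoundedBilinearMap
    (hφ.mdifferentiableAt x) (hψ.mdifferentiableAt x) X

theorem triv_apply {φ : M → EndAmb n} {s : M → Amb n} (hφ : SmoothEnd φ) (hs : SmoothSec s)
    (x : M) (X : TangentSpace 𝓘(ℝ, ℂ) x) :
    triv (fun y => φ y (s y)) x X = dEnd φ x X (s x) + φ x (triv s x X) :=
  mvfderiv_bilinear (B := fun p : EndAmb n × Amb n => p.1 p.2)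
    isBoundedBilinearMap_apply_real
    (hφ.mdifferentiableAt x) (hs.mdifferentiableAt x) X

theorem dEnd_add {φ ψ : M → EndAmb n} (hφ : SmoothEnd φ) (hψ : SmoothEnd ψ) (x : M) 
    (X : TangentSpace 𝓘(ℝ, ℂ) x) :
    dEnd (fun y => φ y + ψ y) x X = dEnd φ x X + dEnd ψ x X := by
  have := mvfderiv_add (hφ.mdifferentiableAt x) (hψ.mdifferentiableAt x)
  exact congrArg (fun T => T X) this

theorem dEnd_const (T : EndAmb n) (x : M) : dEnd (fun _ : M => T) x = 0 :=
  mvfderiv_const T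

theorem dEnd_const_smul {φ : M → EndAmb n} (hφ : SmoothEnd φ) (c : ℂ) (x : M)
    (X : TangentSpace 𝓘(ℝ, ℂ) x) :
    dEnd (fun y => c • φ y) x X = c • dEnd φ x X := by
  -- A complex scalar acts as the constant section c • 1, so the Leibniz rule applies.
  have := dEnd_mul (SmoothEnd.const (c • (1 : EndAmb n))) hφ x X
  simpa [dEnd_const] using this

theorem triv_const (v : Amb n) (x : M) : triv (fun _ : M => v) x = 0 :=
  mvfderiv_const v

theorem triv_add {s t : M → Amb n} (hs : SmoothSec s) (ht : SmoothSec t) (x : M) 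
    (X : TangentSpace 𝓘(ℝ, ℂ) x) :
    triv (fun y => s y + t y) x X = triv s x X + triv t x X := by
  have := mvfderiv_add (hs.mdifferentiableAt x) (ht.mdifferentiableAt x)
  exact congrArg (fun T => T X) this

theorem triv_const_smul {s : M → Amb n} (hs : SmoothSec s) (c : ℂ) (x : M)
    (X : TangentSpace 𝓘(ℝ, ℂ) x) :
    triv (fun y => c • s y) x X = c • triv s x X := by
  have := triv_apply (SmoothEnd.const (c • (1 : EndAmb n))) hs x X
  simpa [dEnd_const] using this

variable [IsManifold 𝓘(ℂ) ω M]

theorem smooth_mvfderiv_apply {E : Type*} [NormedAddCommGroup E] [NormedSpace ℝ E] {f : M → E}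
    (hf : ContMDiff 𝓘(ℝ, ℂ) 𝓘(ℝ, E) ∞ f) {X : VecField M} (hX : SmoothVec X) :
    ContMDiff 𝓘(ℝ, ℂ) 𝓘(ℝ, E) ∞ fun x => mvfderiv 𝓘(ℝ, ℂ) f x (X x) := by
  have : IsManifold 𝓘(ℝ, ℂ) 1 M := IsManifold.of_le (n := ω) (by simp)
  have h1 := (hf.contMDiff_tangentMap (m := ∞) (by simp)).comp hX
  exact (contMDiff_snd_tangentBundle_modelSpace E 𝓘(ℝ, E)).comp h1

theorem SmoothSec.triv {s : M → Amb n} (hs : SmoothSec s) {X : VecField M} (hX : SmoothVec X) :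
    SmoothSec fun x => triv s x (X x) := smooth_mvfderiv_apply hs hX

theorem SmoothEnd.dEnd {φ : M → EndAmb n} (hφ : SmoothEnd φ) : SmoothForm (dEnd φ) :=
  fun _ hX => smooth_mvfderiv_apply hφ hX

/-- Transition maps are holomorphic, so their real derivative is the complex one with scalars
restricted and commutes with i. Hence `tangentJ`, defined fibrewise, preserves smoothness of vector
fields, and the types (1,0) and (0,1) of a smooth form are smooth. -/
theorem tangentCoordChange_I {x y z : M} (hx : z ∈ (extChartAt 𝓘(ℝ, ℂ) x).source)
    (hy : z ∈ (extChartAt 𝓘(ℝ, ℂ) y).source) (v : ℂ) :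
    tangentCoordChange 𝓘(ℝ, ℂ) x y z (Complex.I * v) =
      Complex.I * tangentCoordChange 𝓘(ℝ, ℂ) x y z v := by
  have : IsManifold 𝓘(ℝ, ℂ) 1 M := IsManifold.of_le (n := ω) (by simp)
  have : IsManifold 𝓘(ℂ) 1 M := IsManifold.of_le (n := ω) (by simp)
  have h1 := hasFDerivWithinAt_tangentCoordChange (I := 𝓘(ℝ, ℂ)) ⟨hx, hy⟩
  have h2 := hasFDerivWithinAt_tangentCoordChange (I := 𝓘(ℂ)) (x := x) (y := y) (z := z)
    ⟨by simpa using hx, by simpa using hy⟩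
  have h3 : HasFDerivWithinAt ((extChartAt 𝓘(ℝ, ℂ) y) ∘ (extChartAt 𝓘(ℝ, ℂ) x).symm)
    ((tangentCoordChange 𝓘(ℂ) x y z).restrictScalars ℝ) (Set.range 𝓘(ℝ, ℂ))
    (extChartAt 𝓘(ℝ, ℂ) x z) := h2.restrictScalars ℝ
  have h4 : tangentCoordChange 𝓘(ℝ, ℂ) x y z =
      (tangentCoordChange 𝓘(ℂ) x y z).restrictScalars ℝ := by
    simp only [modelWithCornersSelf_coe, Set.range_id, hasFDerivWithinAt_univ] at h1 h3
    exact h1.unique h3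
  rw [h4]
  exact (tangentCoordChange 𝓘(ℂ) x y z).map_smul Complex.I v

theorem SmoothVec.tangentJ {X : VecField M} (hX : SmoothVec X) :
    SmoothVec fun x => tangentJ x (X x) := by
  have : IsManifold 𝓘(ℝ, ℂ) 1 M := IsManifold.of_le (n := ω) (by simp)
  intro x₀
  have h := (Bundle.contMDiffAt_section x₀).1 (hX x₀)
  refine (Bundle.contMDiffAt_section x₀).2 ?_
  have hJ : ContDiff ℝ ∞ fun v : ℂ => Complex.I * v := contDiff_const.mul contDiff_id
  refine (hJ.comp_contMDiffAt h).congr_of_eventuallyEq ?_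
  filter_upwards [(isOpen_extChartAt_source (I := 𝓘(ℝ, ℂ)) x₀).mem_nhds
    (mem_extChartAt_source x₀)] with y hy
  exact tangentCoordChange_I (mem_extChartAt_source y) hy (X y)

end Calculus

/-! ### Maps with vanishing derivative on a connected surface -/

section LocallyConstant

variable {M : Type*} [TopologicalSpace M] [ChartedSpace ℂ M] {n : ℕ} [ConnectedSpace M]
  [IsManifold 𝓘(ℂ) ω M]

theorem eq_of_mvfderiv_eq_zero {E : Type*} [NormedAddCommGroup E] [NormedSpace ℝ E]
    {f : M → E}
    (hf : ContMDiff 𝓘(ℝ, ℂ) 𝓘(ℝ, E) ∞ f) (h0 : ∀ x, mvfderiv 𝓘(ℝ, ℂ) f x = 0) (x y : M) :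
    f x = f y := by
  have key : IsLocallyConstant f := by
    rw [IsLocallyConstant.iff_eventually_eq]
    intro x
    set e := extChartAt 𝓘(ℝ, ℂ) x with he
    have hopen : IsOpen e.target := isOpen_extChartAt_target x
    obtain ⟨r, hr, hball⟩ := Metric.isOpen_iff.1 hopen (e x) (mem_extChartAt_target x)
    -- On a ball in the chart the derivative of f is that of a composite with `mvfderiv` = 0;
    -- convexity of the ball then makes f constant near x.
    have hmd : ∀ z ∈ Metric.ball (e x) r, HasFDerivAt (f ∘ e.symm) (0 : ℂ →L[ℝ] E) z := by
      intro z hz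
      have h1 := ((hf (e.symm z)).mdifferentiableAt (by simp)).hasMFDerivAt
      have h2 : mfderiv 𝓘(ℝ, ℂ) 𝓘(ℝ, E) f (e.symm z) = 0 := h0 (e.symm z)
      rw [h2] at h1
      have h3 := ((contMDiffOn_extChartAt_symm (n := 1) x).contMDiffAt
        (hopen.mem_nhds (hball hz))).mdifferentiableAt (by simp)
      have h4 := h1.comp z h3.hasMFDerivAt
      rw [hasMFDerivAt_iff_hasFDerivAt] at h4
      exact h4.congr_fderiv (ContinuousLinearMap.ext fun v => rfl)
    have hc : ∀ z ∈ Metric.ball (e x) r, (f ∘ e.symm) z = (f ∘ e.symm) (e x) := by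
      intro z hz
      have := (convex_ball (e x) r).is_const_of_fderivWithin_eq_zero (𝕜 := ℝ) (f := f ∘ e.symm)
        (fun z hz => (hmd z hz).differentiableAt.differentiableWithinAt)
        (fun z hz => ((hmd z hz).hasFDerivWithinAt).fderivWithin
          (Metric.isOpen_ball.uniqueDiffWithinAt hz)) hz (Metric.mem_ball_self hr)
      exact this
    have hcont := (continuousAt_extChartAt (I := 𝓘(ℝ, ℂ)) x).preimage_mem_nhds
      (Metric.ball_mem_nhds _ hr)
    filter_upwards [hcont, extChartAt_source_mem_nhds (I := 𝓘(ℝ, ℂ)) x] with y hy hys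
    have h := hc _ hy
    rw [Function.comp_apply, Function.comp_apply, he, PartialEquiv.left_inv _ hys,
      extChartAt_to_inv] at h
    exact h
  exact key.apply_eq_of_isPreconnected isPreconnected_univ trivial trivial

end LocallyConstant

/-! ### The complexified Lorentz metric, projections, reflections, skew maps -/

section LinearAlgebra

variable {n : ℕ}

theorem metric_apply (u v : Amb n) :
    metric n u v = ∑ i, (if i = Fin.last (n + 1) then -1 else 1) * (u i * v i) := rfl

theorem metric_comm (u v : Amb n) : metric n u v = metric n v u := by
  simp only [metric_apply, mul_comm]

theorem eq_zero_of_metric {u : Amb n} (h : ∀ v, metric n u v = 0) : u = 0 := by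
  ext i
  have h1 := h (EuclideanSpace.single i 1)
  rw [metric_apply, Finset.sum_eq_single i] at h1
  · simp only [PiLp.single_apply, if_true, mul_one] at h1
    split_ifs at h1 <;> simpa using h1
  · intro j _ hj
    simp [hj]
  · simp

theorem ext_metric {u v : Amb n} (h : ∀ w, metric n u w = metric n v w) : u = v := by
  rw [← sub_eq_zero]
  refine eq_zero_of_metric fun w => ?_
  rw [map_sub, LinearMap.sub_apply, h, sub_self]

theorem metric_isSymm : (metric n).IsSymm := ⟨fun u v => metric_comm u v⟩

theorem metric_isRefl : (metric n).IsRefl := metric_isSymm.isRefl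

theorem metric_nondegenerate : (metric n).Nondegenerate :=
  metric_isRefl.nondegenerate_iff_separatingLeft.2 fun _ h => eq_zero_of_metric h

theorem mem_perp {W : Submodule ℂ (Amb n)} {v : Amb n} :
    v ∈ perp W ↔ ∀ w ∈ W, metric n w v = 0 := Iff.rfl

theorem perp_perp (W : Submodule ℂ (Amb n)) : perp (perp W) = W :=
  LinearMap.BilinForm.orthogonal_orthogonal metric_nondegenerate metric_isRefl W

theorem IsNondeg.isCompl {W : Submodule ℂ (Amb n)} (h : IsNondeg W) : IsCompl W (perp W) :=
  (LinearMap.BilinForm.isCompl_orthogonal_iff_disjoint metric_isRefl).2 (disjoint_iff.2 h)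

/-! ### Projections -/

/-- The four conditions already force W and W' to be complementary, so the default value 0 of
`projAlong` never interferes. -/
theorem projAlong_eq {W W' : Submodule ℂ (Amb n)} {P : EndAmb n} (h1 : ∀ v, P v ∈ W)
    (h2 : ∀ v, v - P v ∈ W') (h3 : ∀ v ∈ W, P v = v) (h4 : ∀ v ∈ W', P v = 0) :
    projAlong W W' = P := by
  have hc : IsCompl W W' := by
    refine ⟨Submodule.disjoint_def.2 fun v hv hv' => ?_, ?_⟩
    · rw [← h3 v hv, h4 v hv']
    · refine codisjoint_iff.2 (eq_top_iff.2 fun v _ => ?_)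
      exact Submodule.mem_sup.2 ⟨P v, h1 v, v - P v, h2 v, by abel⟩
  rw [projAlong, dif_pos hc]
  ext1 v
  have h5 : v = P v + (v - P v) := by abel
  change W.projection W' hc v = P v
  conv_lhs => rw [h5]
  rw [map_add, Submodule.projection_apply_of_mem_left hc (h1 v),
    Submodule.projection_apply_of_mem_right hc (h2 v), add_zero]

theorem projAlong_mem {W W' : Submodule ℂ (Amb n)} (h : IsCompl W W') (v : Amb n) :
    projAlong W W' v ∈ W := by
  rw [projAlong, dif_pos h]
  exact Submodule.projection_apply_mem h v

theorem projAlong_of_mem {W W' : Submodule ℂ (Amb n)} (h : IsCompl W W') {v : Amb n}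
    (hv : v ∈ W) : projAlong W W' v = v := by
  rw [projAlong, dif_pos h]
  exact Submodule.projection_apply_of_mem_left h hv

theorem projAlong_of_mem_right {W W' : Submodule ℂ (Amb n)} (h : IsCompl W W') {v : Amb n}
    (hv : v ∈ W') : projAlong W W' v = 0 := by
  rw [projAlong, dif_pos h]
  exact Submodule.projection_apply_of_mem_right h hv

theorem sub_projAlong_mem {W W' : Submodule ℂ (Amb n)} (h : IsCompl W W') (v : Amb n) :
    v - projAlong W W' v ∈ W' := by
  obtain ⟨a, ha, b, hb, rfl⟩ := Submodule.mem_sup.1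
    (show v ∈ W ⊔ W' by rw [h.sup_eq_top]; trivial)
  rw [map_add, projAlong_of_mem h ha, projAlong_of_mem_right h hb]
  simpa using hb

theorem orthProj_add_orthProj_perp {W : Submodule ℂ (Amb n)} (h : IsNondeg W) :
    orthProj W + orthProj (perp W) = 1 := by
  have h1 : orthProj (perp W) = 1 - orthProj W := by
    rw [orthProj, perp_perp]
    refine projAlong_eq (fun v => sub_projAlong_mem h.isCompl v) (fun v => ?_) (fun v hv => ?_)
      fun v hv => ?_
    · simpa [orthProj] using projAlong_mem h.isCompl v
    · simp [orthProj, projAlong_of_mem_right h.isCompl hv]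
    · simp [orthProj, projAlong_of_mem h.isCompl hv]
  rw [h1]; abel

theorem reflection_eq {W : Submodule ℂ (Amb n)} (h : IsNondeg W) :
    reflection W = (2 : ℂ) • orthProj W - 1 := by
  rw [reflection, ← orthProj_add_orthProj_perp h]; module

theorem orthProj_eq {W : Submodule ℂ (Amb n)} (h : IsNondeg W) :
    orthProj W = (1 / 2 : ℂ) • (1 + reflection W) := by
  rw [reflection_eq h]; module

theorem orthProj_perp_eq {W : Submodule ℂ (Amb n)} (h : IsNondeg W) :
    orthProj (perp W) = (1 / 2 : ℂ) • (1 - reflection W) := by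
  rw [← sub_eq_of_eq_add' (orthProj_add_orthProj_perp h).symm, orthProj_eq h]; module

theorem reflection_of_mem {W : Submodule ℂ (Amb n)} (h : IsNondeg W) {v : Amb n} (hv : v ∈ W) :
    reflection W v = v := by
  rw [reflection_eq h]
  simp only [orthProj, sub_apply, smul_apply,
    projAlong_of_mem h.isCompl hv, one_apply_eq_self]
  module

theorem reflection_of_mem_perp {W : Submodule ℂ (Amb n)} (h : IsNondeg W) {v : Amb n}
    (hv : v ∈ perp W) : reflection W v = -v := by
  rw [reflection_eq h]
  simp [orthProj, projAlong_of_mem_right h.isCompl hv]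

theorem mem_iff_reflection {W : Submodule ℂ (Amb n)} (h : IsNondeg W) {v : Amb n} :
    v ∈ W ↔ reflection W v = v := by
  refine ⟨reflection_of_mem h, fun hv => ?_⟩
  have h1 : orthProj W v = v := by
    rw [orthProj_eq h]
    simp only [smul_apply, add_apply,
      one_apply_eq_self, hv]
    module
  rw [← h1]
  exact projAlong_mem h.isCompl v

theorem exists_add_of_isNondeg {W : Submodule ℂ (Amb n)} (h : IsNondeg W) (v : Amb n) :
    ∃ a ∈ W, ∃ b ∈ perp W, v = a + b := by
  obtain ⟨a, ha, b, hb, hab⟩ := Submodule.mem_sup.1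
    (show v ∈ W ⊔ perp W by rw [h.isCompl.sup_eq_top]; trivial)
  exact ⟨a, ha, b, hb, hab.symm⟩

theorem reflection_mul_self {W : Submodule ℂ (Amb n)} (h : IsNondeg W) :
    reflection W * reflection W = 1 := by
  ext1 v
  obtain ⟨a, ha, b, hb, rfl⟩ := exists_add_of_isNondeg h v
  simp [reflection_of_mem h ha, reflection_of_mem_perp h hb]

theorem metric_reflection {W : Submodule ℂ (Amb n)} (h : IsNondeg W) (u v : Amb n) :
    metric n (reflection W u) v = metric n u (reflection W v) := by
  obtain ⟨a, ha, b, hb, rfl⟩ := exists_add_of_isNondeg h u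
  obtain ⟨a', ha', b', hb', rfl⟩ := exists_add_of_isNondeg h v
  simp only [map_add, reflection_of_mem h ha, reflection_of_mem_perp h hb,
    reflection_of_mem h ha', reflection_of_mem_perp h hb', map_neg, LinearMap.add_apply,
    LinearMap.neg_apply, hb' a ha, metric_comm b a', hb a' ha']
  ring

theorem isOrth_reflection {W : Submodule ℂ (Amb n)} (h : IsNondeg W) :
    IsOrth (reflection W) := fun u v => by
  rw [metric_reflection h, ← mul_apply_eq_comp, reflection_mul_self h]; rfl

/-! ### The orthogonal group -/

theorem IsOrth.isUnit {T : EndAmb n} (h : IsOrth T) : IsUnit T := by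
  have hinj : Function.Injective (T : Amb n →ₗ[ℂ] Amb n) := by
    intro u v huv
    refine ext_metric fun w => ?_
    have huv' : T u = T v := huv
    rw [← h u w, huv', h]
  rw [ContinuousLinearMap.isUnit_iff_bijective]
  exact ⟨hinj, LinearMap.injective_iff_surjective.1 hinj⟩

theorem inv_mul_self {T : EndAmb n} (h : IsUnit T) : inv T * T = 1 := Ring.inverse_mul_cancel T h

theorem mul_inv_self {T : EndAmb n} (h : IsUnit T) : T * inv T = 1 := Ring.mul_inverse_cancel T h

theorem inv_apply_self {T : EndAmb n} (h : IsUnit T) (v : Amb n) : inv T (T v) = v := by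
  rw [← mul_apply_eq_comp, inv_mul_self h]; rfl

theorem apply_inv_self {T : EndAmb n} (h : IsUnit T) (v : Amb n) : T (inv T v) = v := by
  rw [← mul_apply_eq_comp, mul_inv_self h]; rfl

theorem isUnit_inv {T : EndAmb n} (h : IsUnit T) : IsUnit (inv T) := h.ringInverse

theorem inv_inv {T : EndAmb n} (h : IsUnit T) : inv (inv T) = T := by
  obtain ⟨u, rfl⟩ := h
  simp [inv]

theorem inv_eq_of_mul_eq_one {S T : EndAmb n} (h : S * T = 1) (h' : T * S = 1) : inv T = S := by
  have : IsUnit T := ⟨⟨T, S, h', h⟩, rfl⟩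
  rw [← one_mul (inv T), ← h, mul_assoc, mul_inv_self this, mul_one]

theorem inv_mul {S T : EndAmb n} (hS : IsUnit S) (hT : IsUnit T) :
    inv (S * T) = inv T * inv S := by
  obtain ⟨s, rfl⟩ := hS
  obtain ⟨t, rfl⟩ := hT
  simp only [inv, ← Units.val_mul, Ring.inverse_unit, mul_inv_rev]

theorem IsOrth.inv {T : EndAmb n} (h : IsOrth T) : IsOrth (inv T) := fun u v => by
  rw [← h, apply_inv_self h.isUnit, apply_inv_self h.isUnit]

theorem IsOrth.mul {S T : EndAmb n} (hS : IsOrth S) (hT : IsOrth T) : IsOrth (S * T) :=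
  fun u v => by
    rw [mul_apply_eq_comp, mul_apply_eq_comp, hS, hT]

theorem mem_img {T : EndAmb n} {W : Submodule ℂ (Amb n)} {v : Amb n} :
    v ∈ img T W ↔ ∃ w ∈ W, T w = v := Iff.rfl

theorem apply_mem_img {T : EndAmb n} {W : Submodule ℂ (Amb n)} {v : Amb n} (hv : v ∈ W) :
    T v ∈ img T W := ⟨v, hv, rfl⟩

theorem mem_img_iff {T : EndAmb n} (h : IsUnit T) {W : Submodule ℂ (Amb n)} {v : Amb n} :
    v ∈ img T W ↔ inv T v ∈ W := by
  refine ⟨?_, fun hv => ⟨_, hv, apply_inv_self h v⟩⟩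
  rintro ⟨w, hw, rfl⟩
  exact (inv_apply_self h w).symm ▸ hw

theorem img_img (S T : EndAmb n) (W : Submodule ℂ (Amb n)) : img S (img T W) = img (S * T) W := by
  ext v; simp [mem_img]

theorem img_one (W : Submodule ℂ (Amb n)) : img (1 : EndAmb n) W = W := by
  ext v; simp [mem_img]

theorem img_sup (T : EndAmb n) (W W' : Submodule ℂ (Amb n)) :
    img T (W ⊔ W') = img T W ⊔ img T W' := Submodule.map_sup _ _ _

theorem img_inf {T : EndAmb n} (h : IsUnit T) (W W' : Submodule ℂ (Amb n)) :
    img T (W ⊓ W') = img T W ⊓ img T W' := by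
  ext v; simp [mem_img_iff h]

theorem img_bot (T : EndAmb n) : img T (⊥ : Submodule ℂ (Amb n)) = ⊥ := Submodule.map_bot _

theorem perp_img {T : EndAmb n} (h : IsOrth T) (W : Submodule ℂ (Amb n)) :
    perp (img T W) = img T (perp W) := by
  ext v
  rw [mem_img_iff h.isUnit, mem_perp, mem_perp]
  constructor
  · intro hv w hw
    rw [← h, apply_inv_self h.isUnit]
    exact hv _ (apply_mem_img hw)
  · rintro hv _ ⟨w, hw, rfl⟩
    have := hv w hw
    rwa [← h, apply_inv_self h.isUnit] at this

theorem IsNondeg.img {T : EndAmb n} (h : IsOrth T) {W : Submodule ℂ (Amb n)} (hW : IsNondeg W) :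
    IsNondeg (img T W) := by
  rw [IsNondeg, perp_img h, ← img_inf h.isUnit, hW, img_bot]

theorem IsNull.img {T : EndAmb n} (h : IsOrth T) {W : Submodule ℂ (Amb n)} (hW : IsNull W) :
    IsNull (img T W) := by
  rintro _ ⟨u, hu, rfl⟩ _ ⟨v, hv, rfl⟩
  exact (h u v).trans (hW u hu v hv)

theorem isCompl_img {T : EndAmb n} (h : IsUnit T) {W W' : Submodule ℂ (Amb n)}
    (hc : IsCompl W W') : IsCompl (img T W) (img T W') := by
  rw [isCompl_iff, disjoint_iff, codisjoint_iff, ← img_inf h, ← img_sup, hc.inf_eq_bot,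
    hc.sup_eq_top, img_bot]
  refine ⟨rfl, eq_top_iff.2 fun v _ => (mem_img_iff h).2 trivial⟩

theorem img_inv_img {T : EndAmb n} (h : IsUnit T) (W : Submodule ℂ (Amb n)) :
    img (inv T) (img T W) = W := by
  rw [img_img, inv_mul_self h, img_one]

theorem projAlong_img {T : EndAmb n} (h : IsUnit T) (W W' : Submodule ℂ (Amb n)) :
    projAlong (img T W) (img T W') = T * projAlong W W' * inv T := by
  by_cases hc : IsCompl W W'
  · refine projAlong_eq (fun v => apply_mem_img (projAlong_mem hc _)) (fun v => ?_) ?_ ?_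
    · rw [mem_img_iff h, map_sub]
      simp only [mul_apply_eq_comp, inv_apply_self h]
      exact sub_projAlong_mem hc _
    · rintro _ ⟨v, hv, rfl⟩
      change T (projAlong W W' (inv T (T v))) = T v
      rw [inv_apply_self h, projAlong_of_mem hc hv]
    · rintro _ ⟨v, hv, rfl⟩
      change T (projAlong W W' (inv T (T v))) = 0
      rw [inv_apply_self h, projAlong_of_mem_right hc hv, map_zero]
  -- Complementarity is invariant under T, so if it fails, both sides take the default value 0.
  · have hc' : ¬ IsCompl (img T W) (img T W') := fun h' => hc <| by
      simpa only [img_inv_img h] using isCompl_img (isUnit_inv h) h'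
    rw [projAlong, projAlong, dif_neg hc, dif_neg hc', mul_zero, zero_mul]

theorem orthProj_img {T : EndAmb n} (h : IsOrth T) (W : Submodule ℂ (Amb n)) :
    orthProj (img T W) = T * orthProj W * inv T := by
  rw [orthProj, perp_img h, projAlong_img h.isUnit, orthProj]

theorem reflection_img {T : EndAmb n} (h : IsOrth T) (W : Submodule ℂ (Amb n)) :
    reflection (img T W) = T * reflection W * inv T := by
  rw [reflection, perp_img h, orthProj_img h, orthProj_img h, reflection, mul_sub, sub_mul]

theorem boost_img {T : EndAmb n} (h : IsOrth T) (c : ℂ) (L L' : Submodule ℂ (Amb n)) :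
    boost c (img T L) (img T L') = T * boost c L L' * inv T := by
  simp only [boost, ← img_sup, perp_img h, projAlong_img h.isUnit, orthProj_img h, mul_add, add_mul,
    mul_smul_comm, smul_mul_assoc]

/-! ### Skew endomorphisms -/

/-- Endomorphisms that are skew for the metric. -/
def IsSkew (A : EndAmb n) : Prop := ∀ u v, metric n (A u) v = -metric n u (A v)

theorem IsSkew.add {A B : EndAmb n} (hA : IsSkew A) (hB : IsSkew B) : IsSkew (A + B) :=
  fun u v => by
    simp only [add_apply, map_add, LinearMap.add_apply, hA u v, hB u v]; ring

theorem IsSkew.sub {A B : EndAmb n} (hA : IsSkew A) (hB : IsSkew B) : IsSkew (A - B) :=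
  fun u v => by
    simp only [sub_apply, map_sub, LinearMap.sub_apply, hA u v, hB u v]; ring

theorem IsSkew.smul {A : EndAmb n} (hA : IsSkew A) (c : ℂ) : IsSkew (c • A) :=
  fun u v => by
    simp only [smul_apply, map_smul, LinearMap.smul_apply, hA u v, smul_neg]

theorem wedge_apply (u v w : Amb n) : wedge u v w = metric n u w • v - metric n v w • u := rfl

theorem isSkew_wedge (u v : Amb n) : IsSkew (wedge u v) := fun a b => by
  simp only [wedge_apply, map_sub, map_smul, LinearMap.sub_apply, LinearMap.smul_apply,
    smul_eq_mul, metric_comm a]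
  ring

theorem isSkew_of_mem_wedge2 {W : Submodule ℂ (Amb n)} {A : EndAmb n} (h : A ∈ wedge2 W) :
    IsSkew A := by
  refine Submodule.span_induction ?_ ?_ (fun _ _ _ _ => IsSkew.add)
    (fun c _ _ hA => hA.smul c) h
  · rintro _ ⟨u, -, v, -, rfl⟩; exact isSkew_wedge u v
  · intro u v; simp

theorem conj_wedge {T : EndAmb n} (h : IsOrth T) (u v : Amb n) :
    T * wedge u v * inv T = wedge (T u) (T v) := by
  ext1 w
  obtain ⟨w, rfl⟩ : ∃ w', w = T w' := ⟨inv T w, (apply_inv_self h.isUnit w).symm⟩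
  simp only [mul_apply_eq_comp, inv_apply_self h.isUnit, wedge_apply, map_sub, map_smul,
    h u w, h v w]

theorem conj_mem_wedge2 {T : EndAmb n} (h : IsOrth T) {W : Submodule ℂ (Amb n)} {A : EndAmb n}
    (hA : A ∈ wedge2 W) : T * A * inv T ∈ wedge2 (img T W) := by
  refine Submodule.span_induction ?_ ?_ (fun a b _ _ ha hb => ?_) (fun c a _ ha => ?_) hA
  · rintro _ ⟨u, hu, v, hv, rfl⟩
    rw [conj_wedge h]
    exact Submodule.subset_span ⟨_, apply_mem_img hu, _, apply_mem_img hv, rfl⟩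
  · simp
  · rw [mul_add, add_mul]; exact add_mem ha hb
  · rw [mul_smul_comm, smul_mul_assoc]; exact Submodule.smul_mem _ _ ha

theorem conj_mem_wedge2_sup {T : EndAmb n} (h : IsOrth T) {W : Submodule ℂ (Amb n)}
    {A : EndAmb n} (hA : A ∈ wedge2 W ⊔ wedge2 (perp W)) :
    T * A * inv T ∈ wedge2 (img T W) ⊔ wedge2 (perp (img T W)) := by
  obtain ⟨a, ha, b, hb, rfl⟩ := Submodule.mem_sup.1 hA
  rw [mul_add, add_mul, perp_img h]
  exact Submodule.add_mem_sup (conj_mem_wedge2 h ha) (conj_mem_wedge2 h hb)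

theorem isSkew_of_mem {W : Submodule ℂ (Amb n)} {A : EndAmb n}
    (hA : A ∈ wedge2 W ⊔ wedge2 (perp W)) : IsSkew A := by
  obtain ⟨a, ha, b, hb, rfl⟩ := Submodule.mem_sup.1 hA
  exact (isSkew_of_mem_wedge2 ha).add (isSkew_of_mem_wedge2 hb)

theorem reflection_inv {W : Submodule ℂ (Amb n)} (h : IsNondeg W) :
    inv (reflection W) = reflection W :=
  inv_eq_of_mul_eq_one (reflection_mul_self h) (reflection_mul_self h)

/-- The reflection is ±1 on W and on its complement, hence (±1)² = 1 on both exterior squares. This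
is the evenness of q under ρ. -/
theorem reflection_conj_of_mem {W : Submodule ℂ (Amb n)} (h : IsNondeg W) {A : EndAmb n}
    (hA : A ∈ wedge2 W ⊔ wedge2 (perp W)) : reflection W * A * reflection W = A := by
  have key : ∀ U : Submodule ℂ (Amb n), ∀ ε : ℂ, ε * ε = 1 → (∀ v ∈ U, reflection W v = ε • v) →
      ∀ a ∈ wedge2 U, reflection W * a * reflection W = a := by
    intro U ε hε hU a ha
    refine Submodule.span_induction ?_ ?_ (fun a b _ _ ha hb => ?_) (fun c a _ ha => ?_) ha
    · rintro _ ⟨u, hu, v, hv, rfl⟩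
      have := conj_wedge (isOrth_reflection h) u v
      rw [reflection_inv h] at this
      have h2 : wedge (ε • u) (ε • v) = (ε * ε) • wedge u v := by
        ext1 w
        simp only [wedge_apply, smul_apply, map_smul, LinearMap.smul_apply, smul_eq_mul]
        module
      rw [this, hU u hu, hU v hv, h2, hε, one_smul]
    · simp
    · rw [mul_add, add_mul, ha, hb]
    · rw [mul_smul_comm, smul_mul_assoc, ha]
  obtain ⟨a, ha, b, hb, rfl⟩ := Submodule.mem_sup.1 hA
  rw [mul_add, add_mul, key W 1 (by simp) (fun v hv => by simp [reflection_of_mem h hv]) a ha,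
    key (perp W) (-1) (by simp) (fun v hv => by simp [reflection_of_mem_perp h hv]) b hb]

end LinearAlgebra

/-! ### Boosts along a null line and its reflection -/

section BoostFrames

variable {n : ℕ}

/-- For complementary idempotents `P`, `Q` with `P Q = Q P = 0`: the endomorphism `c` on the image
of `P`, `c⁻¹` on the image of `Q` and `1` on the common kernel. -/
noncomputable def bst (P Q : EndAmb n) (c : ℂ) : EndAmb n := c • P + (1 - P - Q) + c⁻¹ • Q

/-- The relations between the projections onto a null line and onto its image under a
reflection `ρ`. -/
structure IsBoostFrame (ρ P Q : EndAmb n) : Prop where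
  PP : P * P = P
  QQ : Q * Q = Q
  PQ : P * Q = 0
  QP : Q * P = 0
  conj : ρ * P * ρ = Q
  adj : ∀ u v, metric n (P u) v = metric n u (Q v)
  QSP : ∀ S, IsSkew S → Q * S * P = 0
  PSQ : ∀ S, IsSkew S → P * S * Q = 0

/-- The projection onto the line of `s` with kernel the orthogonal complement of `s'`. -/
noncomputable def rankOneProj (s s' : Amb n) : EndAmb n :=
  (metric n s' s)⁻¹ • LinearMap.toContinuousLinearMap ((metric n s').smulRight s)

theorem rankOneProj_apply (s s' v : Amb n) :
    rankOneProj s s' v = ((metric n s' s)⁻¹ * metric n s' v) • s := by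
  simp [rankOneProj, smul_smul]

/-- The relations rest on s and ρs being null and ρ being self-adjoint. For the last two, skewness
of S gives (v, Sv) = 0, and the scalars in Q S P and P S Q are multiples of (s, Ss) and (ρs, Sρs).
-/
theorem rankOneProj_boostFrame {ρ : EndAmb n} (hρ : ρ * ρ = 1)
    (hρs : ∀ u v, metric n (ρ u) v = metric n u (ρ v)) {s : Amb n} (hs : metric n s s = 0)
    (h : metric n (ρ s) s ≠ 0) :
    IsBoostFrame ρ (rankOneProj s (ρ s)) (rankOneProj (ρ s) s) := by
  have hρρ : ∀ v, ρ (ρ v) = v := fun v => by rw [← mul_apply_eq_comp, hρ]; rfl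
  have h1 : metric n (ρ s) (ρ s) = 0 := by rw [hρs, hρρ, hs]
  have h2 : metric n s (ρ s) = metric n (ρ s) s := metric_comm _ _
  have h3 : ∀ S : EndAmb n, IsSkew S → ∀ v, metric n v (S v) = 0 := fun S hS v => by
    have := hS v v
    rw [metric_comm] at this
    exact self_eq_neg.1 this
  refine ⟨?_, ?_, ?_, ?_, ?_, ?_, ?_, ?_⟩
  · ext1 v
    simp only [mul_apply_eq_comp, rankOneProj_apply, map_smul, inv_mul_cancel₀ h, one_smul]
  · ext1 v
    simp only [mul_apply_eq_comp, rankOneProj_apply, map_smul, h2, inv_mul_cancel₀ h, one_smul]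
  · ext1 v
    simp [rankOneProj_apply, h1]
  · ext1 v
    simp [rankOneProj_apply, hs]
  · ext1 v
    rw [mul_apply_eq_comp, mul_apply_eq_comp, rankOneProj_apply, rankOneProj_apply, map_smul,
      hρs s (ρ v), hρρ, h2]
  · intro u v
    rw [rankOneProj_apply, rankOneProj_apply, map_smul, map_smul, LinearMap.smul_apply, h2,
      smul_eq_mul, smul_eq_mul, metric_comm u (ρ s)]
    ring
  · intro S hS
    ext1 v
    simp [rankOneProj_apply, h3 S hS]
  · intro S hS
    ext1 v
    simp [rankOneProj_apply, h3 S hS]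

theorem projAlong_line {s s' : Amb n} (hs : metric n s s = 0) (hs' : metric n s' s' = 0)
    (h : metric n s' s ≠ 0) :
    projAlong (Submodule.span ℂ {s}) (Submodule.span ℂ {s'} ⊔
        perp (Submodule.span ℂ {s} ⊔ Submodule.span ℂ {s'})) = rankOneProj s s' ∧
      orthProj (perp (Submodule.span ℂ {s} ⊔ Submodule.span ℂ {s'})) =
        1 - rankOneProj s s' - rankOneProj s' s := by
  have h2 : metric n s s' = metric n s' s := metric_comm _ _
  have hperp : ∀ v, v ∈ perp (Submodule.span ℂ {s} ⊔ Submodule.span ℂ {s'}) ↔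
      metric n s v = 0 ∧ metric n s' v = 0 := by
    intro v
    constructor
    · intro hv
      exact ⟨hv s (Submodule.mem_sup_left (Submodule.mem_span_singleton_self s)),
        hv s' (Submodule.mem_sup_right (Submodule.mem_span_singleton_self s'))⟩
    · rintro ⟨h3, h4⟩ w hw
      obtain ⟨a, ha, b, hb, rfl⟩ := Submodule.mem_sup.1 hw
      obtain ⟨a, rfl⟩ := Submodule.mem_span_singleton.1 ha
      obtain ⟨b, rfl⟩ := Submodule.mem_span_singleton.1 hb
      change metric n _ _ = 0
      simp [h3, h4]
  have hres : ∀ v, v - rankOneProj s s' v - rankOneProj s' s v ∈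
      perp (Submodule.span ℂ {s} ⊔ Submodule.span ℂ {s'}) := by
    intro v
    rw [hperp]
    simp only [rankOneProj_apply, map_sub, map_smul, hs, hs', h2, smul_eq_mul]
    constructor <;> field_simp <;> ring
  have hzero : ∀ v ∈ perp (Submodule.span ℂ {s} ⊔ Submodule.span ℂ {s'}),
      rankOneProj s s' v = 0 ∧ rankOneProj s' s v = 0 := by
    intro v hv
    rw [hperp] at hv
    simp [rankOneProj_apply, hv.1, hv.2]
  have hmem : ∀ a b v : Amb n, rankOneProj a b v ∈ Submodule.span ℂ {a} := fun a b v => by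
    rw [rankOneProj_apply]
    exact Submodule.smul_mem _ _ (Submodule.mem_span_singleton_self a)
  constructor
  · refine projAlong_eq (hmem s s') (fun v => ?_) (fun v hv => ?_) fun v hv => ?_
    · refine Submodule.mem_sup.2 ⟨_, hmem s' s v, _, hres v, ?_⟩
      abel
    · obtain ⟨a, rfl⟩ := Submodule.mem_span_singleton.1 hv
      rw [rankOneProj_apply, map_smul, smul_eq_mul]
      field_simp
    · obtain ⟨a, ha, b, hb, rfl⟩ := Submodule.mem_sup.1 hv
      obtain ⟨a, rfl⟩ := Submodule.mem_span_singleton.1 ha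
      rw [map_add, (hzero b hb).1, rankOneProj_apply, map_smul, hs']
      simp
  · rw [orthProj, perp_perp]
    refine projAlong_eq hres (fun v => ?_) (fun v hv => ?_) fun v hv => ?_
    · refine Submodule.mem_sup.2 ⟨_, hmem s s' v, _, hmem s' s v, ?_⟩
      simp only [sub_apply, one_apply_eq_self]
      abel
    · simp [hzero v hv]
    · obtain ⟨a, ha, b, hb, rfl⟩ := Submodule.mem_sup.1 hv
      obtain ⟨a, rfl⟩ := Submodule.mem_span_singleton.1 ha
      obtain ⟨b, rfl⟩ := Submodule.mem_span_singleton.1 hb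
      simp only [sub_apply, one_apply_eq_self, rankOneProj_apply, map_add, map_smul, hs, hs', h2,
        mul_zero, inv_mul_cancel₀ h]
      module

theorem boost_eq_bst {s s' : Amb n} (hs : metric n s s = 0) (hs' : metric n s' s' = 0)
    (h : metric n s' s ≠ 0) (c : ℂ) :
    boost c (Submodule.span ℂ {s}) (Submodule.span ℂ {s'}) =
      bst (rankOneProj s s') (rankOneProj s' s) c := by
  have h2 : metric n s s' = metric n s' s := metric_comm _ _
  have h1 := projAlong_line hs hs' h
  have h3 := projAlong_line hs' hs (h2 ▸ h)
  rw [sup_comm (Submodule.span ℂ {s'}) (Submodule.span ℂ {s})] at h3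
  rw [boost, h1.1, h1.2, h3.1, bst]

variable {ρ P Q : EndAmb n}

namespace IsBoostFrame

theorem bst_mul (h : IsBoostFrame ρ P Q) (c d : ℂ) :
    bst P Q c * bst P Q d = bst P Q (c * d) := by
  simp only [bst, mul_add, add_mul, mul_sub, sub_mul, mul_smul_comm, smul_mul_assoc, one_mul,
    mul_one, h.PP, h.QQ, h.PQ, h.QP, mul_inv]
  module

theorem bst_one : bst P Q 1 = 1 := by
  simp only [bst, one_smul, _root_.inv_one]; abel

theorem bst_mul_inv (h : IsBoostFrame ρ P Q) {c : ℂ} (hc : c ≠ 0) :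
    bst P Q c * bst P Q c⁻¹ = 1 := by
  rw [h.bst_mul, mul_inv_cancel₀ hc, bst_one]

theorem bst_inv_mul (h : IsBoostFrame ρ P Q) {c : ℂ} (hc : c ≠ 0) :
    bst P Q c⁻¹ * bst P Q c = 1 := by
  rw [h.bst_mul, inv_mul_cancel₀ hc, bst_one]

theorem inv_bst (h : IsBoostFrame ρ P Q) {c : ℂ} (hc : c ≠ 0) :
    inv (bst P Q c) = bst P Q c⁻¹ :=
  inv_eq_of_mul_eq_one (h.bst_inv_mul hc) (h.bst_mul_inv hc)

theorem adj' (h : IsBoostFrame ρ P Q) (u v : Amb n) :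
    metric n (Q u) v = metric n u (P v) := by
  rw [metric_comm, ← h.adj, metric_comm]

/-- P and Q are adjoint to each other, so the adjoint of the boost with scalar c is the boost with
scalar c⁻¹, that is, its inverse. -/
theorem isOrth_bst (h : IsBoostFrame ρ P Q) {c : ℂ} (hc : c ≠ 0) : IsOrth (bst P Q c) := by
  intro u v
  have h1 : metric n (bst P Q c u) (bst P Q c v) =
      metric n u (bst P Q c⁻¹ (bst P Q c v)) := by
    simp only [bst, add_apply, sub_apply, smul_apply, one_apply_eq_self, map_add, map_sub,
      map_smul, LinearMap.add_apply, LinearMap.sub_apply, LinearMap.smul_apply, h.adj, h.adj',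
      smul_eq_mul, _root_.inv_inv]
    ring
  rw [h1, ← mul_apply_eq_comp, h.bst_inv_mul hc]
  rfl

/-- Conjugation by ρ swaps P and Q. For p_{α,L} it reads ρ p(μ) ρ = p(μ)⁻¹ = p(-μ). -/
theorem conj_bst (h : IsBoostFrame ρ P Q) (hρ : ρ * ρ = 1) (c : ℂ) :
    ρ * bst P Q c * ρ = bst P Q c⁻¹ := by
  have h1 : ρ * Q * ρ = P := by
    rw [← h.conj]
    calc ρ * (ρ * P * ρ) * ρ = (ρ * ρ) * P * (ρ * ρ) := by noncomm_ring
      _ = P := by rw [hρ, one_mul, mul_one]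
  simp only [bst, mul_add, add_mul, mul_sub, sub_mul, mul_smul_comm, smul_mul_assoc, mul_one,
    h.conj, h1, hρ, _root_.inv_inv]
  abel

end IsBoostFrame

end BoostFrames

/-! ### Smoothness of the reflection across a non-degenerate subbundle -/

section SmoothProjections

variable {M : Type*} [TopologicalSpace M] [ChartedSpace ℂ M] {n : ℕ}

theorem contMDiffAt_of_linear {E F : Type*} [NormedAddCommGroup E] [NormedSpace ℂ E]
    [FiniteDimensional ℂ E] [NormedAddCommGroup F] [NormedSpace ℂ F] (f : E →ₗ[ℂ] F)
    {s : M → E} {x : M} (hs : ContMDiffAt 𝓘(ℝ, ℂ) 𝓘(ℝ, E) ∞ s x) :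
    ContMDiffAt 𝓘(ℝ, ℂ) 𝓘(ℝ, F) ∞ (fun y => f (s y)) x :=
  ((LinearMap.toContinuousLinearMap f).contDiff.restrict_scalars ℝ).contMDiff.contMDiffAt.comp x hs

theorem contMDiffAt_comp_clm {E F G : Type*} [NormedAddCommGroup E] [NormedSpace ℂ E]
    [NormedAddCommGroup F] [NormedSpace ℂ F] [NormedAddCommGroup G] [NormedSpace ℂ G]
    {f : M → F →L[ℂ] G} {g : M → E →L[ℂ] F} {x : M}
    (hf : ContMDiffAt 𝓘(ℝ, ℂ) 𝓘(ℝ, F →L[ℂ] G) ∞ f x)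
    (hg : ContMDiffAt 𝓘(ℝ, ℂ) 𝓘(ℝ, E →L[ℂ] F) ∞ g x) :
    ContMDiffAt 𝓘(ℝ, ℂ) 𝓘(ℝ, E →L[ℂ] G) ∞ (fun y => (f y).comp (g y)) x := by
  have h : ContDiff ℂ ∞ fun p : (F →L[ℂ] G) × (E →L[ℂ] F) => p.1.comp p.2 :=
    contDiff_fst.clm_comp contDiff_snd
  exact (h.restrict_scalars ℝ).contMDiff.contMDiffAt.comp x (hf.prodMk_space hg)

/-- The linear combination of a family of vectors with given coefficients. -/
noncomputable def frameMap {r : ℕ} : (Fin r → Amb n) →ₗ[ℂ] (Fin r → ℂ) →L[ℂ] Amb n :=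
  (LinearMap.toContinuousLinearMap (𝕜 := ℂ) (E := Fin r → ℂ) (F' := Amb n)).toLinearMap ∘ₗ
    (Fintype.bilinearCombination ℂ ℂ)

theorem frameMap_apply {r : ℕ} (s : Fin r → Amb n) (c : Fin r → ℂ) :
    frameMap s c = ∑ i, c i • s i := rfl

/-- The metric products of a vector with a family of vectors. -/
noncomputable def coframeMap {r : ℕ} : (Fin r → Amb n) →ₗ[ℂ] Amb n →L[ℂ] (Fin r → ℂ) where
  toFun s := LinearMap.toContinuousLinearMap (LinearMap.pi fun i => metric n (s i))
  map_add' s t := by ext; simp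
  map_smul' c s := by ext; simp

theorem coframeMap_apply {r : ℕ} (s : Fin r → Amb n) (v : Amb n) (i : Fin r) :
    coframeMap s v i = metric n (s i) v := rfl

theorem span_range_eq {r : ℕ} (s : Fin r → Amb n) (v : Amb n) :
    v ∈ Submodule.span ℂ (Set.range s) ↔ ∃ c, frameMap s c = v :=
  Submodule.mem_span_range_iff_exists_fun ℂ

theorem mem_perp_span {r : ℕ} (s : Fin r → Amb n) (v : Amb n) :
    v ∈ perp (Submodule.span ℂ (Set.range s)) ↔ coframeMap s v = 0 := by
  constructor
  · intro h
    ext i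
    exact h _ (Submodule.subset_span ⟨i, rfl⟩)
  · intro h w hw
    obtain ⟨c, rfl⟩ := (span_range_eq s w).1 hw
    change metric n _ _ = 0
    simp only [frameMap_apply, map_sum, map_smul, LinearMap.sum_apply, LinearMap.smul_apply]
    refine Finset.sum_eq_zero fun i _ => ?_
    rw [← coframeMap_apply, h]
    simp

/-- A kernel vector of the Gram matrix gives a combination of the frame lying in the span and
orthogonal to it, hence zero by non-degeneracy. -/
theorem isUnit_gram {r : ℕ} {s : Fin r → Amb n} (hs : LinearIndependent ℂ s)
    (h : IsNondeg (Submodule.span ℂ (Set.range s))) :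
    IsUnit ((coframeMap s).comp (frameMap s)) := by
  have hinj : Function.Injective ((coframeMap s).comp (frameMap s)) := by
    rw [injective_iff_map_eq_zero]
    intro c hc
    have h1 : frameMap s c ∈ Submodule.span ℂ (Set.range s) ⊓
        perp (Submodule.span ℂ (Set.range s)) :=
      ⟨(span_range_eq s _).2 ⟨c, rfl⟩, (mem_perp_span s _).2 hc⟩
    rw [h, Submodule.mem_bot, frameMap_apply] at h1
    exact funext (Fintype.linearIndependent_iff.1 hs c h1)
  rw [ContinuousLinearMap.isUnit_iff_bijective]
  exact ⟨hinj, (LinearMap.injective_iff_surjective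
    (f := ((coframeMap s).comp (frameMap s)).toLinearMap)).1 hinj⟩

/-- The formula frame · Gram⁻¹ · coframe exhibits the orthogonal projection as a smooth expression
in the frame. -/
theorem orthProj_span {r : ℕ} {s : Fin r → Amb n} (hs : LinearIndependent ℂ s)
    (h : IsNondeg (Submodule.span ℂ (Set.range s))) :
    orthProj (Submodule.span ℂ (Set.range s)) =
      (frameMap s).comp ((Ring.inverse ((coframeMap s).comp (frameMap s))).comp (coframeMap s)) := by
  have hu := isUnit_gram hs h
  set G := (coframeMap s).comp (frameMap s) with hG
  have h1 : ∀ c, G (Ring.inverse G c) = c := fun c => by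
    rw [← mul_apply_eq_comp, Ring.mul_inverse_cancel G hu]; rfl
  have h2 : ∀ c, Ring.inverse G (G c) = c := fun c => by
    rw [← mul_apply_eq_comp, Ring.inverse_mul_cancel G hu]; rfl
  refine projAlong_eq (fun v => (span_range_eq s _).2 ⟨_, rfl⟩) (fun v => ?_) (fun v hv => ?_)
    fun v hv => ?_
  · rw [mem_perp_span, map_sub, sub_eq_zero]
    exact (h1 _).symm
  · obtain ⟨c, rfl⟩ := (span_range_eq s v).1 hv
    exact congrArg (frameMap s) (h2 c)
  · rw [mem_perp_span] at hv
    simp [hv]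

theorem smoothEnd_reflection {r : ℕ} {V : Bdl M n} (hV : IsSubbundle r V)
    (hn : ∀ x, IsNondeg (V x)) : SmoothEnd fun x => reflection (V x) := by
  intro x₀
  obtain ⟨U, hU, hx₀, s, hs, hspan⟩ := hV x₀
  have hs' : ContMDiffAt 𝓘(ℝ, ℂ) 𝓘(ℝ, Fin r → Amb n) ∞ (fun x i => s i x) x₀ :=
    contMDiffAt_pi_space.2 fun i => (hs i).contMDiffAt (hU.mem_nhds hx₀)
  have h1 := contMDiffAt_of_linear (frameMap (n := n) (r := r)) hs'
  have h2 := contMDiffAt_of_linear (coframeMap (n := n) (r := r)) hs'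
  have h3 := contMDiffAt_comp_clm h2 h1
  have hnd : ∀ x ∈ U, IsNondeg (Submodule.span ℂ (Set.range fun i => s i x)) := fun x hx =>
    (hspan x hx).2 ▸ hn x
  obtain ⟨u, hu⟩ := isUnit_gram (hspan x₀ hx₀).1 (hnd x₀ hx₀)
  have h4 : ContDiffAt ℝ ∞ (Ring.inverse : ((Fin r → ℂ) →L[ℂ] (Fin r → ℂ)) → _)
      ((coframeMap fun i => s i x₀).comp (frameMap fun i => s i x₀)) := by
    rw [← hu]; exact contDiffAt_ringInverse ℝ u
  have h5 : ContMDiffAt 𝓘(ℝ, ℂ) 𝓘(ℝ, (Fin r → ℂ) →L[ℂ] (Fin r → ℂ)) ∞ (fun x =>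
      Ring.inverse ((coframeMap fun i => s i x).comp (frameMap fun i => s i x))) x₀ :=
    ContDiffAt.comp_contMDiffAt (f := fun x =>
      (coframeMap fun i => s i x).comp (frameMap fun i => s i x)) h4 h3
  have h5 := contMDiffAt_comp_clm h1 (contMDiffAt_comp_clm h5 h2)
  have h6 : ContDiff ℝ ∞ fun T : EndAmb n => (2 : ℂ) • T - 1 :=
    (contDiff_id.const_smul (2 : ℂ)).sub contDiff_const
  refine (h6.comp_contMDiffAt h5).congr_of_eventuallyEq ?_
  filter_upwards [hU.mem_nhds hx₀] with x hx
  rw [reflection_eq (hn x), (hspan x hx).2, orthProj_span (hspan x hx).1 (hnd x hx)]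
  rfl

end SmoothProjections

/-! ### Pointwise algebra of the dressing -/

section DressingAlgebra

variable {n : ℕ}

/-- The derivative of `bst P Q c` when `P`, `Q` have derivatives `a`, `b`. -/
noncomputable def dBst (a b : EndAmb n) (c : ℂ) : EndAmb n := c • a - (a + b) + c⁻¹ • b

/-- The coefficient of the simple pole of the dressed connection. -/
noncomputable def dressPole (P Q N q : EndAmb n) (τ ε : ℂ) : EndAmb n :=
  bst P Q ε * N * bst P Q ε +
    (2 * τ * ε) • ((1 - P - Q) * q * P + Q * q * (1 - P - Q) - (1 - P - Q) * q * Q -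
      P * q * (1 - P - Q))

/-- The components P X Q and Q X P would carry c² and d². Once they vanish, as they do for skew X,
the conjugate is affine in c and d, so with c = (α-μ)/(α+μ) only simple poles at ±α can occur. -/
theorem bst_conj {P Q X : EndAmb n} (c d : ℂ) (hX : P * X * Q = 0)
    (hX' : Q * X * P = 0) (hcd : c * d = 1) :
    bst P Q c * X * bst P Q d = P * X * P + (1 - P - Q) * X * (1 - P - Q) + Q * X * Q +
      c • (P * X * (1 - P - Q)) + d • ((1 - P - Q) * X * P) + c • ((1 - P - Q) * X * Q) +
      d • (Q * X * (1 - P - Q)) := by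
  have hd : d⁻¹ = c := (eq_inv_of_mul_eq_one_left hcd).symm
  have hc : c⁻¹ = d := (eq_inv_of_mul_eq_one_right hcd).symm
  set R := 1 - P - Q
  simp only [bst, hd, hc, mul_add, add_mul, mul_smul_comm, smul_mul_assoc, hX, hX']
  match_scalars <;> first | ring1 | linear_combination hcd

/-- The relations between the projections `P`, `Q` onto two lines, their derivatives `a`, `b` and
the coefficients `N`, `q` of a connection for which the lines are parallel at `τ`, `-τ`. -/
structure IsDressing (P Q N q a b : EndAmb n) (τ : ℂ) : Prop where
  hN : P * N * Q = 0
  hN' : Q * N * P = 0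
  hq : P * q * Q = 0
  hq' : Q * q * P = 0
  hQa : Q * a = 0
  hPb : P * b = 0
  hbP : b * P = 0
  haQ : a * Q = 0
  ha : a = a * P + P * a
  hb : b = b * Q + Q * b
  h1 : (1 - P - Q) * a = -((1 - P - Q) * ((τ - 1) • N + (τ ^ 2 - 1) • q) * P)
  h2 : (1 - P - Q) * b = -((1 - P - Q) * ((-τ - 1) • N + (τ ^ 2 - 1) • q) * Q)
  h3 : a * (1 - P - Q) = P * ((-τ - 1) • N + (τ ^ 2 - 1) • q) * (1 - P - Q)
  h4 : b * (1 - P - Q) = Q * ((τ - 1) • N + (τ ^ 2 - 1) • q) * (1 - P - Q)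

/-- The variable t is μ⁻¹ or μ according to type, and τ is the parameter of the parallel line in the
same variable. The blocks between the lines and the middle space 1-P-Q could have poles at t = ±τ;
`h1` to `h4` express the derivatives of P and Q there through N and q, and the poles cancel. As t →
∞, c → ε, which gives the t² coefficient; the correction of order t⁻¹ in c applied to q produces the
term with 2τε in `dressPole`. -/
theorem IsDressing.identity {P Q N q a b : EndAmb n} {τ : ℂ} (H : IsDressing P Q N q a b τ)
    {ε t c c₁ : ℂ} (hε : ε * ε = 1) (hτ1 : τ ≠ 1) (hτ1' : τ ≠ -1) (ht : t ≠ τ) (ht' : t ≠ -τ)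
    (hc : c = ε * ((t - τ) / (t + τ))) (hc₁ : c₁ = ε * ((1 - τ) / (1 + τ))) :
    bst P Q c * ((t - 1) • N + (t ^ 2 - 1) • q) * bst P Q c⁻¹ + bst P Q c * dBst a b c⁻¹ =
      bst P Q c₁ * dBst a b c₁⁻¹ + (t - 1) • dressPole P Q N q τ ε +
        (t ^ 2 - 1) • (bst P Q ε * q * bst P Q ε) := by
  obtain ⟨hN, hN', hq, hq', hQa, hPb, hbP, haQ, ha, hb, h1, h2, h3, h4⟩ := H
  have hε0 : ε ≠ 0 := left_ne_zero_of_mul_eq_one hε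
  have ht1 : t - τ ≠ 0 := sub_ne_zero.2 ht
  have ht2 : t + τ ≠ 0 := fun h => ht' (eq_neg_of_add_eq_zero_left h)
  have hτ2 : 1 - τ ≠ 0 := sub_ne_zero.2 hτ1.symm
  have hτ3 : 1 + τ ≠ 0 := fun h => hτ1' (eq_neg_of_add_eq_zero_right h)
  have hεi : ε⁻¹ = ε := inv_eq_of_mul_eq_one_left hε
  have hc0 : c ≠ 0 := by rw [hc]; positivity
  have hc10 : c₁ ≠ 0 := by rw [hc₁]; positivity
  have hci : c⁻¹ = ε * ((t + τ) / (t - τ)) := by rw [hc, mul_inv, hεi, inv_div]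
  have hc1i : c₁⁻¹ = ε * ((1 + τ) / (1 - τ)) := by rw [hc₁, mul_inv, hεi, inv_div]
  have hPa : P * a = a * (1 - P - Q) := by
    rw [mul_sub, mul_sub, haQ, mul_one]; nth_rewrite 2 [ha]; abel
  have hQb : Q * b = b * (1 - P - Q) := by
    rw [mul_sub, mul_sub, hbP, mul_one]; nth_rewrite 2 [hb]; abel
  -- Since Qa = Pb = 0, the logarithmic derivative of the boost only has blocks joining the middle
  -- space to the lines.
  have hd : ∀ e : ℂ, e ≠ 0 → bst P Q e * dBst a b e⁻¹ =
      (1 - e) • (a * (1 - P - Q)) + (e⁻¹ - 1) • ((1 - P - Q) * a) +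
        (e - 1) • ((1 - P - Q) * b) + (1 - e⁻¹) • (b * (1 - P - Q)) := by
    intro e he
    rw [← hPa, ← hQb]
    set R := 1 - P - Q
    change (e • P + R + e⁻¹ • Q) * _ = _
    simp only [dBst, _root_.inv_inv, mul_add, add_mul, mul_sub, mul_smul_comm, smul_mul_assoc,
      hQa, hPb]
    match_scalars <;> field_simp <;> ring
  have hAPQ : ∀ x y : ℂ, P * (x • N + y • q) * Q = 0 := fun x y => by
    simp only [mul_add, add_mul, mul_smul_comm, smul_mul_assoc, hN, hq]; module
  have hAQP : ∀ x y : ℂ, Q * (x • N + y • q) * P = 0 := fun x y => by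
    simp only [mul_add, add_mul, mul_smul_comm, smul_mul_assoc, hN', hq']; module
  rw [hd c hc0, hd c₁ hc10, dressPole,
    bst_conj c c⁻¹ (hAPQ _ _) (hAQP _ _) (mul_inv_cancel₀ hc0),
    bst_conj ε ε hN hN' hε, bst_conj ε ε hq hq' hε, h1, h2, h3, h4]
  set R := 1 - P - Q
  simp only [mul_add, add_mul, mul_smul_comm, smul_mul_assoc]
  rw [hci, hc1i, hc, hc₁]
  match_scalars <;> field_simp <;> ring

/-- The value at `-1` of a dressed connection determines the part anticommuting with `ρ`. -/
theorem pole_eq_of_parity {ρ k ψ dρ dk dψ N C B : EndAmb n} (hρ : ρ * ρ = 1) (hkψ : k * ψ = 1)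
    (hψk : ψ * k = 1) (hconj : ρ * k * ρ = ψ) (hdρ : dρ * ρ + ρ * dρ = 0)
    (hdk : dk = dρ * ψ * ρ + ρ * dψ * ρ + ρ * ψ * dρ) (hd : dk * ψ + k * dψ = 0)
    (hN : N = -(1 / 2 : ℂ) • (ρ * dρ)) (hB : B = k * dψ)
    (hC : dψ + (B - (2 : ℂ) • C) * ψ = ψ * (-(2 : ℂ) • N)) :
    C = N + (1 / 2 : ℂ) • (B - ρ * B * ρ) := by
  have e1 : dψ * k = -(ψ * dk) := by
    have : ψ * (dk * ψ + k * dψ) * k = 0 := by rw [hd]; simp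
    have e : ψ * (dk * ψ + k * dψ) * k = ψ * dk * (ψ * k) + (ψ * k) * dψ * k := by noncomm_ring
    rw [this, hψk, mul_one, one_mul] at e
    exact eq_neg_of_add_eq_zero_right e.symm
  have e2 : (2 : ℂ) • C = B + dψ * k + (2 : ℂ) • (ψ * N * k) := by
    have e : (dψ + (B - (2 : ℂ) • C) * ψ) * k = dψ * k + (B - (2 : ℂ) • C) * (ψ * k) := by
      noncomm_ring
    rw [hC, hψk, mul_one, mul_smul_comm, smul_mul_assoc] at e
    linear_combination (norm := module) e
  have e3 : ρ * k = ψ * ρ := by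
    rw [← hconj, mul_assoc _ ρ ρ, hρ, mul_one]
  have e4 : ψ * ρ * ψ = ρ := by
    rw [← e3, mul_assoc, hkψ, mul_one]
  have e5 : ρ * B * ρ = ψ * ρ * dψ * ρ := by
    rw [hB, ← e3]; noncomm_ring
  have e6 : ψ * dk = ψ * dρ * ρ * k + ψ * ρ * dψ * ρ + ρ * dρ := by
    have : ψ * dk = ψ * dρ * (ψ * ρ) + ψ * ρ * dψ * ρ + (ψ * ρ * ψ) * dρ := by
      rw [hdk]; noncomm_ring
    rw [this, e4, show ψ * dρ * (ψ * ρ) = ψ * dρ * ρ * k by rw [← e3]; noncomm_ring]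
  have e7 : ψ * dρ * ρ * k = -(ψ * ρ * dρ * k) := by
    have : ψ * (dρ * ρ + ρ * dρ) * k = 0 := by rw [hdρ]; simp
    have e : ψ * (dρ * ρ + ρ * dρ) * k = ψ * dρ * ρ * k + ψ * ρ * dρ * k := by noncomm_ring
    rw [this] at e
    exact eq_neg_of_add_eq_zero_left e.symm
  have e8 : ψ * N * k = -(1 / 2 : ℂ) • (ψ * ρ * dρ * k) := by
    rw [hN, mul_smul_comm, smul_mul_assoc]; noncomm_ring
  -- The terms ψρ dρ k coming from dk and from N cancel, leaving N and the ρ-odd part of B.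
  have e9 : (2 : ℂ) • C = (2 : ℂ) • (N + (1 / 2 : ℂ) • (B - ρ * B * ρ)) := by
    rw [e2, e1, e6, e7, e8, e5, hN]; module
  exact smul_right_injective _ two_ne_zero e9

end DressingAlgebra

/-! ### Types of forms, and the loop as d plus an endomorphism-valued form -/

section Forms

variable {M : Type*} [TopologicalSpace M] [ChartedSpace ℂ M] {n : ℕ}

theorem tangentJ_tangentJ {x : M} (X : TangentSpace 𝓘(ℝ, ℂ) x) :
    tangentJ x (tangentJ x X) = -X := by
  have h : ∀ z : ℂ, Complex.I * (Complex.I * z) = -z := fun z => by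
    rw [← mul_assoc, Complex.I_mul_I, neg_one_mul]
  exact h X

theorem I_smul_I_smul {W : Type*} [AddCommGroup W] [Module ℂ W] (w : W) :
    Complex.I • Complex.I • w = -w := by
  rw [smul_smul, Complex.I_mul_I, neg_one_smul]

section Parts

variable {W : Type*} [NormedAddCommGroup W] [NormedSpace ℂ W] [NormedSpace ℝ W]
  [IsScalarTower ℝ ℂ W] {x : M}

theorem part10_apply (η : TangentSpace 𝓘(ℝ, ℂ) x →L[ℝ] W) (X : TangentSpace 𝓘(ℝ, ℂ) x) :
    part10 η X = (1 / 2 : ℂ) • (η X - Complex.I • η (tangentJ x X)) := rfl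

theorem part01_apply (η : TangentSpace 𝓘(ℝ, ℂ) x →L[ℝ] W) (X : TangentSpace 𝓘(ℝ, ℂ) x) :
    part01 η X = (1 / 2 : ℂ) • (η X + Complex.I • η (tangentJ x X)) := rfl

theorem part10_add_part01 (η : TangentSpace 𝓘(ℝ, ℂ) x →L[ℝ] W) : part10 η + part01 η = η := by
  ext1 X
  rw [add_apply, part10_apply, part01_apply]
  module

theorem part10_add (η θ : TangentSpace 𝓘(ℝ, ℂ) x →L[ℝ] W) :
    part10 (η + θ) = part10 η + part10 θ := by
  ext1 X
  simp only [add_apply, part10_apply]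
  module

theorem part01_add (η θ : TangentSpace 𝓘(ℝ, ℂ) x →L[ℝ] W) :
    part01 (η + θ) = part01 η + part01 θ := by
  ext1 X
  simp only [add_apply, part01_apply]
  module

theorem part10_smul (c : ℂ) (η : TangentSpace 𝓘(ℝ, ℂ) x →L[ℝ] W) :
    part10 (c • η) = c • part10 η := by
  ext1 X
  simp only [smul_apply, part10_apply]
  module

theorem part01_smul (c : ℂ) (η : TangentSpace 𝓘(ℝ, ℂ) x →L[ℝ] W) :
    part01 (c • η) = c • part01 η := by
  ext1 X
  simp only [smul_apply, part01_apply]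
  module

theorem part10_part10 (η : TangentSpace 𝓘(ℝ, ℂ) x →L[ℝ] W) : part10 (part10 η) = part10 η := by
  ext1 X
  simp only [part10_apply, tangentJ_tangentJ, map_neg, smul_sub, smul_neg, smul_comm Complex.I,
    I_smul_I_smul]
  module

theorem part01_part01 (η : TangentSpace 𝓘(ℝ, ℂ) x →L[ℝ] W) : part01 (part01 η) = part01 η := by
  ext1 X
  simp only [part01_apply, tangentJ_tangentJ, map_neg, smul_add, smul_neg, smul_comm Complex.I,
    I_smul_I_smul]
  module

theorem part10_part01 (η : TangentSpace 𝓘(ℝ, ℂ) x →L[ℝ] W) : part10 (part01 η) = 0 := by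
  ext1 X
  simp only [part10_apply, part01_apply, tangentJ_tangentJ, map_neg, smul_add, smul_neg,
    smul_comm Complex.I, I_smul_I_smul, zero_apply]
  module

theorem part01_part10 (η : TangentSpace 𝓘(ℝ, ℂ) x →L[ℝ] W) : part01 (part10 η) = 0 := by
  ext1 X
  simp only [part10_apply, part01_apply, tangentJ_tangentJ, map_neg, smul_sub, smul_neg,
    smul_comm Complex.I, I_smul_I_smul, zero_apply]
  module

end Parts

theorem formApply_apply {x : M} (η : TangentSpace 𝓘(ℝ, ℂ) x →L[ℝ] EndAmb n) (v : Amb n)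
    (X : TangentSpace 𝓘(ℝ, ℂ) x) : formApply η v X = η X v := rfl

theorem adAt_apply {x : M} (T : EndAmb n) (η : TangentSpace 𝓘(ℝ, ℂ) x →L[ℝ] EndAmb n)
    (X : TangentSpace 𝓘(ℝ, ℂ) x) : adAt T η X = T * η X * inv T := rfl

theorem part10_adAt {x : M} (T : EndAmb n) (η : TangentSpace 𝓘(ℝ, ℂ) x →L[ℝ] EndAmb n) :
    part10 (adAt T η) = adAt T (part10 η) := by
  ext1 X
  simp only [part10_apply, adAt_apply, mul_sub, sub_mul, mul_smul_comm, smul_mul_assoc]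

theorem part01_adAt {x : M} (T : EndAmb n) (η : TangentSpace 𝓘(ℝ, ℂ) x →L[ℝ] EndAmb n) :
    part01 (adAt T η) = adAt T (part01 η) := by
  ext1 X
  simp only [part01_apply, adAt_apply, mul_add, add_mul, mul_smul_comm, smul_mul_assoc]

theorem adAt_add {x : M} (T : EndAmb n) (η θ : TangentSpace 𝓘(ℝ, ℂ) x →L[ℝ] EndAmb n) :
    adAt T (η + θ) = adAt T η + adAt T θ := by
  ext1 X
  simp only [add_apply, adAt_apply, mul_add, add_mul]

theorem adAt_smul {x : M} (T : EndAmb n) (c : ℂ) (η : TangentSpace 𝓘(ℝ, ℂ) x →L[ℝ] EndAmb n) :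
    adAt T (c • η) = c • adAt T η := by
  ext1 X
  simp only [smul_apply, adAt_apply, mul_smul_comm, smul_mul_assoc]

theorem adAt_adAt {x : M} {S T : EndAmb n} (hS : IsUnit S) (hT : IsUnit T)
    (η : TangentSpace 𝓘(ℝ, ℂ) x →L[ℝ] EndAmb n) : adAt S (adAt T η) = adAt (S * T) η := by
  ext1 X
  simp only [adAt_apply, inv_mul hS hT, mul_assoc]

theorem mem_part10 {x : M} {η : TangentSpace 𝓘(ℝ, ℂ) x →L[ℝ] EndAmb n}
    {U : Submodule ℂ (EndAmb n)} (h : ∀ X, η X ∈ U) (X : TangentSpace 𝓘(ℝ, ℂ) x) :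
    part10 η X ∈ U :=
  U.smul_mem _ (U.sub_mem (h _) (U.smul_mem _ (h _)))

theorem mem_part01 {x : M} {η : TangentSpace 𝓘(ℝ, ℂ) x →L[ℝ] EndAmb n}
    {U : Submodule ℂ (EndAmb n)} (h : ∀ X, η X ∈ U) (X : TangentSpace 𝓘(ℝ, ℂ) x) :
    part01 η X ∈ U :=
  U.smul_mem _ (U.add_mem (h _) (U.smul_mem _ (h _)))

/-- `𝒩_V` as an endomorphism-valued form, `-½ ρ dρ`. -/
noncomputable def nForm (V : Bdl M n) : EndForm M n := fun x =>
  ((-(1 / 2 : ℂ) • ContinuousLinearMap.mul ℂ (EndAmb n) (reflection (V x))).restrictScalars ℝ).comp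
    (dEnd (fun y => reflection (V y)) x)

theorem nForm_apply (V : Bdl M n) (x : M) (X : TangentSpace 𝓘(ℝ, ℂ) x) :
    nForm V x X =
      -(1 / 2 : ℂ) • (reflection (V x) * dEnd (fun y => reflection (V y)) x X) := rfl

/-- The form `d^{μ,q}_V - d`. -/
noncomputable def connForm (V : Bdl M n) (q : EndForm M n) (μ : ℂ) : EndForm M n := fun x =>
  (μ⁻¹ - 1) • part10 (nForm V x) + (μ - 1) • part01 (nForm V x) +
    ((μ ^ 2)⁻¹ - 1) • part10 (q x) + (μ ^ 2 - 1) • part01 (q x)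

theorem connForm_apply (V : Bdl M n) (q : EndForm M n) (μ : ℂ) (x : M)
    (X : TangentSpace 𝓘(ℝ, ℂ) x) :
    connForm V q μ x X = (μ⁻¹ - 1) • part10 (nForm V x) X + (μ - 1) • part01 (nForm V x) X +
      ((μ ^ 2)⁻¹ - 1) • part10 (q x) X + (μ ^ 2 - 1) • part01 (q x) X := rfl

/-- Smooth families of non-degenerate subspaces. -/
structure IsSmoothNondeg (V : Bdl M n) : Prop where
  nondeg : ∀ x, IsNondeg (V x)
  smooth : SmoothEnd fun x => reflection (V x)

variable {V : Bdl M n} {q : EndForm M n}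

theorem IsSmoothNondeg.dEnd_mul_add (hV : IsSmoothNondeg V) (x : M)
    (X : TangentSpace 𝓘(ℝ, ℂ) x) :
    dEnd (fun y => reflection (V y)) x X * reflection (V x) +
      reflection (V x) * dEnd (fun y => reflection (V y)) x X = 0 := by
  rw [← dEnd_mul hV.smooth hV.smooth]
  simp only [fun y => reflection_mul_self (hV.nondeg y), dEnd_const]
  rfl

/-- With π = ½(1 ± ρ) the derivatives of s cancel in d - 𝒟_V, so 𝒩_V is tensorial and equals -½ρ dρ.
-/
theorem IsSmoothNondeg.calN_eq (hV : IsSmoothNondeg V) {s : M → Amb n} (hs : SmoothSec s) (x : M) :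
    calN V s x = formApply (nForm V x) (s x) := by
  ext1 X
  have h1 : ∀ c : ℂ, SmoothEnd fun y => (1 / 2 : ℂ) • (1 + c • reflection (V y)) := fun c =>
    ((SmoothEnd.const 1).add (hV.smooth.const_smul c)).const_smul _
  have h2 : ∀ c : ℂ, dEnd (fun y => (1 / 2 : ℂ) • (1 + c • reflection (V y))) x X =
      (1 / 2 : ℂ) • (c • dEnd (fun y => reflection (V y)) x X) := by
    intro c
    rw [dEnd_const_smul ((SmoothEnd.const 1).add (hV.smooth.const_smul c)),
      dEnd_add (SmoothEnd.const 1) (hV.smooth.const_smul c), dEnd_const_smul hV.smooth, dEnd_const]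
    simp
  have h3 : ∀ y, orthProj (V y) = (1 / 2 : ℂ) • (1 + (1 : ℂ) • reflection (V y)) := fun y => by
    rw [orthProj_eq (hV.nondeg y), one_smul]
  have h4 : ∀ y, orthProj (perp (V y)) = (1 / 2 : ℂ) • (1 + (-1 : ℂ) • reflection (V y)) :=
    fun y => by rw [orthProj_perp_eq (hV.nondeg y)]; module
  have h5 : calD V s x X = orthProj (V x) (triv (fun y => orthProj (V y) (s y)) x X) +
      orthProj (perp (V x)) (triv (fun y => orthProj (perp (V y)) (s y)) x X) := rfl
  have hρρ : ∀ v, reflection (V x) (reflection (V x) v) = v := fun v => by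
    rw [← mul_apply_eq_comp, reflection_mul_self (hV.nondeg x)]; rfl
  simp only [h3, h4] at h5
  rw [triv_apply (h1 _) hs, triv_apply (h1 _) hs, h2, h2] at h5
  rw [calN, sub_apply, h5, formApply_apply, nForm_apply]
  simp only [smul_apply, add_apply, one_apply_eq_self, mul_apply_eq_comp, map_add, map_smul, hρρ]
  module

theorem IsSmoothNondeg.specConn_apply (hV : IsSmoothNondeg V) {s : M → Amb n} (hs : SmoothSec s)
    (μ : ℂ) (x : M) (X : TangentSpace 𝓘(ℝ, ℂ) x) :
    specConn V q μ s x X = triv s x X + connForm V q μ x X (s x) := by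
  have h1 : calD V s x = triv s x - formApply (nForm V x) (s x) := by
    rw [← hV.calN_eq hs, calN]; abel
  have h2 : nForm V x X = part10 (nForm V x) X + part01 (nForm V x) X := by
    rw [← add_apply, part10_add_part01]
  rw [specConn, hV.calN_eq hs, h1]
  simp only [add_apply, sub_apply, smul_apply, connForm_apply, formApply_apply]
  rw [h2]
  have h3 : part10 (formApply (nForm V x) (s x)) X = part10 (nForm V x) X (s x) := rfl
  have h4 : part01 (formApply (nForm V x) (s x)) X = part01 (nForm V x) X (s x) := rfl
  rw [h3, h4, add_apply]
  module

/-- Differentiating ρ² = 1 shows that ρ and dρ anticommute. This is the oddness of 𝒩_V under ρ. -/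
theorem IsSmoothNondeg.conj_nForm (hV : IsSmoothNondeg V) (x : M)
    (X : TangentSpace 𝓘(ℝ, ℂ) x) :
    reflection (V x) * nForm V x X * reflection (V x) = -nForm V x X := by
  rw [nForm_apply]
  have h := hV.dEnd_mul_add x X
  have h1 := reflection_mul_self (hV.nondeg x)
  set ρ := reflection (V x)
  set dρ := dEnd (fun y => reflection (V y)) x X
  rw [mul_smul_comm, smul_mul_assoc, ← mul_assoc, h1, one_mul, eq_neg_of_add_eq_zero_left h,
    smul_neg]

variable [IsManifold 𝓘(ℂ) ω M]

theorem IsConstrainedHarmonic.isSmoothNondeg (h : IsConstrainedHarmonic V q) :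
    IsSmoothNondeg V := by
  obtain ⟨r, hr⟩ := h.subbundle
  exact ⟨h.nondeg, smoothEnd_reflection hr h.nondeg⟩

theorem SmoothForm.part10 {η : EndForm M n} (h : SmoothForm η) :
    SmoothForm fun x => part10 (η x) := fun X hX =>
  ((h X hX).sub ((h _ hX.tangentJ).const_smul Complex.I)).const_smul (1 / 2 : ℂ)

theorem SmoothForm.part01 {η : EndForm M n} (h : SmoothForm η) :
    SmoothForm fun x => part01 (η x) := fun X hX =>
  ((h X hX).add ((h _ hX.tangentJ).const_smul Complex.I)).const_smul (1 / 2 : ℂ)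

theorem SmoothForm.adForm {η : EndForm M n} (h : SmoothForm η) {φ : M → EndAmb n}
    (hφ : SmoothEnd φ) (hu : ∀ x, IsUnit (φ x)) : SmoothForm (adForm φ η) := fun X hX =>
  (hφ.mul (h X hX)).mul (hφ.inv hu)

theorem SmoothForm.add {η θ : EndForm M n} (h : SmoothForm η) (h' : SmoothForm θ) :
    SmoothForm fun x => η x + θ x := fun X hX => (h X hX).add (h' X hX)

theorem SmoothForm.const_smul {η : EndForm M n} (h : SmoothForm η) (c : ℂ) :
    SmoothForm fun x => c • η x := fun X hX => (h X hX).const_smul c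

theorem IsSmoothNondeg.smoothForm_nForm (hV : IsSmoothNondeg V) : SmoothForm (nForm V) := fun X hX =>
  (hV.smooth.mul (hV.smooth.dEnd X hX)).const_smul _

end Forms

/-! ### Gauge transformations, and transport of flatness and parallel lines -/

section Gauge

variable {M : Type*} [TopologicalSpace M] [ChartedSpace ℂ M] {n : ℕ}

/-- `g` intertwines the connections `d + A` and `d + A'`. -/
def Intertwines (g : M → EndAmb n) (A A' : EndForm M n) : Prop :=
  ∀ x X, dEnd g x X + A' x X * g x = g x * A x X

theorem Intertwines.comp {g h : M → EndAmb n} {A A' A'' : EndForm M n} (hh : SmoothEnd h)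
    (hg : SmoothEnd g) (H : Intertwines h A' A'') (G : Intertwines g A A') :
    Intertwines (fun x => h x * g x) A A'' := fun x X => by
  rw [dEnd_mul hh hg]
  calc dEnd h x X * g x + h x * dEnd g x X + A'' x X * (h x * g x)
      = (dEnd h x X + A'' x X * h x) * g x + h x * dEnd g x X := by noncomm_ring
    _ = h x * (dEnd g x X + A' x X * g x) := by rw [H x X]; noncomm_ring
    _ = h x * g x * A x X := by rw [G x X, mul_assoc]

theorem dEnd_inv {g : M → EndAmb n} (hg : SmoothEnd g) (hu : ∀ x, IsUnit (g x)) (x : M)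
    (X : TangentSpace 𝓘(ℝ, ℂ) x) :
    dEnd (fun y => inv (g y)) x X = -(inv (g x) * dEnd g x X * inv (g x)) := by
  have h := dEnd_mul (hg.inv hu) hg x X
  simp only [fun y => inv_mul_self (hu y), dEnd_const] at h
  have h1 : (dEnd (fun y => inv (g y)) x X * g x + inv (g x) * dEnd g x X) * inv (g x) = 0 := by
    rw [← h]; simp
  rw [add_mul, mul_assoc, mul_inv_self (hu x), mul_one] at h1
  exact eq_neg_of_add_eq_zero_left h1

theorem Intertwines.inv {g : M → EndAmb n} {A A' : EndForm M n} (hg : SmoothEnd g)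
    (hu : ∀ x, IsUnit (g x)) (G : Intertwines g A A') :
    Intertwines (fun x => inv (g x)) A' A := fun x X => by
  rw [dEnd_inv hg hu]
  have h1 : A x X = ConstrainedHarmonic.inv (g x) * (dEnd g x X + A' x X * g x) := by
    rw [G x X, ← mul_assoc, inv_mul_self (hu x), one_mul]
  calc _ = -(ConstrainedHarmonic.inv (g x) * dEnd g x X * ConstrainedHarmonic.inv (g x)) +
        (ConstrainedHarmonic.inv (g x) * dEnd g x X * ConstrainedHarmonic.inv (g x) +
        ConstrainedHarmonic.inv (g x) * A' x X * (g x * ConstrainedHarmonic.inv (g x))) := by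
        rw [h1]; noncomm_ring
    _ = _ := by rw [mul_inv_self (hu x), mul_one]; abel

variable {V V' : Bdl M n} {q q' : EndForm M n}

theorem Intertwines.specConn_apply (hV : IsSmoothNondeg V) (hV' : IsSmoothNondeg V') {μ μ' : ℂ}
    {g : M → EndAmb n} (hg : SmoothEnd g)
    (G : Intertwines g (connForm V q μ) (connForm V' q' μ')) {s : M → Amb n} (hs : SmoothSec s)
    (x : M) (X : TangentSpace 𝓘(ℝ, ℂ) x) :
    specConn V' q' μ' (fun y => g y (s y)) x X = g x (specConn V q μ s x X) := by
  rw [hV'.specConn_apply (hg.apply hs), hV.specConn_apply hs, triv_apply hg hs, map_add]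
  have h := congrArg (fun T : EndAmb n => T (s x)) (G x X)
  simp only [add_apply, mul_apply_eq_comp] at h
  rw [← h]; abel

/-- Testing on constant sections isolates the zeroth-order term, so preserving connections amounts
to φ⁻¹dφ = A_μ. -/
theorem isGauge_iff (hV : IsSmoothNondeg V) {μ : ℂ} {φ : M → EndAmb n} :
    IsGauge (specConn V q μ) φ ↔
      SmoothEnd φ ∧ (∀ x, IsOrth (φ x)) ∧ ∀ x X, dEnd φ x X = φ x * connForm V q μ x X := by
  constructor
  · rintro ⟨h1, h2, h3⟩
    refine ⟨h1, h2, fun x X => ?_⟩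
    ext1 v
    have hs : SmoothSec fun _ : M => v := contMDiff_const
    have h := h3 (fun _ => v) hs x X
    rw [triv_apply h1 hs, hV.specConn_apply hs, triv_const] at h
    simpa using h
  · rintro ⟨h1, h2, h3⟩
    refine ⟨h1, h2, fun s hs x X => ?_⟩
    rw [triv_apply h1 hs, hV.specConn_apply hs, h3, map_add, mul_apply_eq_comp, add_comm]

theorem IsParallel.mapB (hV : IsSmoothNondeg V) (hV' : IsSmoothNondeg V') {μ μ' : ℂ}
    {g : M → EndAmb n} (hg : SmoothEnd g) (hu : ∀ x, IsUnit (g x))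
    (G : Intertwines g (connForm V q μ) (connForm V' q' μ')) {L : Bdl M n}
    (hL : IsParallel (specConn V q μ) L) : IsParallel (specConn V' q' μ') (mapB g L) := by
  intro s hs hsL x X
  have h1 := (hg.inv hu).apply hs
  have h2 := hL _ h1 (fun y => (mem_img_iff (hu y)).1 (hsL y)) x X
  have h3 := G.specConn_apply hV hV' hg h1 x X
  simp only [apply_inv_self (hu _)] at h3
  rw [h3]
  exact apply_mem_img h2

theorem IsSubbundle.mapB {r : ℕ} {g : M → EndAmb n} (hg : SmoothEnd g) (hu : ∀ x, IsUnit (g x))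
    (hV : IsSubbundle r V) : IsSubbundle r (mapB g V) := by
  intro x₀
  obtain ⟨U, hU, hx₀, s, hs, hspan⟩ := hV x₀
  refine ⟨U, hU, hx₀, fun i x => g x (s i x), fun i => ?_, fun x hx => ⟨?_, ?_⟩⟩
  · have h : ContDiff ℝ ∞ fun p : EndAmb n × Amb n => p.1 p.2 :=
      isBoundedBilinearMap_apply_real.contDiff
    exact h.contMDiff.comp_contMDiffOn ((hg.contMDiffOn).prodMk_space (hs i))
  · exact (hspan x hx).1.map' (g x : Amb n →ₗ[ℂ] Amb n) (LinearMap.ker_eq_bot.2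
      (ContinuousLinearMap.isUnit_iff_bijective.1 (hu x)).1)
  · change img (g x) (V x) = _
    rw [(hspan x hx).2, img, Submodule.map_span, ← Set.range_comp]
    rfl

theorem IsSmoothNondeg.mapB (hV : IsSmoothNondeg V) {φ : M → EndAmb n} (hφ : SmoothEnd φ)
    (ho : ∀ x, IsOrth (φ x)) : IsSmoothNondeg (mapB φ V) := by
  refine ⟨fun x => (hV.nondeg x).img (ho x), ?_⟩
  simp only [ConstrainedHarmonic.mapB, fun x => reflection_img (ho x) (V x)]
  exact (hφ.mul hV.smooth).mul (hφ.inv fun x => (ho x).isUnit)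

/-- The behaviour of `d - 𝒟_V` under the action of a section of the orthogonal group. -/
theorem nForm_mapB (hV : IsSmoothNondeg V) {ψ : M → EndAmb n} (hψ : SmoothEnd ψ)
    (ho : ∀ x, IsOrth (ψ x)) {B C : EndForm M n} (hB : ∀ x X, dEnd ψ x X = ψ x * B x X)
    (hC : ∀ x X, C x X = nForm V x X +
      (1 / 2 : ℂ) • (B x X - reflection (V x) * B x X * reflection (V x))) :
    nForm (mapB ψ V) = adForm ψ C := by
  funext x
  ext1 X
  have hu := fun y => (ho y).isUnit
  have h1 : (fun y => reflection (mapB ψ V y)) = fun y =>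
      ψ y * reflection (V y) * inv (ψ y) := funext fun y => reflection_img (ho y) (V y)
  -- The transformed reflection is ψρψ⁻¹. Its derivative is ψ(Bρ + dρ - ρB)ψ⁻¹, and multiplying by
  -- -½ψρψ⁻¹ gives ψCψ⁻¹.
  have h2 : dEnd (fun y => reflection (mapB ψ V y)) x X =
      ψ x * (B x X * reflection (V x) + dEnd (fun y => reflection (V y)) x X -
        reflection (V x) * B x X) * inv (ψ x) := by
    rw [h1, dEnd_mul (hψ.mul hV.smooth) (hψ.inv hu), dEnd_mul hψ hV.smooth, dEnd_inv hψ hu, hB]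
    have h3 : inv (ψ x) * (ψ x * B x X) * inv (ψ x) = B x X * inv (ψ x) := by
      rw [← mul_assoc, inv_mul_self (hu x), one_mul]
    rw [h3, mul_neg (ψ x * reflection (V x)) (B x X * inv (ψ x))]
    simp only [mul_add, add_mul, mul_sub, sub_mul, mul_assoc]
    abel
  rw [nForm_apply, h2, congrFun h1 x]
  change _ = ψ x * C x X * inv (ψ x)
  rw [hC, nForm_apply]
  have h4 := inv_mul_self (hu x)
  have h5 := reflection_mul_self (hV.nondeg x)
  set ρ := reflection (V x)
  set dρ := dEnd (fun y => reflection (V y)) x X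
  set k := inv (ψ x)
  have h6 : ψ x * ρ * k * (ψ x * (B x X * ρ + dρ - ρ * B x X) * k) =
      ψ x * (ρ * B x X * ρ + ρ * dρ - B x X) * k := by
    calc _ = ψ x * ρ * (k * ψ x) * (B x X * ρ + dρ - ρ * B x X) * k := by simp only [mul_assoc]
      _ = ψ x * (ρ * B x X * ρ + ρ * dρ - (ρ * ρ) * B x X) * k := by
        rw [h4]; simp only [mul_add, mul_sub, mul_assoc, one_mul]
      _ = _ := by rw [h5, one_mul]
  rw [h6, ← smul_mul_assoc, ← mul_smul_comm]
  congr 2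
  module

/-- The gauge ψ absorbs B = ψ⁻¹dψ. What remains is the loop of ψV as soon as the coefficient C is
𝒩_V plus the ρ-odd part of B. Both the spectral deformation and the dressing step are instances. -/
theorem intertwines_mapB (hV : IsSmoothNondeg V) {ψ : M → EndAmb n} (hψ : SmoothEnd ψ)
    (ho : ∀ x, IsOrth (ψ x)) {B C : EndForm M n} (hB : ∀ x X, dEnd ψ x X = ψ x * B x X)
    (hC : ∀ x X, C x X = nForm V x X +
      (1 / 2 : ℂ) • (B x X - reflection (V x) * B x X * reflection (V x)))
    (q' : EndForm M n) (μ : ℂ) :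
    Intertwines ψ (fun x => B x + ((μ⁻¹ - 1) • part10 (C x) + (μ - 1) • part01 (C x) +
      ((μ ^ 2)⁻¹ - 1) • part10 (q' x) + (μ ^ 2 - 1) • part01 (q' x)))
      (connForm (mapB ψ V) (adForm ψ q') μ) := fun x X => by
  rw [connForm_apply, nForm_mapB hV hψ ho hB hC, adForm, adForm, part10_adAt, part01_adAt,
    part10_adAt, part01_adAt, hB]
  have h : ∀ η : TangentSpace 𝓘(ℝ, ℂ) x →L[ℝ] EndAmb n, adAt (ψ x) η X * ψ x = ψ x * η X :=
    fun η => by rw [adAt_apply, mul_assoc, inv_mul_self (ho x).isUnit, mul_one]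
  simp only [add_mul, smul_mul_assoc, h, add_apply, smul_apply, mul_add, mul_smul_comm]

theorem continuousAt_specConn (hV : IsSmoothNondeg V) {μ₀ : ℂ} (h0 : μ₀ ≠ 0) {s : M → Amb n}
    (hs : SmoothSec s) (x : M) (X : TangentSpace 𝓘(ℝ, ℂ) x) :
    ContinuousAt (fun μ => specConn V q μ s x X) μ₀ := by
  simp only [hV.specConn_apply hs, connForm_apply, add_apply, smul_apply]
  have h2 : μ₀ ^ 2 ≠ 0 := pow_ne_zero 2 h0
  fun_prop (disch := assumption)

variable [IsManifold 𝓘(ℂ) ω M]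

theorem smoothForm_connForm (hV : IsSmoothNondeg V) (hq : SmoothForm q) (μ : ℂ) :
    SmoothForm (connForm V q μ) :=
  (((hV.smoothForm_nForm.part10.const_smul _).add (hV.smoothForm_nForm.part01.const_smul _)).add
    (hq.part10.const_smul _)).add (hq.part01.const_smul _)

theorem smoothSec_specConn (hV : IsSmoothNondeg V) (hq : SmoothForm q) (μ : ℂ) {s : M → Amb n}
    (hs : SmoothSec s) {X : VecField M} (hX : SmoothVec X) :
    SmoothSec fun y => specConn V q μ s y (X y) := by
  simp only [fun y => hV.specConn_apply (q := q) hs μ y (X y)]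
  exact (hs.triv hX).add ((smoothForm_connForm hV hq μ X hX).apply hs)

theorem IsFlat.of_intertwines (hV : IsSmoothNondeg V) (hV' : IsSmoothNondeg V')
    (hq : SmoothForm q) {μ μ' : ℂ} {g : M → EndAmb n} (hg : SmoothEnd g)
    (hu : ∀ x, IsUnit (g x)) (G : Intertwines g (connForm V q μ) (connForm V' q' μ'))
    (hF : IsFlat (specConn V q μ)) : IsFlat (specConn V' q' μ') := by
  intro X Y hX hY s hs x
  obtain ⟨t, ht, rfl⟩ : ∃ t, SmoothSec t ∧ s = fun y => g y (t y) :=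
    ⟨_, (hg.inv hu).apply hs, funext fun y => (apply_inv_self (hu y) (s y)).symm⟩
  simp only [G.specConn_apply hV hV' hg ht]
  rw [G.specConn_apply hV hV' hg (smoothSec_specConn hV hq μ ht hX),
    G.specConn_apply hV hV' hg (smoothSec_specConn hV hq μ ht hY), ← map_sub, ← map_sub,
    hF X Y hX hY t ht x, map_zero]

/-- With s and Y fixed, the inner covariant derivative is a combination of sections independent of μ
with coefficients that are Laurent polynomials in μ, so applying the connection once more stays
continuous away from 0. -/
theorem continuousAt_specConn_specConn (hV : IsSmoothNondeg V) (hq : SmoothForm q) {μ₀ : ℂ}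
    (h0 : μ₀ ≠ 0) {s : M → Amb n} (hs : SmoothSec s) (x : M) (X : TangentSpace 𝓘(ℝ, ℂ) x)
    {Y : VecField M} (hY : SmoothVec Y) :
    ContinuousAt (fun μ => specConn V q μ (fun y => specConn V q μ s y (Y y)) x X) μ₀ := by
  have h1 := (hV.smoothForm_nForm.part10 Y hY).apply hs
  have h2 := (hV.smoothForm_nForm.part01 Y hY).apply hs
  have h3 := (hq.part10 Y hY).apply hs
  have h4 := (hq.part01 Y hY).apply hs
  have h5 := hs.triv hY
  have key : ∀ μ : ℂ, specConn V q μ (fun y => specConn V q μ s y (Y y)) x X =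
      (triv (fun y => triv s y (Y y)) x X +
        ((μ⁻¹ - 1) • triv (fun y => part10 (nForm V y) (Y y) (s y)) x X +
        (μ - 1) • triv (fun y => part01 (nForm V y) (Y y) (s y)) x X +
        ((μ ^ 2)⁻¹ - 1) • triv (fun y => part10 (q y) (Y y) (s y)) x X +
        (μ ^ 2 - 1) • triv (fun y => part01 (q y) (Y y) (s y)) x X)) +
      ((μ⁻¹ - 1) • part10 (nForm V x) X (specConn V q μ s x (Y x)) +
        (μ - 1) • part01 (nForm V x) X (specConn V q μ s x (Y x)) +
        ((μ ^ 2)⁻¹ - 1) • part10 (q x) X (specConn V q μ s x (Y x)) +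
        (μ ^ 2 - 1) • part01 (q x) X (specConn V q μ s x (Y x))) := by
    intro μ
    rw [hV.specConn_apply (smoothSec_specConn hV hq μ hs hY)]
    congr 1
    have h6 : (fun y => specConn V q μ s y (Y y)) = fun y => triv s y (Y y) +
        ((μ⁻¹ - 1) • part10 (nForm V y) (Y y) (s y) +
        (μ - 1) • part01 (nForm V y) (Y y) (s y) +
        ((μ ^ 2)⁻¹ - 1) • part10 (q y) (Y y) (s y) +
        (μ ^ 2 - 1) • part01 (q y) (Y y) (s y)) := by
      funext y
      rw [hV.specConn_apply hs, connForm_apply]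
      simp only [add_apply, smul_apply]
    have e1 := h1.const_smul (μ⁻¹ - 1)
    have e2 := h2.const_smul (μ - 1)
    have e3 := h3.const_smul ((μ ^ 2)⁻¹ - 1)
    have e4 := h4.const_smul (μ ^ 2 - 1)
    rw [h6, triv_add h5 (((e1.add e2).add e3).add e4), triv_add ((e1.add e2).add e3) e4,
      triv_add (e1.add e2) e3, triv_add e1 e2, triv_const_smul h1, triv_const_smul h2,
      triv_const_smul h3, triv_const_smul h4]
  simp only [key]
  have h7 := continuousAt_specConn (q := q) hV h0 hs x (Y x)
  have h8 : μ₀ ^ 2 ≠ 0 := pow_ne_zero 2 h0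
  fun_prop (disch := assumption)

open Filter Topology in
-- The curvature on given fields and section is continuous in μ, so it vanishes at μ₀ if it vanishes
-- on a punctured neighbourhood. This covers the values ±α, where the dressing gauge is undefined or
-- singular.
theorem isFlat_of_eventually (hV : IsSmoothNondeg V) (hq : SmoothForm q) {μ₀ : ℂ} (h0 : μ₀ ≠ 0)
    (h : ∀ᶠ μ in 𝓝[≠] μ₀, IsFlat (specConn V q μ)) : IsFlat (specConn V q μ₀) := by
  intro X Y hX hY s hs x
  have h1 := ((continuousAt_specConn_specConn hV hq h0 hs x (X x) hY).sub
    (continuousAt_specConn_specConn hV hq h0 hs x (Y x) hX)).sub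
    (continuousAt_specConn (q := q) hV h0 hs x (VectorField.mlieBracket 𝓘(ℝ, ℂ) X Y x))
  refine tendsto_nhds_unique (l := 𝓝[≠] μ₀) (h1.tendsto.mono_left nhdsWithin_le_nhds) ?_
  refine tendsto_const_nhds.congr' ?_
  filter_upwards [h] with μ hμ
  exact (hμ X Y hX hY s hs x).symm

end Gauge

/-! ### Adjoints for the metric and their derivatives -/

section Adjoint

variable {n : ℕ}

/-- `T` is the adjoint of `S` for the metric. -/
def IsAdj (S T : EndAmb n) : Prop := ∀ u v, metric n (S u) v = metric n u (T v)

theorem IsAdj.symm {S T : EndAmb n} (h : IsAdj S T) : IsAdj T S := fun u v => by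
  rw [metric_comm, ← h, metric_comm]

theorem IsAdj.mul {S T S' T' : EndAmb n} (h : IsAdj S T) (h' : IsAdj S' T') :
    IsAdj (S * S') (T' * T) := fun u v => by
  rw [mul_apply_eq_comp, mul_apply_eq_comp, h, h']

theorem IsAdj.eq {S S' T : EndAmb n} (h : IsAdj S T) (h' : IsAdj S' T) : S = S' := by
  ext1 u
  exact ext_metric fun v => by rw [h, h']

theorem IsAdj.sub {S T S' T' : EndAmb n} (h : IsAdj S T) (h' : IsAdj S' T') :
    IsAdj (S - S') (T - T') := fun u v => by
  simp only [sub_apply, map_sub, LinearMap.sub_apply, h u v, h' u v]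

theorem isAdj_one : IsAdj (1 : EndAmb n) 1 := fun _ _ => rfl

theorem IsSkew.isAdj {S : EndAmb n} (h : IsSkew S) : IsAdj S (-S) := fun u v => by
  rw [h, neg_apply, map_neg]

theorem IsAdj.isSkew {S : EndAmb n} (h : IsAdj S (-S)) : IsSkew S := fun u v => by
  rw [h, neg_apply, map_neg]

variable {M : Type*} [TopologicalSpace M] [ChartedSpace ℂ M]

/-- Differentiate (Su, v) = (u, Tv) with u and v constant. -/
theorem IsAdj.dEnd {S T : M → EndAmb n} (hS : SmoothEnd S) (hT : SmoothEnd T)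
    (h : ∀ x, IsAdj (S x) (T x)) (x : M) (X : TangentSpace 𝓘(ℝ, ℂ) x) :
    IsAdj (dEnd S x X) (dEnd T x X) := by
  intro u v
  have key : ∀ (f : EndAmb n →ₗ[ℂ] ℂ) {φ : M → EndAmb n}, SmoothEnd φ →
      mvfderiv 𝓘(ℝ, ℂ) (fun y => f (φ y)) x X = f (ConstrainedHarmonic.dEnd φ x X) := by
    intro f φ hφ
    have hf := ((LinearMap.toContinuousLinearMap f).restrictScalars ℝ).hasFDerivAt (x := φ x)
    have h1 := hf.hasMFDerivAt.comp x (hφ.mdifferentiableAt x).hasMFDerivAt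
    have h2 : mvfderiv 𝓘(ℝ, ℂ) (fun y => f (φ y)) x X =
      mfderiv 𝓘(ℝ, ℂ) 𝓘(ℝ, ℂ) (((LinearMap.toContinuousLinearMap f).restrictScalars ℝ) ∘ φ) x X :=
      rfl
    rw [h2, h1.mfderiv]
    rfl
  have h1 := key ((metric n).flip v ∘ₗ
    (ContinuousLinearMap.apply ℂ (Amb n) u).toLinearMap) hS
  have h2 := key ((metric n u) ∘ₗ (ContinuousLinearMap.apply ℂ (Amb n) v).toLinearMap) hT
  have h3 : (fun y => ((metric n).flip v ∘ₗ
      (ContinuousLinearMap.apply ℂ (Amb n) u).toLinearMap) (S y)) = fun y => ((metric n u) ∘ₗ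
      (ContinuousLinearMap.apply ℂ (Amb n) v).toLinearMap) (T y) := funext fun y => h y u v
  rw [h3, h2] at h1
  exact h1.symm

end Adjoint

/-! ### Parity under the reflection and spectral deformation -/

section Spectral

variable {M : Type*} [TopologicalSpace M] [ChartedSpace ℂ M] {n : ℕ} {V : Bdl M n}
  {q : EndForm M n}

/-- The form `X ↦ S ∘ η(X) ∘ T`. -/
noncomputable def conjForm {x : M} (S T : EndAmb n)
    (η : TangentSpace 𝓘(ℝ, ℂ) x →L[ℝ] EndAmb n) : TangentSpace 𝓘(ℝ, ℂ) x →L[ℝ] EndAmb n :=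
  ((ContinuousLinearMap.mulLeftRight ℂ (EndAmb n) S T).restrictScalars ℝ).comp η

theorem conjForm_apply {x : M} (S T : EndAmb n) (η : TangentSpace 𝓘(ℝ, ℂ) x →L[ℝ] EndAmb n)
    (X : TangentSpace 𝓘(ℝ, ℂ) x) : conjForm S T η X = S * η X * T := rfl

theorem part10_conjForm {x : M} (S T : EndAmb n) (η : TangentSpace 𝓘(ℝ, ℂ) x →L[ℝ] EndAmb n) :
    part10 (conjForm S T η) = conjForm S T (part10 η) := by
  ext1 X
  simp only [part10_apply, conjForm_apply, mul_sub, sub_mul, mul_smul_comm, smul_mul_assoc]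

theorem part01_conjForm {x : M} (S T : EndAmb n) (η : TangentSpace 𝓘(ℝ, ℂ) x →L[ℝ] EndAmb n) :
    part01 (conjForm S T η) = conjForm S T (part01 η) := by
  ext1 X
  simp only [part01_apply, conjForm_apply, mul_add, add_mul, mul_smul_comm, smul_mul_assoc]

/-- Left and right multiplication are complex linear and commute with taking types, so an identity
between full forms splits into its (1,0) and (0,1) parts. -/
theorem conjForm_part_of_eq {x : M} {S T S' T' : EndAmb n}
    {η θ : TangentSpace 𝓘(ℝ, ℂ) x →L[ℝ] EndAmb n}
    (h : ∀ X, S * η X * T = S' * θ X * T') (X : TangentSpace 𝓘(ℝ, ℂ) x) :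
    S * part10 η X * T = S' * part10 θ X * T' ∧ S * part01 η X * T = S' * part01 θ X * T' := by
  have h1 : conjForm S T η = conjForm S' T' θ := ContinuousLinearMap.ext h
  have h2 := congrArg part10 h1
  have h3 := congrArg part01 h1
  rw [part10_conjForm, part10_conjForm] at h2
  rw [part01_conjForm, part01_conjForm] at h3
  exact ⟨congrArg (fun T => T X) h2, congrArg (fun T => T X) h3⟩

theorem IsSmoothNondeg.conj_nForm_part (hV : IsSmoothNondeg V) (x : M)
    (X : TangentSpace 𝓘(ℝ, ℂ) x) :
    reflection (V x) * part10 (nForm V x) X * reflection (V x) = -part10 (nForm V x) X ∧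
      reflection (V x) * part01 (nForm V x) X * reflection (V x) = -part01 (nForm V x) X := by
  have hneg : ∀ A : EndAmb n, -1 * A = -A := fun A => neg_one_mul A
  have h := conjForm_part_of_eq (S' := -1) (T' := 1) (θ := nForm V x) (fun X => by
    rw [hV.conj_nForm x X, mul_one, hneg]) X
  simpa only [mul_one, hneg] using h

theorem conj_q_part (hV : IsSmoothNondeg V)
    (hq : ∀ x X, q x X ∈ wedge2 (V x) ⊔ wedge2 (perp (V x))) (x : M)
    (X : TangentSpace 𝓘(ℝ, ℂ) x) :
    reflection (V x) * part10 (q x) X * reflection (V x) = part10 (q x) X ∧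
      reflection (V x) * part01 (q x) X * reflection (V x) = part01 (q x) X :=
  ⟨reflection_conj_of_mem (hV.nondeg x) (mem_part10 (hq x) X),
    reflection_conj_of_mem (hV.nondeg x) (mem_part01 (hq x) X)⟩

/-- The terms in 𝒩_V are odd and those in q even, so conjugation by ρ changes only the sign of the
former. -/
theorem conj_connForm (hV : IsSmoothNondeg V)
    (hq : ∀ x X, q x X ∈ wedge2 (V x) ⊔ wedge2 (perp (V x))) (μ : ℂ) (x : M)
    (X : TangentSpace 𝓘(ℝ, ℂ) x) :
    reflection (V x) * connForm V q μ x X * reflection (V x) =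
      (1 - μ⁻¹) • part10 (nForm V x) X + (1 - μ) • part01 (nForm V x) X +
      ((μ ^ 2)⁻¹ - 1) • part10 (q x) X + (μ ^ 2 - 1) • part01 (q x) X := by
  have h1 := hV.conj_nForm_part x X
  have h2 := conj_q_part hV hq x X
  rw [connForm_apply]
  simp only [mul_add, add_mul, mul_smul_comm, smul_mul_assoc, h1.1, h1.2, h2.1, h2.2]
  module

/-- The form A_{lμ} is A_l plus the loop in μ with coefficients l⁻¹𝒩^{1,0} + l𝒩^{0,1} and q_l. The
gauge φ absorbs A_l, and the odd part of A_l is exactly what turns 𝒩_V into l⁻¹𝒩^{1,0} + l𝒩^{0,1}.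
-/
theorem intertwines_spectral (hV : IsSmoothNondeg V)
    (hq : ∀ x X, q x X ∈ wedge2 (V x) ⊔ wedge2 (perp (V x))) {l : ℂ} {φ : M → EndAmb n}
    (hφ : IsGauge (specConn V q l) φ) (μ : ℂ) :
    Intertwines φ (connForm V q (l * μ))
      (connForm (mapB φ V) (adForm φ (qScale l q)) μ) := by
  obtain ⟨h1, h2, h3⟩ := (isGauge_iff hV).1 hφ
  have h4 := intertwines_mapB hV h1 h2 (B := connForm V q l)
    (C := fun x => l⁻¹ • part10 (nForm V x) + l • part01 (nForm V x)) h3 (fun x X => by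
      have h5 : nForm V x X = part10 (nForm V x) X + part01 (nForm V x) X := by
        rw [← add_apply, part10_add_part01]
      rw [conj_connForm hV hq, connForm_apply, h5]
      simp only [add_apply, smul_apply]
      module) (qScale l q) μ
  convert h4 using 1
  funext x
  simp only [connForm, qScale, part10_add, part01_add, part10_smul, part01_smul, part10_part10,
    part01_part01, part10_part01, part01_part10, smul_zero, add_zero, zero_add, mul_inv, mul_pow]
  ext1 X
  simp only [add_apply, smul_apply]
  module

variable [IsManifold 𝓘(ℂ) ω M]

theorem IsConstrainedHarmonic.mapB (hV : IsConstrainedHarmonic V q) {ψ : M → EndAmb n}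
    (hψ : SmoothEnd ψ) (ho : ∀ x, IsOrth (ψ x)) {q' : EndForm M n} (hq' : SmoothForm q')
    (hv : ∀ x X, q' x X ∈ wedge2 (V x) ⊔ wedge2 (perp (V x)))
    (hF : ∀ μ : ℂ, μ ≠ 0 →
      IsFlat (specConn (ConstrainedHarmonic.mapB ψ V) (adForm ψ q') μ)) :
    IsConstrainedHarmonic (ConstrainedHarmonic.mapB ψ V) (adForm ψ q') where
  subbundle := hV.subbundle.imp fun _ h => h.mapB hψ fun x => (ho x).isUnit
  nondeg x := (hV.nondeg x).img (ho x)
  smooth := hq'.adForm hψ fun x => (ho x).isUnit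
  values x X := conj_mem_wedge2_sup (ho x) (hv x X)
  flat := hF

theorem IsConstrainedHarmonic.spectral (hV : IsConstrainedHarmonic V q) {l : ℂ} (hl : l ≠ 0)
    {φ : M → EndAmb n} (hφ : IsGauge (specConn V q l) φ) :
    IsConstrainedHarmonic (ConstrainedHarmonic.mapB φ V) (adForm φ (qScale l q)) := by
  have hS := hV.isSmoothNondeg
  refine hV.mapB hφ.smooth hφ.orth ((hV.smooth.part10.const_smul _).add
    (hV.smooth.part01.const_smul _)) (fun x X => ?_) fun μ hμ => ?_
  · exact add_mem (Submodule.smul_mem _ _ (mem_part10 (hV.values x) X))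
      (Submodule.smul_mem _ _ (mem_part01 (hV.values x) X))
  · exact (hV.flat (l * μ) (mul_ne_zero hl hμ)).of_intertwines hS (hS.mapB hφ.smooth hφ.orth)
      hV.smooth hφ.smooth (fun x => (hφ.orth x).isUnit)
      (intertwines_spectral hS hV.values hφ μ)

end Spectral

/-! ### Null line bundles transverse to their reflections -/

section NullLines

section Boosts

variable {M : Type*} {n : ℕ}

/-- The projection onto `L` with kernel `L^⊥`, for a line bundle as in `IsTransNullLine`. -/
noncomputable def lineP (V L : Bdl M n) : M → EndAmb n := fun x =>
  projAlong (L x) (img (reflection (V x)) (L x) ⊔ perp (L x ⊔ img (reflection (V x)) (L x)))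

/-- The projection onto `ρ L`, conjugate to `lineP`. -/
noncomputable def lineQ (V L : Bdl M n) : M → EndAmb n := fun x =>
  reflection (V x) * lineP V L x * reflection (V x)

/-- The endomorphism equal to `c` on `L`, to `1` on `(L ⊕ ρL)^⊥` and to `c⁻¹` on `ρL`. -/
noncomputable def lineBoost (V L : Bdl M n) (c : ℂ) : M → EndAmb n := fun x =>
  boost c (L x) (img (reflection (V x)) (L x))

theorem lineBoost_mapB {φ : M → EndAmb n} (ho : ∀ x, IsOrth (φ x)) (V L : Bdl M n) (c : ℂ)
    (x : M) : lineBoost (mapB φ V) (mapB φ L) c x = φ x * lineBoost V L c x * inv (φ x) := by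
  have h : img (reflection (mapB φ V x)) (mapB φ L x) =
      img (φ x) (img (reflection (V x)) (L x)) := by
    simp only [mapB, reflection_img (ho x), img_img]
    rw [mul_assoc, inv_mul_self (ho x).isUnit, mul_one]
  rw [lineBoost, h, mapB, boost_img (ho x), lineBoost]

end Boosts

variable {M : Type*} [TopologicalSpace M] [ChartedSpace ℂ M] {n : ℕ}

/-- Null line bundles `L` with `ρ L ∩ L^⊥ = 0`. -/
structure IsTransNullLine (V L : Bdl M n) : Prop where
  line : IsSubbundle 1 L
  null : ∀ x, IsNull (L x)
  trans : ∀ x, img (reflection (V x)) (L x) ⊓ perp (L x) = ⊥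

variable {V L : Bdl M n}

/-- If (ρs, s) vanished, ρs would lie both in ρL and in L^⊥, contradicting transversality. This
scalar is the denominator of the projections onto L and ρL. -/
theorem metric_reflection_ne_zero {W : Submodule ℂ (Amb n)} {s : Amb n}
    (hs : s ≠ 0) (h : img (reflection W) (Submodule.span ℂ {s}) ⊓
      perp (Submodule.span ℂ {s}) = ⊥) (hW : IsNondeg W) : metric n (reflection W s) s ≠ 0 := by
  intro h0
  have h1 : reflection W s ∈ img (reflection W) (Submodule.span ℂ {s}) ⊓
      perp (Submodule.span ℂ {s}) := by
    refine ⟨apply_mem_img (Submodule.mem_span_singleton_self s), fun w hw => ?_⟩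
    obtain ⟨c, rfl⟩ := Submodule.mem_span_singleton.1 hw
    change metric n _ _ = 0
    rw [map_smul, LinearMap.smul_apply, metric_comm, h0, smul_zero]
  rw [h, Submodule.mem_bot] at h1
  apply hs
  rw [← inv_apply_self (isOrth_reflection hW).isUnit s, h1, map_zero]

namespace IsTransNullLine

theorem span_eq {W U : Submodule ℂ (Amb n)} {s : Amb n} (hW : IsNondeg W)
    (hn : IsNull U) (ht : img (reflection W) U ⊓ perp U = ⊥) (hU : U = Submodule.span ℂ {s})
    (hs : s ≠ 0) :
    metric n (reflection W s) s ≠ 0 ∧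
      projAlong U (img (reflection W) U ⊔ perp (U ⊔ img (reflection W) U)) =
        rankOneProj s (reflection W s) ∧
      IsBoostFrame (reflection W) (rankOneProj s (reflection W s))
        (rankOneProj (reflection W s) s) ∧
      ∀ c, boost c U (img (reflection W) U) =
        bst (rankOneProj s (reflection W s)) (rankOneProj (reflection W s) s) c := by
  subst hU
  have h0 := metric_reflection_ne_zero hs ht hW
  have hss : metric n s s = 0 := hn s (Submodule.mem_span_singleton_self s) s
    (Submodule.mem_span_singleton_self s)
  have hss' : metric n (reflection W s) (reflection W s) = 0 := by
    rw [isOrth_reflection hW, hss]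
  have himg : img (reflection W) (Submodule.span ℂ {s}) = Submodule.span ℂ {reflection W s} := by
    rw [img, Submodule.map_span, Set.image_singleton]
    rfl
  rw [himg]
  exact ⟨h0, (projAlong_line hss hss' h0).1,
    rankOneProj_boostFrame (reflection_mul_self hW) (metric_reflection hW) hss h0,
    boost_eq_bst hss hss' h0⟩

theorem exists_span (hL : IsTransNullLine V L) (x : M) :
    ∃ s, L x = Submodule.span ℂ {s} ∧ s ≠ 0 := by
  obtain ⟨U, -, hx, s, -, h⟩ := hL.line x
  refine ⟨s 0 x, ?_, (h x hx).1.ne_zero 0⟩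
  rw [(h x hx).2, Set.range_unique]
  rfl

theorem frame (hL : IsTransNullLine V L) (hV : ∀ x, IsNondeg (V x)) (x : M) :
    IsBoostFrame (reflection (V x)) (lineP V L x) (lineQ V L x) := by
  obtain ⟨s, hs, hs0⟩ := hL.exists_span x
  obtain ⟨-, h2, h3, -⟩ := span_eq (hV x) (hL.null x) (hL.trans x) hs hs0
  rw [lineQ, lineP, h2, h3.conj]
  exact h3

theorem lineBoost_eq (hL : IsTransNullLine V L) (hV : ∀ x, IsNondeg (V x)) (c : ℂ) (x : M) :
    lineBoost V L c x = bst (lineP V L x) (lineQ V L x) c := by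
  obtain ⟨s, hs, hs0⟩ := hL.exists_span x
  obtain ⟨-, h2, h3, h4⟩ := span_eq (hV x) (hL.null x) (hL.trans x) hs hs0
  rw [lineQ, lineP, h2, h3.conj, lineBoost, h4]

theorem lineP_mem (hL : IsTransNullLine V L) (hV : ∀ x, IsNondeg (V x)) (x : M) (v : Amb n) :
    lineP V L x v ∈ L x := by
  obtain ⟨s, hs, hs0⟩ := hL.exists_span x
  obtain ⟨-, h2, -, -⟩ := span_eq (hV x) (hL.null x) (hL.trans x) hs hs0
  rw [lineP, h2, hs, rankOneProj_apply]
  exact Submodule.smul_mem _ _ (Submodule.mem_span_singleton_self s)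

theorem lineP_of_mem (hL : IsTransNullLine V L) (hV : ∀ x, IsNondeg (V x)) {x : M} {v : Amb n}
    (hv : v ∈ L x) : lineP V L x v = v := by
  obtain ⟨s, hs, hs0⟩ := hL.exists_span x
  obtain ⟨h1, h2, -, -⟩ := span_eq (hV x) (hL.null x) (hL.trans x) hs hs0
  rw [hs] at hv
  obtain ⟨c, rfl⟩ := Submodule.mem_span_singleton.1 hv
  rw [lineP, h2, rankOneProj_apply, map_smul, smul_eq_mul, mul_comm, mul_assoc, mul_inv_cancel₀ h1,
    mul_one]

theorem smoothEnd_lineP (hL : IsTransNullLine V L) (hV : IsSmoothNondeg V) :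
    SmoothEnd (lineP V L) := by
  intro x₀
  obtain ⟨U, hU, hx₀, s, hs, hspan⟩ := hL.line x₀
  have hs0 : ContMDiffAt 𝓘(ℝ, ℂ) 𝓘(ℝ, Amb n) ∞ (s 0) x₀ := (hs 0).contMDiffAt (hU.mem_nhds hx₀)
  have happ : ContDiff ℝ ∞ fun p : EndAmb n × Amb n => p.1 p.2 :=
    isBoundedBilinearMap_apply_real.contDiff
  have hρs : ContMDiffAt 𝓘(ℝ, ℂ) 𝓘(ℝ, Amb n) ∞ (fun x => reflection (V x) (s 0 x)) x₀ :=
    happ.contMDiff.contMDiffAt.comp x₀ ((hV.smooth x₀).prodMk_space hs0)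
  have h1 := contMDiffAt_of_linear (frameMap (n := n) (r := 1))
    (s := fun x _ => s 0 x) (contMDiffAt_pi_space.2 fun _ => hs0)
  have h2 := contMDiffAt_of_linear (coframeMap (n := n) (r := 1))
    (s := fun x _ => reflection (V x) (s 0 x)) (contMDiffAt_pi_space.2 fun _ => hρs)
  have h3 := contMDiffAt_comp_clm h1 h2
  have h4 := contMDiffAt_comp_clm h2 h1
  -- The scalar (ρs, s) is read off as the single entry of the 1×1 matrix `h4`.
  have h5 : ContMDiffAt 𝓘(ℝ, ℂ) 𝓘(ℝ, ℂ) ∞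
      (fun x => metric n (reflection (V x) (s 0 x)) (s 0 x)) x₀ := by
    have h6 := contMDiffAt_of_linear (((LinearMap.proj (0 : Fin 1)) ∘ₗ
      (ContinuousLinearMap.apply ℂ (Fin 1 → ℂ) (fun _ : Fin 1 => (1 : ℂ))).toLinearMap :
      ((Fin 1 → ℂ) →L[ℂ] (Fin 1 → ℂ)) →ₗ[ℂ] ℂ)) h4
    refine h6.congr_of_eventuallyEq (Filter.Eventually.of_forall fun x => ?_)
    change _ = metric n (reflection (V x) (s 0 x)) (∑ _i : Fin 1, (1 : ℂ) • s 0 x)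
    simp
  have hdata : ∀ x ∈ U, metric n (reflection (V x) (s 0 x)) (s 0 x) ≠ 0 ∧
      lineP V L x = rankOneProj (s 0 x) (reflection (V x) (s 0 x)) := fun x hx => by
    have h7 := span_eq (s := s 0 x) (hV.nondeg x) (hL.null x) (hL.trans x)
      (by rw [(hspan x hx).2, Set.range_unique]; rfl) ((hspan x hx).1.ne_zero 0)
    exact ⟨h7.1, h7.2.1⟩
  have h8 : ContMDiffAt 𝓘(ℝ, ℂ) 𝓘(ℝ, ℂ) ∞
      (fun x => (metric n (reflection (V x) (s 0 x)) (s 0 x))⁻¹) x₀ :=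
    ContDiffAt.comp_contMDiffAt (g := fun z : ℂ => z⁻¹)
      (f := fun x => metric n (reflection (V x) (s 0 x)) (s 0 x))
      (contDiffAt_inv ℝ (hdata x₀ hx₀).1) h5
  have hsmul : ContDiff ℝ ∞ fun p : ℂ × EndAmb n => p.1 • p.2 :=
    isBoundedBilinearMap_smul.contDiff
  refine (hsmul.contMDiff.contMDiffAt.comp x₀ (h8.prodMk_space h3)).congr_of_eventuallyEq ?_
  filter_upwards [hU.mem_nhds hx₀] with x hx
  rw [(hdata x hx).2]
  ext1 v
  change _ = (metric n (reflection (V x) (s 0 x)) (s 0 x))⁻¹ • ∑ _i : Fin 1,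
    metric n (reflection (V x) (s 0 x)) v • s 0 x
  simp [rankOneProj_apply, smul_smul]

theorem smoothEnd_lineQ (hL : IsTransNullLine V L) (hV : IsSmoothNondeg V) :
    SmoothEnd (lineQ V L) :=
  (hV.smooth.mul (hL.smoothEnd_lineP hV)).mul hV.smooth

end IsTransNullLine

end NullLines

/-! ### First-order relations for a null line and for a parallel one -/

section OneStep

variable {M : Type*} [TopologicalSpace M] [ChartedSpace ℂ M] {n : ℕ} {V L : Bdl M n}
  {q : EndForm M n}

/-- Both ρ and dρ are self-adjoint and they anticommute, so ρ dρ is skew. -/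
theorem isSkew_nForm (hV : IsSmoothNondeg V) (x : M) (X : TangentSpace 𝓘(ℝ, ℂ) x) :
    IsSkew (nForm V x X) := by
  have h1 : ∀ y, IsAdj (reflection (V y)) (reflection (V y)) := fun y =>
    metric_reflection (hV.nondeg y)
  have h2 := IsAdj.dEnd hV.smooth hV.smooth h1 x X
  have h3 := (h1 x).mul h2
  rw [eq_neg_of_add_eq_zero_left (hV.dEnd_mul_add x X)] at h3
  rw [nForm_apply]
  exact h3.isSkew.smul _

theorem IsSkew.part {x : M} {η : TangentSpace 𝓘(ℝ, ℂ) x →L[ℝ] EndAmb n}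
    (h : ∀ X, IsSkew (η X)) (X : TangentSpace 𝓘(ℝ, ℂ) x) :
    IsSkew (part10 η X) ∧ IsSkew (part01 η X) :=
  ⟨((h X).sub ((h _).smul _)).smul _, ((h X).add ((h _).smul _)).smul _⟩

theorem isSkew_connForm (hV : IsSmoothNondeg V) (hq : ∀ x X, IsSkew (q x X)) (μ : ℂ) (x : M)
    (X : TangentSpace 𝓘(ℝ, ℂ) x) : IsSkew (connForm V q μ x X) := by
  have h1 := IsSkew.part (isSkew_nForm hV x) X
  have h2 := IsSkew.part (hq x) X
  exact (((h1.1.smul _).add (h1.2.smul _)).add (h2.1.smul _)).add (h2.2.smul _)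

namespace IsTransNullLine

/-- Differentiating P² = P, PQ = 0 and their companions gives all but the vanishing statements. For
these, Q dP has adjoint dQ P = -Q dP, so it is skew; its block Q(Q dP)P then vanishes, L being a
null line, and that block is all of Q dP. The same applies to P dQ. -/
theorem dEnd_relations (hL : IsTransNullLine V L) (hV : IsSmoothNondeg V) (x : M)
    (X : TangentSpace 𝓘(ℝ, ℂ) x) :
    lineQ V L x * dEnd (lineP V L) x X = 0 ∧ lineP V L x * dEnd (lineQ V L) x X = 0 ∧
    dEnd (lineQ V L) x X * lineP V L x = 0 ∧ dEnd (lineP V L) x X * lineQ V L x = 0 ∧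
    dEnd (lineP V L) x X = dEnd (lineP V L) x X * lineP V L x + lineP V L x * dEnd (lineP V L) x X ∧
    dEnd (lineQ V L) x X = dEnd (lineQ V L) x X * lineQ V L x + lineQ V L x * dEnd (lineQ V L) x X ∧
    IsAdj (dEnd (lineP V L) x X) (dEnd (lineQ V L) x X) := by
  have hP := hL.smoothEnd_lineP hV
  have hQ := hL.smoothEnd_lineQ hV
  have hf := hL.frame hV.nondeg
  have hadj := IsAdj.dEnd hP hQ (fun y => (hf y).adj) x X
  have e1 := dEnd_mul hP hP x X
  have e2 := dEnd_mul hQ hQ x X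
  have e3 := dEnd_mul hP hQ x X
  have e4 := dEnd_mul hQ hP x X
  simp only [fun y => (hf y).PP, fun y => (hf y).QQ, fun y => (hf y).PQ, fun y => (hf y).QP,
    dEnd_const] at e1 e2 e3 e4
  have hx := hf x
  change dEnd (lineP V L) x X = _ at e1
  change dEnd (lineQ V L) x X = _ at e2
  have e3' : dEnd (lineP V L) x X * lineQ V L x = -(lineP V L x * dEnd (lineQ V L) x X) :=
    eq_neg_of_add_eq_zero_left e3.symm
  have e4' : dEnd (lineQ V L) x X * lineP V L x = -(lineQ V L x * dEnd (lineP V L) x X) :=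
    eq_neg_of_add_eq_zero_left e4.symm
  have hPQ : IsAdj (lineP V L x) (lineQ V L x) := hx.adj
  set P := lineP V L x
  set Q := lineQ V L x
  set a := dEnd (lineP V L) x X
  set b := dEnd (lineQ V L) x X
  have s1 : IsSkew (Q * a) := by
    have := hPQ.symm.mul hadj
    rw [e4'] at this
    exact this.isSkew
  have s2 : IsSkew (P * b) := by
    have := hPQ.mul hadj.symm
    rw [e3'] at this
    exact this.isSkew
  have f1 : Q * a = 0 := by
    have h1 : Q * a = Q * a * P := by
      conv_lhs => rw [e1]
      rw [mul_add, ← mul_assoc Q P, hx.QP, zero_mul, add_zero, mul_assoc]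
    have h2 := hx.QSP _ s1
    rw [← mul_assoc, hx.QQ] at h2
    rw [h1, h2]
  have f2 : P * b = 0 := by
    have h1 : P * b = P * b * Q := by
      conv_lhs => rw [e2]
      rw [mul_add, ← mul_assoc P Q, hx.PQ, zero_mul, add_zero, mul_assoc]
    have h2 := hx.PSQ _ s2
    rw [← mul_assoc, hx.PP] at h2
    rw [h1, h2]
  refine ⟨f1, f2, ?_, ?_, e1, e2, hadj⟩
  · rw [e4', f1, neg_zero]
  · rw [e3', f2, neg_zero]

/-- The off-diagonal components of the derivative of the projections onto a parallel line. -/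
theorem parallel_relations (hL : IsTransNullLine V L) (hV : IsSmoothNondeg V)
    (hq : ∀ x X, q x X ∈ wedge2 (V x) ⊔ wedge2 (perp (V x))) {α : ℂ}
    (hpar : IsParallel (specConn V q α) L) (x : M) (X : TangentSpace 𝓘(ℝ, ℂ) x) :
    (1 - lineP V L x - lineQ V L x) * dEnd (lineP V L) x X =
      -((1 - lineP V L x - lineQ V L x) * connForm V q α x X * lineP V L x) ∧
    (1 - lineP V L x - lineQ V L x) * dEnd (lineQ V L) x X =
      -((1 - lineP V L x - lineQ V L x) * connForm V q (-α) x X * lineQ V L x) ∧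
    dEnd (lineP V L) x X * (1 - lineP V L x - lineQ V L x) =
      lineP V L x * connForm V q (-α) x X * (1 - lineP V L x - lineQ V L x) ∧
    dEnd (lineQ V L) x X * (1 - lineP V L x - lineQ V L x) =
      lineQ V L x * connForm V q α x X * (1 - lineP V L x - lineQ V L x) := by
  have hP := hL.smoothEnd_lineP hV
  have hQ := hL.smoothEnd_lineQ hV
  have hx := hL.frame hV.nondeg x
  obtain ⟨-, -, -, -, -, -, hadj⟩ := hL.dEnd_relations hV x X
  have hPQ : IsAdj (lineP V L x) (lineQ V L x) := hx.adj
  have hR : IsAdj (1 - lineP V L x - lineQ V L x) (1 - lineP V L x - lineQ V L x) := by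
    have h : IsAdj (1 - lineP V L x - lineQ V L x) (1 - lineQ V L x - lineP V L x) :=
      (isAdj_one.sub hPQ).sub hPQ.symm
    rwa [sub_right_comm 1 (lineQ V L x) (lineP V L x)] at h
  have hRP : (1 - lineP V L x - lineQ V L x) * lineP V L x = 0 := by
    rw [sub_mul, sub_mul, one_mul, hx.PP, hx.QP, sub_self, sub_zero]
  -- For a constant vector v, Pv is a section of L, so its covariant derivative lies in L and is
  -- killed by 1-P-Q.
  have h1 : (1 - lineP V L x - lineQ V L x) *
      (dEnd (lineP V L) x X + connForm V q α x X * lineP V L x) = 0 := by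
    ext1 v
    have hv : SmoothSec fun _ : M => v := contMDiff_const
    have h := hpar _ (hP.apply hv) (fun y => hL.lineP_mem hV.nondeg y v) x X
    rw [hV.specConn_apply (hP.apply hv), triv_apply hP hv, triv_const] at h
    rw [mul_apply_eq_comp, add_apply, mul_apply_eq_comp, ← hL.lineP_of_mem hV.nondeg
      (v := dEnd (lineP V L) x X v + _) (by simpa using h), ← mul_apply_eq_comp, hRP]
    rfl
  have g1 : (1 - lineP V L x - lineQ V L x) * dEnd (lineP V L) x X =
      -((1 - lineP V L x - lineQ V L x) * connForm V q α x X * lineP V L x) := by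
    rw [mul_add, ← mul_assoc] at h1
    exact eq_neg_of_add_eq_zero_left h1
  have hρρ := reflection_mul_self (hV.nondeg x)
  have hb : dEnd (lineQ V L) x X =
      dEnd (fun y => reflection (V y)) x X * lineP V L x * reflection (V x) +
      reflection (V x) * dEnd (lineP V L) x X * reflection (V x) +
      reflection (V x) * lineP V L x * dEnd (fun y => reflection (V y)) x X := by
    have h := dEnd_mul (hV.smooth.mul hP) hV.smooth x X
    rw [dEnd_mul hV.smooth hP, add_mul] at h
    exact h
  -- This says ρ d^{α} ρ = d^{-α}, whence ρL is d^{-α}-parallel and Q = ρPρ satisfies the analogue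
  -- of `g1` at -α.
  have hA : connForm V q (-α) x X = reflection (V x) * connForm V q α x X * reflection (V x) -
      dEnd (fun y => reflection (V y)) x X * reflection (V x) := by
    have h2 : dEnd (fun y => reflection (V y)) x X * reflection (V x) =
        (2 : ℂ) • (part10 (nForm V x) X + part01 (nForm V x) X) := by
      rw [← add_apply, part10_add_part01, nForm_apply,
        eq_neg_of_add_eq_zero_left (hV.dEnd_mul_add x X)]
      module
    rw [conj_connForm hV hq, h2, connForm_apply, inv_neg, neg_sq]
    module
  have hQρ : lineQ V L x * reflection (V x) = reflection (V x) * lineP V L x := by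
    rw [lineQ, mul_assoc _ (reflection (V x)) (reflection (V x)), hρρ, mul_one]
  have hρQ : reflection (V x) * lineQ V L x = lineP V L x * reflection (V x) := by
    rw [lineQ, ← mul_assoc, ← mul_assoc, hρρ, one_mul]
  have hρR : (1 - lineP V L x - lineQ V L x) * reflection (V x) =
      reflection (V x) * (1 - lineP V L x - lineQ V L x) := by
    rw [sub_mul, sub_mul, hQρ, mul_sub, mul_sub, hρQ, one_mul, mul_one, sub_right_comm]
  have g2 : (1 - lineP V L x - lineQ V L x) * dEnd (lineQ V L) x X =
      -((1 - lineP V L x - lineQ V L x) * connForm V q (-α) x X * lineQ V L x) := by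
    rw [hb, hA]
    have hρ1 : lineQ V L x = reflection (V x) * lineP V L x * reflection (V x) := rfl
    set ρ := reflection (V x)
    set dρ := dEnd (fun y => reflection (V y)) x X
    set P := lineP V L x
    set Q := lineQ V L x
    set R := 1 - P - Q
    set A := connForm V q α x X
    set a := dEnd (lineP V L) x X
    have k1 : R * (ρ * a * ρ) = -(ρ * (R * A * P) * ρ) := by
      rw [← mul_assoc, ← mul_assoc, hρR, mul_assoc ρ R a, g1, mul_neg ρ (R * A * P),
        neg_mul (ρ * (R * A * P)) ρ]
    have k2 : R * (ρ * P * dρ) = 0 := by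
      rw [← mul_assoc, ← mul_assoc, hρR, mul_assoc ρ R P, hRP, mul_zero, zero_mul]
    have k3 : R * (ρ * A * ρ) * Q = ρ * (R * A * P) * ρ := by
      rw [mul_assoc, mul_assoc _ ρ Q, hρQ, ← mul_assoc, ← mul_assoc, ← mul_assoc, hρR]
      simp only [mul_assoc]
    have k4 : R * (dρ * ρ) * Q = R * (dρ * P * ρ) := by
      rw [mul_assoc, mul_assoc _ ρ Q, hρQ, mul_assoc dρ]
    rw [mul_add, mul_add, k1, k2, mul_sub R (ρ * A * ρ), sub_mul (R * (ρ * A * ρ)), k3, k4]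
    abel
  -- The last two relations are the adjoints of `g2` and `g1`: adjunction exchanges P and Q, fixes
  -- 1-P-Q and negates the connection form.
  have hsk : ∀ μ, IsAdj (connForm V q μ x X) (-connForm V q μ x X) := fun μ =>
    (isSkew_connForm hV (fun x X => isSkew_of_mem (hq x X)) μ x X).isAdj
  refine ⟨g1, g2, ?_, ?_⟩
  · have h3 := hadj.mul hR
    have h4 := (hPQ.mul (hsk (-α))).mul hR
    rw [g2] at h3
    refine h3.eq ?_
    convert h4 using 1
    rw [neg_mul (connForm V q (-α) x X) (lineQ V L x), mul_neg (1 - lineP V L x - lineQ V L x),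
      mul_assoc]
  · have h3 := hadj.symm.mul hR
    have h4 := (hPQ.symm.mul (hsk α)).mul hR
    rw [g1] at h3
    refine h3.eq ?_
    convert h4 using 1
    rw [neg_mul (connForm V q α x X) (lineP V L x), mul_neg (1 - lineP V L x - lineQ V L x),
      mul_assoc]

end IsTransNullLine

theorem part10_connForm (V : Bdl M n) (q : EndForm M n) (μ : ℂ) (x : M)
    (X : TangentSpace 𝓘(ℝ, ℂ) x) : part10 (connForm V q μ x) X =
      (μ⁻¹ - 1) • part10 (nForm V x) X + ((μ⁻¹) ^ 2 - 1) • part10 (q x) X := by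
  rw [connForm, part10_add, part10_add, part10_add, part10_smul, part10_smul, part10_smul,
    part10_smul, part10_part10, part10_part10, part10_part01, part10_part01, inv_pow]
  simp

theorem part01_connForm (V : Bdl M n) (q : EndForm M n) (μ : ℂ) (x : M)
    (X : TangentSpace 𝓘(ℝ, ℂ) x) : part01 (connForm V q μ x) X =
      (μ - 1) • part01 (nForm V x) X + (μ ^ 2 - 1) • part01 (q x) X := by
  rw [connForm, part01_add, part01_add, part01_add, part01_smul, part01_smul, part01_smul,
    part01_smul, part01_part01, part01_part01, part01_part10, part01_part10]
  simp

end OneStep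

/-! ### The loop dressed by a parallel null line -/

section Dressing

variable {M : Type*} [TopologicalSpace M] [ChartedSpace ℂ M] {n : ℕ} {V L : Bdl M n}
  {q : EndForm M n}

/-- `dressPole` for forms. -/
noncomputable def dressPoleForm {x : M} (P Q : EndAmb n)
    (η θ : TangentSpace 𝓘(ℝ, ℂ) x →L[ℝ] EndAmb n) (τ ε : ℂ) :
    TangentSpace 𝓘(ℝ, ℂ) x →L[ℝ] EndAmb n :=
  conjForm (bst P Q ε) (bst P Q ε) η +
    (2 * τ * ε) • (conjForm (1 - P - Q) P θ + conjForm Q (1 - P - Q) θ +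
      conjForm (-(1 - P - Q)) Q θ + conjForm (-P) (1 - P - Q) θ)

theorem dressPoleForm_apply {x : M} (P Q : EndAmb n)
    (η θ : TangentSpace 𝓘(ℝ, ℂ) x →L[ℝ] EndAmb n) (τ ε : ℂ) (X : TangentSpace 𝓘(ℝ, ℂ) x) :
    dressPoleForm P Q η θ τ ε X = dressPole P Q (η X) (θ X) τ ε := by
  have h : ∀ A B C : EndAmb n, -A * B * C = -(A * B * C) := fun A B C => by
    rw [neg_mul A B, neg_mul (A * B) C]
  simp only [dressPoleForm, dressPole, add_apply, smul_apply, conjForm_apply, h, ← sub_eq_add_neg]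

theorem part10_dressPoleForm {x : M} (P Q : EndAmb n)
    (η θ : TangentSpace 𝓘(ℝ, ℂ) x →L[ℝ] EndAmb n) (τ ε : ℂ) :
    part10 (dressPoleForm P Q η θ τ ε) = dressPoleForm P Q (part10 η) (part10 θ) τ ε := by
  simp only [dressPoleForm, part10_add, part10_smul, part10_conjForm]

theorem part01_dressPoleForm {x : M} (P Q : EndAmb n)
    (η θ : TangentSpace 𝓘(ℝ, ℂ) x →L[ℝ] EndAmb n) (τ ε : ℂ) :
    part01 (dressPoleForm P Q η θ τ ε) = dressPoleForm P Q (part01 η) (part01 θ) τ ε := by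
  simp only [dressPoleForm, part01_add, part01_smul, part01_conjForm]

theorem conjForm_zero {x : M} (S T : EndAmb n) :
    conjForm S T (0 : TangentSpace 𝓘(ℝ, ℂ) x →L[ℝ] EndAmb n) = 0 := by
  ext1 X
  rw [conjForm_apply, zero_apply, mul_zero, zero_mul]

theorem dressPoleForm_zero {x : M} (P Q : EndAmb n) (τ ε : ℂ) :
    dressPoleForm P Q (0 : TangentSpace 𝓘(ℝ, ℂ) x →L[ℝ] EndAmb n) 0 τ ε = 0 := by
  ext1 X
  rw [dressPoleForm_apply]
  simp [dressPole]

/-- The part of the dressed connection at `1` that anticommutes with the reflection. -/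
noncomputable def poleForm (V L : Bdl M n) (q : EndForm M n) (α : ℂ) : EndForm M n := fun x =>
  dressPoleForm (lineP V L x) (lineQ V L x) (part10 (nForm V x)) (part10 (q x)) α⁻¹ 1 +
    dressPoleForm (lineP V L x) (lineQ V L x) (part01 (nForm V x)) (part01 (q x)) α (-1)

/-- The dressed multiplier. -/
noncomputable def dressQ (V L : Bdl M n) (q : EndForm M n) : EndForm M n := fun x =>
  part10 (q x) +
    conjForm (bst (lineP V L x) (lineQ V L x) (-1)) (bst (lineP V L x) (lineQ V L x) (-1))
      (part01 (q x))

theorem part10_poleForm (V L : Bdl M n) (q : EndForm M n) (α : ℂ) (x : M) :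
    part10 (poleForm V L q α x) =
      dressPoleForm (lineP V L x) (lineQ V L x) (part10 (nForm V x)) (part10 (q x)) α⁻¹ 1 := by
  rw [poleForm, part10_add, part10_dressPoleForm, part10_dressPoleForm, part10_part10,
    part10_part10, part10_part01, part10_part01, dressPoleForm_zero, add_zero]

theorem part01_poleForm (V L : Bdl M n) (q : EndForm M n) (α : ℂ) (x : M) :
    part01 (poleForm V L q α x) =
      dressPoleForm (lineP V L x) (lineQ V L x) (part01 (nForm V x)) (part01 (q x)) α (-1) := by
  rw [poleForm, part01_add, part01_dressPoleForm, part01_dressPoleForm, part01_part01,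
    part01_part01, part01_part10, part01_part10, dressPoleForm_zero, zero_add]

theorem part10_dressQ (V L : Bdl M n) (q : EndForm M n) (x : M) :
    part10 (dressQ V L q x) = part10 (q x) := by
  rw [dressQ, part10_add, part10_part10, part10_conjForm, part10_part01, conjForm_zero, add_zero]

theorem part01_dressQ (V L : Bdl M n) (q : EndForm M n) (x : M) :
    part01 (dressQ V L q x) = conjForm (bst (lineP V L x) (lineQ V L x) (-1))
      (bst (lineP V L x) (lineQ V L x) (-1)) (part01 (q x)) := by
  rw [dressQ, part01_add, part01_part10, part01_conjForm, part01_part01, zero_add]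

namespace IsTransNullLine

theorem smoothEnd_lineBoost (hL : IsTransNullLine V L) (hV : IsSmoothNondeg V) (c : ℂ) :
    SmoothEnd (lineBoost V L c) := by
  have hP := hL.smoothEnd_lineP hV
  have hQ := hL.smoothEnd_lineQ hV
  rw [funext (hL.lineBoost_eq hV.nondeg c)]
  exact ((hP.const_smul c).add (((SmoothEnd.const 1).sub hP).sub hQ)).add (hQ.const_smul c⁻¹)

theorem dEnd_lineBoost (hL : IsTransNullLine V L) (hV : IsSmoothNondeg V) (c : ℂ) (x : M)
    (X : TangentSpace 𝓘(ℝ, ℂ) x) :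
    dEnd (lineBoost V L c) x X = dBst (dEnd (lineP V L) x X) (dEnd (lineQ V L) x X) c := by
  have hP := hL.smoothEnd_lineP hV
  have hQ := hL.smoothEnd_lineQ hV
  have h : lineBoost V L c = fun x => ((c - 1) • lineP V L x + 1) + (c⁻¹ - 1) • lineQ V L x := by
    funext y
    rw [hL.lineBoost_eq hV.nondeg, bst]
    module
  rw [h, dEnd_add ((hP.const_smul _).add (SmoothEnd.const 1)) (hQ.const_smul _),
    dEnd_add (hP.const_smul _) (SmoothEnd.const 1), dEnd_const_smul hP, dEnd_const_smul hQ,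
    dEnd_const, dBst, zero_apply]
  module

/-- On (1,0)-forms A_α only involves α⁻¹ and on (0,1)-forms only α, so the first-order relations
split by type into two instances of the same algebra, with τ = α⁻¹ and τ = α. -/
theorem isDressing (hL : IsTransNullLine V L) (hV : IsSmoothNondeg V)
    (hq : ∀ x X, q x X ∈ wedge2 (V x) ⊔ wedge2 (perp (V x))) {α : ℂ}
    (hpar : IsParallel (specConn V q α) L) (x : M) (X : TangentSpace 𝓘(ℝ, ℂ) x) :
    IsDressing (lineP V L x) (lineQ V L x) (part10 (nForm V x) X) (part10 (q x) X)
      (part10 (dEnd (lineP V L) x) X) (part10 (dEnd (lineQ V L) x) X) α⁻¹ ∧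
    IsDressing (lineP V L x) (lineQ V L x) (part01 (nForm V x) X) (part01 (q x) X)
      (part01 (dEnd (lineP V L) x) X) (part01 (dEnd (lineQ V L) x) X) α := by
  have hx := hL.frame hV.nondeg x
  have hN := IsSkew.part (isSkew_nForm hV x) X
  have hsq := IsSkew.part (fun X => isSkew_of_mem (hq x X)) X
  have hd := hL.dEnd_relations hV x
  have hp := hL.parallel_relations hV hq hpar x
  have hneg : ∀ A B C : EndAmb n, -A * B * C = -(A * B * C) := fun A B C => by
    rw [neg_mul A B, neg_mul (A * B) C]
  have e1 := conjForm_part_of_eq (S := lineQ V L x) (T := 1) (S' := 0) (T' := 0)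
    (θ := dEnd (lineP V L) x) (fun Y => by rw [(hd Y).1]; simp) X
  have e2 := conjForm_part_of_eq (S := lineP V L x) (T := 1) (S' := 0) (T' := 0)
    (θ := dEnd (lineP V L) x) (fun Y => by rw [(hd Y).2.1]; simp) X
  have e3 := conjForm_part_of_eq (S := 1) (T := lineP V L x) (S' := 0) (T' := 0)
    (θ := dEnd (lineP V L) x) (fun Y => by rw [one_mul, (hd Y).2.2.1]; simp) X
  have e4 := conjForm_part_of_eq (S := 1) (T := lineQ V L x) (S' := 0) (T' := 0)
    (θ := dEnd (lineP V L) x) (fun Y => by rw [one_mul, (hd Y).2.2.2.1]; simp) X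
  have e5 : dEnd (lineP V L) x = conjForm 1 (lineP V L x) (dEnd (lineP V L) x) +
      conjForm (lineP V L x) 1 (dEnd (lineP V L) x) := ContinuousLinearMap.ext fun Y => by
    rw [add_apply, conjForm_apply, conjForm_apply, one_mul, mul_one]
    exact (hd Y).2.2.2.2.1
  have e6 : dEnd (lineQ V L) x = conjForm 1 (lineQ V L x) (dEnd (lineQ V L) x) +
      conjForm (lineQ V L x) 1 (dEnd (lineQ V L) x) := ContinuousLinearMap.ext fun Y => by
    rw [add_apply, conjForm_apply, conjForm_apply, one_mul, mul_one]
    exact (hd Y).2.2.2.2.2.1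
  have e5' := congrArg part10 e5
  have e5'' := congrArg part01 e5
  have e6' := congrArg part10 e6
  have e6'' := congrArg part01 e6
  rw [part10_add, part10_conjForm, part10_conjForm] at e5' e6'
  rw [part01_add, part01_conjForm, part01_conjForm] at e5'' e6''
  replace e5' := congrArg (fun T => T X) e5'
  replace e5'' := congrArg (fun T => T X) e5''
  replace e6' := congrArg (fun T => T X) e6'
  replace e6'' := congrArg (fun T => T X) e6''
  simp only [add_apply, conjForm_apply, one_mul, mul_one] at e5' e5'' e6' e6''
  have f1 := conjForm_part_of_eq (S := 1 - lineP V L x - lineQ V L x) (T := 1)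
    (S' := -(1 - lineP V L x - lineQ V L x)) (T' := lineP V L x) (θ := connForm V q α x)
    (fun Y => by rw [mul_one, hneg, (hp Y).1]) X
  have f2 := conjForm_part_of_eq (S := 1 - lineP V L x - lineQ V L x) (T := 1)
    (S' := -(1 - lineP V L x - lineQ V L x)) (T' := lineQ V L x) (θ := connForm V q (-α) x)
    (fun Y => by rw [mul_one, hneg, (hp Y).2.1]) X
  have f3 := conjForm_part_of_eq (S := 1) (T := 1 - lineP V L x - lineQ V L x)
    (S' := lineP V L x) (T' := 1 - lineP V L x - lineQ V L x) (θ := connForm V q (-α) x)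
    (fun Y => by rw [one_mul, (hp Y).2.2.1]) X
  have f4 := conjForm_part_of_eq (S := 1) (T := 1 - lineP V L x - lineQ V L x)
    (S' := lineQ V L x) (T' := 1 - lineP V L x - lineQ V L x) (θ := connForm V q α x)
    (fun Y => by rw [one_mul, (hp Y).2.2.2]) X
  simp only [mul_one, one_mul, zero_mul] at e1 e2 e3 e4
  simp only [mul_one, one_mul, hneg, part10_connForm, part01_connForm, inv_neg, neg_sq]
    at f1 f2 f3 f4
  exact ⟨⟨hx.PSQ _ hN.1, hx.QSP _ hN.1, hx.PSQ _ hsq.1, hx.QSP _ hsq.1, e1.1, e2.1, e3.1, e4.1,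
      e5', e6', f1.1, f2.1, f3.1, f4.1⟩,
    ⟨hx.PSQ _ hN.2, hx.QSP _ hN.2, hx.PSQ _ hsq.2, hx.QSP _ hsq.2, e1.2, e2.2, e3.2, e4.2,
      e5'', e6'', f1.2, f2.2, f3.2, f4.2⟩⟩

theorem dressed_connForm (hL : IsTransNullLine V L) (hV : IsSmoothNondeg V)
    (hq : ∀ x X, q x X ∈ wedge2 (V x) ⊔ wedge2 (perp (V x))) {α : ℂ}
    (hα : α ≠ -1 ∧ α ≠ 0 ∧ α ≠ 1) (hpar : IsParallel (specConn V q α) L) {μ : ℂ} (hμ0 : μ ≠ 0)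
    (hμ : μ ≠ α) (hμ' : μ ≠ -α) (x : M) (X : TangentSpace 𝓘(ℝ, ℂ) x) :
    lineBoost V L ((α - μ) / (α + μ)) x * connForm V q μ x X *
        lineBoost V L ((α - μ) / (α + μ))⁻¹ x +
      lineBoost V L ((α - μ) / (α + μ)) x * dEnd (lineBoost V L ((α - μ) / (α + μ))⁻¹) x X =
    lineBoost V L ((α - 1) / (α + 1)) x * dEnd (lineBoost V L ((α - 1) / (α + 1))⁻¹) x X +
      ((μ⁻¹ - 1) • part10 (poleForm V L q α x) X + (μ - 1) • part01 (poleForm V L q α x) X +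
        ((μ ^ 2)⁻¹ - 1) • part10 (dressQ V L q x) X +
        (μ ^ 2 - 1) • part01 (dressQ V L q x) X) := by
  obtain ⟨h10, h01⟩ := hL.isDressing hV hq hpar x X
  obtain ⟨hα1, hα0, hα2⟩ := hα
  have a1 : α + μ ≠ 0 := fun h => hμ' (eq_neg_of_add_eq_zero_right h)
  have a2 : μ + α ≠ 0 := by rwa [add_comm]
  have a3 : α + 1 ≠ 0 := fun h => hα1 (eq_neg_of_add_eq_zero_left h)
  have a4 : 1 + α ≠ 0 := by rwa [add_comm]
  -- The scalar (α-μ)/(α+μ) equals ε(t-τ)/(t+τ) for t = μ⁻¹, τ = α⁻¹, ε = 1 and also for t = μ, τ =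
  -- α, ε = -1. The values of ε are the scalars of p at 0 and ∞.
  have k10 := h10.identity (ε := 1) (t := μ⁻¹) (c := (α - μ) / (α + μ)) (c₁ := (α - 1) / (α + 1))
    (one_mul 1) (fun h => hα2 (by rw [← _root_.inv_inv α, h, _root_.inv_one]))
    (fun h => hα1 (by rw [← _root_.inv_inv α, h, inv_neg, _root_.inv_one]))
    (fun h => hμ (inv_injective h))
    (fun h => hμ' (inv_injective (by rw [h, inv_neg]))) (by field_simp) (by field_simp)
  have k01 := h01.identity (ε := -1) (t := μ) (c := (α - μ) / (α + μ)) (c₁ := (α - 1) / (α + 1))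
    (by norm_num) hα2 hα1 hμ hμ' (by field_simp; ring) (by field_simp; ring)
  rw [hL.lineBoost_eq hV.nondeg, hL.lineBoost_eq hV.nondeg, hL.lineBoost_eq hV.nondeg,
    hL.dEnd_lineBoost hV, hL.dEnd_lineBoost hV, part10_poleForm, part01_poleForm, part10_dressQ,
    part01_dressQ, dressPoleForm_apply, dressPoleForm_apply, conjForm_apply]
  have hA : connForm V q μ x X =
      ((μ⁻¹ - 1) • part10 (nForm V x) X + ((μ⁻¹) ^ 2 - 1) • part10 (q x) X) +
      ((μ - 1) • part01 (nForm V x) X + (μ ^ 2 - 1) • part01 (q x) X) := by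
    rw [← part10_connForm, ← part01_connForm, ← add_apply, part10_add_part01]
  have hdb : ∀ c : ℂ, dBst (dEnd (lineP V L) x X) (dEnd (lineQ V L) x X) c =
      dBst (part10 (dEnd (lineP V L) x) X) (part10 (dEnd (lineQ V L) x) X) c +
      dBst (part01 (dEnd (lineP V L) x) X) (part01 (dEnd (lineQ V L) x) X) c := by
    intro c
    have e1 : dEnd (lineP V L) x X = part10 (dEnd (lineP V L) x) X +
      part01 (dEnd (lineP V L) x) X := by rw [← add_apply, part10_add_part01]
    have e2 : dEnd (lineQ V L) x X = part10 (dEnd (lineQ V L) x) X +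
      part01 (dEnd (lineQ V L) x) X := by rw [← add_apply, part10_add_part01]
    rw [e1, e2]
    simp only [dBst]
    module
  have hone : bst (lineP V L x) (lineQ V L x) 1 = 1 := IsBoostFrame.bst_one
  rw [hone, one_mul, mul_one, inv_pow] at k10
  rw [hA, hdb, hdb, inv_pow]
  simp only [mul_add, add_mul] at k10 k01 ⊢
  linear_combination (norm := module) k10 + k01

end IsTransNullLine

end Dressing

/-! ### Transformation by a single parallel null line -/

section Step

variable {M : Type*} [TopologicalSpace M] [ChartedSpace ℂ M] {n : ℕ} {V L : Bdl M n}
  {q : EndForm M n}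

/-- A section of the orthogonal group that commutes with the reflection preserves the bundle. -/
theorem img_eq_of_conj {W : Submodule ℂ (Amb n)} (hW : IsNondeg W) {S : EndAmb n}
    (hS : S * S = 1) (h : reflection W * S * reflection W = S) : img S W = W := by
  have hSρ : reflection W * S = S * reflection W := by
    conv_rhs => rw [← h]
    rw [mul_assoc _ (reflection W) (reflection W), reflection_mul_self hW, mul_one]
  -- W is the +1-eigenspace of its reflection, with which S commutes; S² = 1 then gives the reverse
  -- inclusion.
  have key : ∀ v ∈ W, S v ∈ W := fun v hv => by
    rw [mem_iff_reflection hW, ← mul_apply_eq_comp, hSρ, mul_apply_eq_comp,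
      reflection_of_mem hW hv]
  ext v
  refine ⟨?_, fun hv => ⟨S v, key v hv, ?_⟩⟩
  · rintro ⟨w, hw, rfl⟩
    exact key w hw
  · change S (S v) = v
    rw [← mul_apply_eq_comp, hS]
    rfl

namespace IsTransNullLine

theorem lineBoost_mul (hL : IsTransNullLine V L) (hV : ∀ x, IsNondeg (V x)) (c d : ℂ) (x : M) :
    lineBoost V L c x * lineBoost V L d x = lineBoost V L (c * d) x := by
  rw [hL.lineBoost_eq hV, hL.lineBoost_eq hV, hL.lineBoost_eq hV, (hL.frame hV x).bst_mul]

theorem lineBoost_one (hL : IsTransNullLine V L) (hV : ∀ x, IsNondeg (V x)) (x : M) :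
    lineBoost V L 1 x = 1 := by
  rw [hL.lineBoost_eq hV]
  exact IsBoostFrame.bst_one

theorem inv_lineBoost (hL : IsTransNullLine V L) (hV : ∀ x, IsNondeg (V x)) {c : ℂ} (hc : c ≠ 0)
    (x : M) : inv (lineBoost V L c x) = lineBoost V L c⁻¹ x := by
  rw [hL.lineBoost_eq hV, hL.lineBoost_eq hV, (hL.frame hV x).inv_bst hc]

theorem isOrth_lineBoost (hL : IsTransNullLine V L) (hV : ∀ x, IsNondeg (V x)) {c : ℂ}
    (hc : c ≠ 0) (x : M) : IsOrth (lineBoost V L c x) := by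
  rw [hL.lineBoost_eq hV]
  exact (hL.frame hV x).isOrth_bst hc

theorem reflection_conj_lineBoost (hL : IsTransNullLine V L) (hV : ∀ x, IsNondeg (V x)) (c : ℂ)
    (x : M) : reflection (V x) * lineBoost V L c x * reflection (V x) = lineBoost V L c⁻¹ x := by
  rw [hL.lineBoost_eq hV, hL.lineBoost_eq hV,
    (hL.frame hV x).conj_bst (reflection_mul_self (hV x))]

theorem lineBoost_neg_one_mul_self (hL : IsTransNullLine V L) (hV : ∀ x, IsNondeg (V x)) (x : M) :
    lineBoost V L (-1) x * lineBoost V L (-1) x = 1 := by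
  rw [hL.lineBoost_mul hV, neg_one_mul, neg_neg, hL.lineBoost_one hV]

theorem img_lineBoost_neg_one (hL : IsTransNullLine V L) (hV : ∀ x, IsNondeg (V x)) (x : M) :
    img (lineBoost V L (-1) x) (V x) = V x :=
  img_eq_of_conj (hV x) (hL.lineBoost_neg_one_mul_self hV x) (by
    rw [hL.reflection_conj_lineBoost hV, inv_neg, _root_.inv_one])

theorem dressQ_eq (hL : IsTransNullLine V L) (hV : ∀ x, IsNondeg (V x)) (q : EndForm M n) (x : M) :
    dressQ V L q x = part10 (q x) + adAt (lineBoost V L (-1) x) (part01 (q x)) := by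
  have h : inv (lineBoost V L (-1) x) = lineBoost V L (-1) x := by
    rw [hL.inv_lineBoost hV (by norm_num), inv_neg, _root_.inv_one]
  rw [dressQ, ← hL.lineBoost_eq hV]
  congr 1
  ext1 X
  rw [conjForm_apply, adAt_apply, h]

theorem dressQ_mem (hL : IsTransNullLine V L) (hV : ∀ x, IsNondeg (V x))
    (hq : ∀ x X, q x X ∈ wedge2 (V x) ⊔ wedge2 (perp (V x))) (x : M)
    (X : TangentSpace 𝓘(ℝ, ℂ) x) :
    dressQ V L q x X ∈ wedge2 (V x) ⊔ wedge2 (perp (V x)) := by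
  rw [hL.dressQ_eq hV]
  refine add_mem (mem_part10 (hq x) X) ?_
  have h := conj_mem_wedge2_sup (hL.isOrth_lineBoost hV (c := -1) (by norm_num) x)
    (mem_part01 (hq x) X)
  rwa [hL.img_lineBoost_neg_one hV] at h

/-- From p p⁻¹ = 1 one has p d(p⁻¹) = -dp p⁻¹, which turns `dressed_connForm` into the intertwining
equation for p(μ). -/
theorem intertwines_dressed (hL : IsTransNullLine V L) (hV : IsSmoothNondeg V)
    (hq : ∀ x X, q x X ∈ wedge2 (V x) ⊔ wedge2 (perp (V x))) {α : ℂ}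
    (hα : α ≠ -1 ∧ α ≠ 0 ∧ α ≠ 1) (hpar : IsParallel (specConn V q α) L) {μ : ℂ} (hμ0 : μ ≠ 0)
    (hμ : μ ≠ α) (hμ' : μ ≠ -α) :
    Intertwines (lineBoost V L ((α - μ) / (α + μ))) (connForm V q μ) (fun x =>
      conjForm (lineBoost V L ((α - 1) / (α + 1)) x) 1
        (dEnd (lineBoost V L ((α - 1) / (α + 1))⁻¹) x) +
      ((μ⁻¹ - 1) • part10 (poleForm V L q α x) + (μ - 1) • part01 (poleForm V L q α x) +
        ((μ ^ 2)⁻¹ - 1) • part10 (dressQ V L q x) +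
        (μ ^ 2 - 1) • part01 (dressQ V L q x))) := by
  intro x X
  have h := hL.dressed_connForm hV hq hα hpar hμ0 hμ hμ' x X
  have hc : (α - μ) / (α + μ) ≠ 0 := div_ne_zero (sub_ne_zero.2 hμ.symm)
    fun h => hμ' (eq_neg_of_add_eq_zero_right h)
  set c := (α - μ) / (α + μ)
  have h1 : lineBoost V L c x * lineBoost V L c⁻¹ x = 1 := by
    rw [hL.lineBoost_mul hV.nondeg, mul_inv_cancel₀ hc, hL.lineBoost_one hV.nondeg]
  have h2 : lineBoost V L c⁻¹ x * lineBoost V L c x = 1 := by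
    rw [hL.lineBoost_mul hV.nondeg, inv_mul_cancel₀ hc, hL.lineBoost_one hV.nondeg]
  have h3 := dEnd_mul (hL.smoothEnd_lineBoost hV c) (hL.smoothEnd_lineBoost hV c⁻¹) x X
  have h4 : (fun y => lineBoost V L c y * lineBoost V L c⁻¹ y) = fun _ => 1 := funext fun y => by
    rw [hL.lineBoost_mul hV.nondeg, mul_inv_cancel₀ hc, hL.lineBoost_one hV.nondeg]
  rw [h4, dEnd_const, zero_apply] at h3
  simp only [add_apply, smul_apply]
  rw [conjForm_apply, mul_one, ← h, eq_neg_of_add_eq_zero_right h3.symm]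
  set p := lineBoost V L c x
  set k := lineBoost V L c⁻¹ x
  set dp := dEnd (lineBoost V L c) x X
  have e : dp + (p * connForm V q μ x X * k + -(dp * k)) * p =
      dp - dp * (k * p) + p * connForm V q μ x X * (k * p) := by
    rw [add_mul, neg_mul (dp * k) p, mul_assoc (p * connForm V q μ x X) k p, mul_assoc dp k p]
    abel
  rw [e, h2, mul_one, mul_one, sub_self, zero_add]

/-- The dressed gauge is evaluated at μ = -1, allowed because α ≠ ±1. There p(-1) = p(1)⁻¹, the
q-terms drop out, and the original connection is d - 2𝒩_V; comparison with ρ p(1)⁻¹ ρ = p(1)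
determines the coefficient. -/
theorem poleForm_eq (hL : IsTransNullLine V L) (hV : IsSmoothNondeg V)
    (hq : ∀ x X, q x X ∈ wedge2 (V x) ⊔ wedge2 (perp (V x))) {α : ℂ}
    (hα : α ≠ -1 ∧ α ≠ 0 ∧ α ≠ 1) (hpar : IsParallel (specConn V q α) L) (x : M)
    (X : TangentSpace 𝓘(ℝ, ℂ) x) :
    poleForm V L q α x X = nForm V x X + (1 / 2 : ℂ) •
      (conjForm (lineBoost V L ((α - 1) / (α + 1)) x) 1
        (dEnd (lineBoost V L ((α - 1) / (α + 1))⁻¹) x) X - reflection (V x) *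
      conjForm (lineBoost V L ((α - 1) / (α + 1)) x) 1
        (dEnd (lineBoost V L ((α - 1) / (α + 1))⁻¹) x) X * reflection (V x)) := by
  obtain ⟨hα1, hα0, hα2⟩ := id hα
  have hc : (α - 1) / (α + 1) ≠ 0 := div_ne_zero (sub_ne_zero.2 hα2)
    fun h => hα1 (eq_neg_of_add_eq_zero_left h)
  have h := hL.intertwines_dressed hV hq hα hpar (μ := -1) (by norm_num) hα1.symm
    (fun h => hα2 (neg_injective h).symm) x X
  have hc1 : (α - -1) / (α + -1) = ((α - 1) / (α + 1))⁻¹ := by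
    rw [inv_div, sub_neg_eq_add, sub_eq_add_neg]
  rw [hc1] at h
  set c := (α - 1) / (α + 1)
  have hk := hL.smoothEnd_lineBoost hV c
  have hψ := hL.smoothEnd_lineBoost hV c⁻¹
  have h1 : ∀ y, lineBoost V L c y * lineBoost V L c⁻¹ y = 1 := fun y => by
    rw [hL.lineBoost_mul hV.nondeg, mul_inv_cancel₀ hc, hL.lineBoost_one hV.nondeg]
  have h2 : lineBoost V L c⁻¹ x * lineBoost V L c x = 1 := by
    rw [hL.lineBoost_mul hV.nondeg, inv_mul_cancel₀ hc, hL.lineBoost_one hV.nondeg]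
  have h3 := dEnd_mul hk hψ x X
  rw [funext h1, dEnd_const, zero_apply] at h3
  have h4 : lineBoost V L c = fun y =>
      reflection (V y) * lineBoost V L c⁻¹ y * reflection (V y) := funext fun y => by
    rw [hL.reflection_conj_lineBoost hV.nondeg, _root_.inv_inv]
  have h5 : dEnd (lineBoost V L c) x X =
      dEnd (fun y => reflection (V y)) x X * lineBoost V L c⁻¹ x * reflection (V x) +
      reflection (V x) * dEnd (lineBoost V L c⁻¹) x X * reflection (V x) +
      reflection (V x) * lineBoost V L c⁻¹ x * dEnd (fun y => reflection (V y)) x X := by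
    conv_lhs => rw [h4]
    rw [dEnd_mul (hV.smooth.mul hψ) hV.smooth, dEnd_mul hV.smooth hψ, add_mul]
  have hp : poleForm V L q α x X = part10 (poleForm V L q α x) X +
      part01 (poleForm V L q α x) X := by rw [← add_apply, part10_add_part01]
  have hn : nForm V x X = part10 (nForm V x) X + part01 (nForm V x) X := by
    rw [← add_apply, part10_add_part01]
  refine pole_eq_of_parity (reflection_mul_self (hV.nondeg x)) (h1 x) h2
    (hL.reflection_conj_lineBoost hV.nondeg c x) (hV.dEnd_mul_add x X) h5 h3.symm
    (nForm_apply V x X) (by rw [conjForm_apply, mul_one]) ?_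
  have e1 : connForm V q (-1) x X = -(2 : ℂ) • nForm V x X := by
    rw [connForm_apply, hn, inv_neg, _root_.inv_one, neg_sq, one_pow, _root_.inv_one]
    module
  rw [e1] at h
  rw [← h]
  congr 2
  rw [hp]
  simp only [add_apply, smul_apply, inv_neg, _root_.inv_one, neg_sq, one_pow]
  module

/-- The gauge transformation relating a bundle and its transform by a parallel null line. -/
theorem intertwines_step (hL : IsTransNullLine V L) (hV : IsSmoothNondeg V)
    (hq : ∀ x X, q x X ∈ wedge2 (V x) ⊔ wedge2 (perp (V x))) {α : ℂ}
    (hα : α ≠ -1 ∧ α ≠ 0 ∧ α ≠ 1) (hpar : IsParallel (specConn V q α) L) {μ : ℂ} (hμ0 : μ ≠ 0)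
    (hμ : μ ≠ α) (hμ' : μ ≠ -α) :
    Intertwines (lineBoost V L (((α - 1) / (α + 1))⁻¹ * ((α - μ) / (α + μ)))) (connForm V q μ)
      (connForm (mapB (lineBoost V L ((α - 1) / (α + 1))⁻¹) V)
        (adForm (lineBoost V L ((α - 1) / (α + 1))⁻¹) (dressQ V L q)) μ) := by
  have hc : (α - 1) / (α + 1) ≠ 0 := div_ne_zero (sub_ne_zero.2 hα.2.2)
    fun h => hα.1 (eq_neg_of_add_eq_zero_left h)
  have h1 := hL.intertwines_dressed hV hq hα hpar hμ0 hμ hμ'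
  have hpole := hL.poleForm_eq hV hq hα hpar
  set c := (α - 1) / (α + 1)
  have hψ := hL.smoothEnd_lineBoost hV c⁻¹
  have h2 := intertwines_mapB hV hψ (hL.isOrth_lineBoost hV.nondeg (inv_ne_zero hc))
    (B := fun x => conjForm (lineBoost V L c x) 1 (dEnd (lineBoost V L c⁻¹) x))
    (C := poleForm V L q α) (fun x X => by
      rw [conjForm_apply, mul_one, ← mul_assoc, hL.lineBoost_mul hV.nondeg, inv_mul_cancel₀ hc,
        hL.lineBoost_one hV.nondeg, one_mul]) hpole (dressQ V L q) μ
  -- Dressing by p(μ) followed by the gauge p(1)⁻¹; the composite is a boost along the same line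
  -- with the product of the scalars.
  have h3 := h2.comp hψ (hL.smoothEnd_lineBoost hV _) h1
  rwa [funext fun x => hL.lineBoost_mul hV.nondeg c⁻¹ ((α - μ) / (α + μ)) x] at h3

variable [IsManifold 𝓘(ℂ) ω M]

theorem smoothForm_dressQ (hL : IsTransNullLine V L) (hV : IsSmoothNondeg V)
    (hq : SmoothForm q) : SmoothForm (dressQ V L q) := by
  have h : dressQ V L q = fun x => part10 (q x) +
      adForm (lineBoost V L (-1)) (fun x => part01 (q x)) x :=
    funext fun x => hL.dressQ_eq hV.nondeg q x
  rw [h]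
  exact hq.part10.add (hq.part01.adForm (hL.smoothEnd_lineBoost hV _) fun x =>
    (hL.isOrth_lineBoost hV.nondeg (by norm_num) x).isUnit)

open Filter Topology in
-- For μ ≠ 0, ±α flatness is carried over by the gauge p(1)⁻¹p(μ); the remaining values follow by
-- continuity.
theorem isConstrainedHarmonic_step (hL : IsTransNullLine V L) (hV : IsConstrainedHarmonic V q)
    {α : ℂ} (hα : α ≠ -1 ∧ α ≠ 0 ∧ α ≠ 1) (hpar : IsParallel (specConn V q α) L) :
    IsConstrainedHarmonic (mapB (lineBoost V L ((α - 1) / (α + 1))⁻¹) V)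
      (adForm (lineBoost V L ((α - 1) / (α + 1))⁻¹) (dressQ V L q)) := by
  have hS := hV.isSmoothNondeg
  have hc : (α - 1) / (α + 1) ≠ 0 := div_ne_zero (sub_ne_zero.2 hα.2.2)
    fun h => hα.1 (eq_neg_of_add_eq_zero_left h)
  have hψ := hL.smoothEnd_lineBoost hS ((α - 1) / (α + 1))⁻¹
  have ho := hL.isOrth_lineBoost hS.nondeg (inv_ne_zero hc)
  have hq' := hL.smoothForm_dressQ hS hV.smooth
  have hS' := hS.mapB hψ ho
  have key : ∀ μ : ℂ, μ ≠ 0 → μ ≠ α → μ ≠ -α →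
      IsFlat (specConn (mapB (lineBoost V L ((α - 1) / (α + 1))⁻¹) V)
        (adForm (lineBoost V L ((α - 1) / (α + 1))⁻¹) (dressQ V L q)) μ) := fun μ h0 h1 h2 =>
    (hV.flat μ h0).of_intertwines hS hS' hV.smooth (hL.smoothEnd_lineBoost hS _)
      (fun x => (hL.isOrth_lineBoost hS.nondeg (mul_ne_zero (inv_ne_zero hc)
        (div_ne_zero (sub_ne_zero.2 h1.symm)
          fun h => h2 (eq_neg_of_add_eq_zero_right h))) x).isUnit)
      (hL.intertwines_step hS hV.values hα hpar h0 h1 h2)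
  refine hV.mapB hψ ho hq' (hL.dressQ_mem hS.nondeg hV.values) fun μ h0 => ?_
  refine isFlat_of_eventually hS' (hq'.adForm hψ fun x => (ho x).isUnit) h0 ?_
  -- A punctured neighbourhood avoids z, also when z is its centre; this allows μ itself to be ±α.
  have hev : ∀ z : ℂ, ∀ᶠ w in 𝓝[≠] μ, w ≠ z := fun z => by
    by_cases h : z = μ
    · subst h
      exact self_mem_nhdsWithin
    · exact mem_nhdsWithin_of_mem_nhds (isOpen_ne.mem_nhds (Ne.symm h))
  filter_upwards [hev 0, hev α, hev (-α)] with w h1 h2 h3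
  exact key w h1 h2 h3

end IsTransNullLine

end Step

/-! ### Scalars of the dressing factors and their rescaling -/

section Boosts

variable {M : Type*} {n : ℕ}

theorem mapB_mapB (φ ψ : M → EndAmb n) (V : Bdl M n) :
    mapB φ (mapB ψ V) = mapB (fun x => φ x * ψ x) V :=
  funext fun x => img_img (φ x) (ψ x) (V x)

/-- The scalar of `p_{α,L}(μ)` on `L`. -/
noncomputable def pScalar (α : ℂ) (μ : OnePoint ℂ) : ℂ :=
  OnePoint.elim μ (-1) fun m => (α - m) / (α + m)

/-- The scalar of `q_{α,L}(μ)` on `L`. -/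
noncomputable def qScalar (α : ℂ) (μ : OnePoint ℂ) : ℂ :=
  OnePoint.elim μ 1 fun m => (m - α) / (m + α)

theorem pScalar_coe (α m : ℂ) : pScalar α (m : OnePoint ℂ) = (α - m) / (α + m) := rfl

theorem qScalar_coe (α m : ℂ) : qScalar α (m : OnePoint ℂ) = (m - α) / (m + α) := rfl

theorem pScalar_infty (α : ℂ) : pScalar α OnePoint.infty = -1 := rfl

theorem qScalar_infty (α : ℂ) : qScalar α OnePoint.infty = 1 := rfl

/-- The factor q_{α,L}(μ) is thus p_{α,L}(μ) composed with the boost of scalar -1, an involution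
commuting with ρ. -/
theorem qScalar_eq (α : ℂ) (μ : OnePoint ℂ) : qScalar α μ = -pScalar α μ := by
  induction μ using OnePoint.rec with
  | infty => rw [qScalar_infty, pScalar_infty, neg_neg]
  | coe m => rw [qScalar_coe, pScalar_coe, ← neg_div, neg_sub, add_comm]

theorem pScalar_ne_zero {α m : ℂ} (h : m ≠ α ∧ m ≠ -α) : pScalar α (m : OnePoint ℂ) ≠ 0 :=
  div_ne_zero (sub_ne_zero.2 h.1.symm) fun e => h.2 (eq_neg_of_add_eq_zero_right e)

theorem pMap_eq (V : Bdl M n) (α : ℂ) (L : Bdl M n) (μ : OnePoint ℂ) :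
    pMap V α L μ = lineBoost V L (pScalar α μ) := rfl

theorem rStar_eq (V : Bdl M n) (α β : ℂ) (Lα Lβ : Bdl M n) (μ : OnePoint ℂ) (x : M) :
    rStar V α β Lα Lβ μ x = lineBoost V (hatL V α β Lα Lβ) (-pScalar β μ) x *
      lineBoost V Lα (pScalar α μ) x := by
  rw [← qScalar_eq]
  rfl

theorem hatL_mapB {φ : M → EndAmb n} (ho : ∀ x, IsOrth (φ x)) {l : ℂ} (hl : l ≠ 0)
    (V : Bdl M n) (α β : ℂ) (Lα Lβ : Bdl M n) :
    hatL (mapB φ V) (α / l) (β / l) (mapB φ Lα) (mapB φ Lβ) = mapB φ (hatL V α β Lα Lβ) := by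
  have h : pScalar (α / l) ((β / l : ℂ) : OnePoint ℂ) = pScalar α (β : OnePoint ℂ) := by
    rw [pScalar_coe, pScalar_coe, ← sub_div, ← add_div, div_div_div_cancel_right₀ hl]
  rw [hatL, hatL, mapB_mapB, mapB_mapB, pMap_eq, pMap_eq, h]
  congr 1
  funext x
  rw [lineBoost_mapB ho, mul_assoc _ (inv (φ x)) (φ x), inv_mul_self (ho x).isUnit, mul_one]

theorem rStar_mapB {φ : M → EndAmb n} (ho : ∀ x, IsOrth (φ x)) {l : ℂ} (hl : l ≠ 0)
    (V : Bdl M n) (α β : ℂ) (Lα Lβ : Bdl M n) {μ ν : OnePoint ℂ}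
    (hμ : ∀ α, pScalar (α / l) μ = pScalar α ν) (x : M) :
    rStar (mapB φ V) (α / l) (β / l) (mapB φ Lα) (mapB φ Lβ) μ x =
      φ x * rStar V α β Lα Lβ ν x * inv (φ x) := by
  rw [rStar_eq, rStar_eq, hatL_mapB ho hl, lineBoost_mapB ho, lineBoost_mapB ho, hμ, hμ]
  set A := lineBoost V (hatL V α β Lα Lβ) (-pScalar β ν) x
  set B := lineBoost V Lα (pScalar α ν) x
  calc φ x * A * inv (φ x) * (φ x * B * inv (φ x)) =
      φ x * A * (inv (φ x) * φ x) * B * inv (φ x) := by simp only [mul_assoc]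
    _ = _ := by rw [inv_mul_self (ho x).isUnit, mul_one, mul_assoc (φ x)]

end Boosts

/-! ### Commutation of the two composites, reduced to an identity of gauges -/

section Backlund

variable {M : Type*} [TopologicalSpace M] [ChartedSpace ℂ M] {n : ℕ} {V L Lα Lβ : Bdl M n}
  {q : EndForm M n} {α β : ℂ}

theorem IsTransNullLine.mapB (hL : IsTransNullLine V L) {φ : M → EndAmb n} (hφ : SmoothEnd φ)
    (ho : ∀ x, IsOrth (φ x)) :
    IsTransNullLine (ConstrainedHarmonic.mapB φ V) (ConstrainedHarmonic.mapB φ L) where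
  line := hL.line.mapB hφ fun x => (ho x).isUnit
  null x := (hL.null x).img (ho x)
  trans x := by
    simp only [ConstrainedHarmonic.mapB]
    have h : img (reflection (img (φ x) (V x))) (img (φ x) (L x)) =
        img (φ x) (img (reflection (V x)) (L x)) := by
      rw [reflection_img (ho x), img_img, img_img, mul_assoc, inv_mul_self (ho x).isUnit, mul_one]
    rw [h, perp_img (ho x), ← img_inf (ho x).isUnit, hL.trans x, img_bot]

theorem pScalar_div {l : ℂ} (hl : l ≠ 0) (m α : ℂ) :
    pScalar (α / l) (m : OnePoint ℂ) = pScalar α ((l * m : ℂ) : OnePoint ℂ) := by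
  rw [pScalar_coe, pScalar_coe]
  have h1 : α / l - m = (α - l * m) / l := by field_simp
  have h2 : α / l + m = (α + l * m) / l := by field_simp
  rw [h1, h2, div_div_div_cancel_right₀ hl]

theorem adAt_zero {x : M} (T : EndAmb n) :
    adAt T (0 : TangentSpace 𝓘(ℝ, ℂ) x →L[ℝ] EndAmb n) = 0 := by
  ext1 X
  rw [adAt_apply, zero_apply, mul_zero, zero_mul]

theorem part10_adAt_add {x : M} (S T T' : EndAmb n)
    (η : TangentSpace 𝓘(ℝ, ℂ) x →L[ℝ] EndAmb n) :
    part10 (adAt S (adAt T (part10 η) + adAt T' (part01 η))) = adAt S (adAt T (part10 η)) := by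
  rw [part10_adAt, part10_add, part10_adAt, part10_adAt, part10_part10, part10_part01, adAt_zero,
    add_zero]

theorem part01_adAt_add {x : M} (S T T' : EndAmb n)
    (η : TangentSpace 𝓘(ℝ, ℂ) x →L[ℝ] EndAmb n) :
    part01 (adAt S (adAt T (part10 η) + adAt T' (part01 η))) = adAt S (adAt T' (part01 η)) := by
  rw [part01_adAt, part01_add, part01_adAt, part01_adAt, part01_part01, part01_part10, adAt_zero,
    zero_add]

theorem part10_qScale (l : ℂ) (q : EndForm M n) (x : M) :
    part10 (qScale l q x) = (l ^ 2)⁻¹ • part10 (q x) := by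
  rw [qScale, part10_add, part10_smul, part10_smul, part10_part10, part10_part01]
  ext1 X
  simp only [add_apply, smul_apply, zero_apply]
  module

theorem part01_qScale (l : ℂ) (q : EndForm M n) (x : M) :
    part01 (qScale l q x) = l ^ 2 • part01 (q x) := by
  rw [qScale, part01_add, part01_smul, part01_smul, part01_part01, part01_part10]
  ext1 X
  simp only [add_apply, smul_apply, zero_apply]
  module

/-- Purely algebraic: r* of the deformed data at 1, 0, ∞ is the conjugate by φ of r* at l, 0, ∞. The
choice of ψ is exactly ψ r*(1)⁻¹ = φ r*(l)⁻¹, so all inner factors φ⁻¹φ cancel. -/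
theorem Permutes.of_eq [IsManifold 𝓘(ℂ) ω M] {φ ψ : M → EndAmb n} (ho : ∀ x, IsOrth (φ x)) {l : ℂ}
    (hl : l ≠ 0)
    (hu : ∀ x, IsUnit (rStar V α β Lα Lβ ((1 : ℂ) : OnePoint ℂ) x) ∧
      IsUnit (rStar V α β Lα Lβ (l : OnePoint ℂ) x) ∧
      IsUnit (rStar V α β Lα Lβ ((0 : ℂ) : OnePoint ℂ) x) ∧
      IsUnit (rStar V α β Lα Lβ OnePoint.infty x))
    (hψ : ∀ x, ψ x = φ x * (inv (rStar V α β Lα Lβ (l : OnePoint ℂ) x) *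
      rStar V α β Lα Lβ ((1 : ℂ) : OnePoint ℂ) x)) :
    Permutes V q α β Lα Lβ l φ ψ := by
  have r1 := fun x => rStar_mapB ho hl V α β Lα Lβ (μ := ((1 : ℂ) : OnePoint ℂ))
    (fun α => (pScalar_div hl 1 α).trans (by rw [mul_one])) x
  have r0 := fun x => rStar_mapB ho hl V α β Lα Lβ (μ := ((0 : ℂ) : OnePoint ℂ))
    (fun α => (pScalar_div hl 0 α).trans (by rw [mul_zero])) x
  have ri := fun x => rStar_mapB ho hl V α β Lα Lβ (μ := OnePoint.infty) (ν := OnePoint.infty)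
    (fun α => rfl) x
  have hφ : ∀ x, IsUnit (φ x) := fun x => (ho x).isUnit
  have hφi : ∀ x, IsUnit (inv (φ x)) := fun x => isUnit_inv (hφ x)
  have hr1 : ∀ x, inv (rStar (mapB φ V) (α / l) (β / l) (mapB φ Lα) (mapB φ Lβ)
      ((1 : ℂ) : OnePoint ℂ) x) = φ x * inv (rStar V α β Lα Lβ (l : OnePoint ℂ) x) * inv (φ x) := by
    intro x
    rw [r1, inv_mul ((hφ x).mul (hu x).2.1) (hφi x), inv_mul (hφ x) (hu x).2.1, inv_inv (hφ x),
      mul_assoc]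
  have hψ1 : ∀ x, ψ x * inv (rStar V α β Lα Lβ ((1 : ℂ) : OnePoint ℂ) x) =
      φ x * inv (rStar V α β Lα Lβ (l : OnePoint ℂ) x) := fun x => by
    rw [hψ, ← mul_assoc, mul_assoc _ _ (inv _), mul_inv_self (hu x).1, mul_one]
  have hψu : ∀ x, IsUnit (ψ x) := fun x => by
    rw [hψ]
    exact (hφ x).mul ((isUnit_inv (hu x).2.1).mul (hu x).1)
  -- Here z stands for r*(∞) or r*(0), the factors acting on Λ^{1,0} and Λ^{0,1}.
  have key : ∀ (z : M → EndAmb n) (W : Bdl M n),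
      mapB (fun x => inv (rStar (mapB φ V) (α / l) (β / l) (mapB φ Lα) (mapB φ Lβ)
        ((1 : ℂ) : OnePoint ℂ) x)) (mapB (fun x => φ x * z x * inv (φ x)) (mapB φ W)) =
      mapB ψ (mapB (fun x => inv (rStar V α β Lα Lβ ((1 : ℂ) : OnePoint ℂ) x)) (mapB z W)) := by
    intro z W
    simp only [mapB_mapB]
    congr 1
    funext x
    rw [hr1, ← mul_assoc (ψ x), hψ1]
    calc _ = φ x * inv (rStar V α β Lα Lβ (l : OnePoint ℂ) x) * (inv (φ x) * φ x) * z x *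
          (inv (φ x) * φ x) := by simp only [mul_assoc]
      _ = _ := by rw [inv_mul_self (hφ x), mul_one, mul_one]
  refine ⟨?_, ?_, fun Λ10 Λ01 _ => ⟨?_, ?_⟩⟩
  · rw [backV, backV, mapB_mapB, mapB_mapB]
    congr 1
    funext x
    rw [rStarOneInv, rStarOneInv, hr1, hψ1, mul_assoc _ (inv (φ x)), inv_mul_self (hφ x), mul_one]
  · funext x
    obtain ⟨ha, hb, hz, hw⟩ := hu x
    have hai := isUnit_inv ha
    have hbi := isUnit_inv hb
    -- The same cancellation for Ad, with z = r*(0) on q^{1,0} and z = r*(∞) on q^{0,1}; the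
    -- scalings l⁻² and l² pass through by linearity.
    have e : ∀ (z : EndAmb n) (_ : IsUnit z) (η : TangentSpace 𝓘(ℝ, ℂ) x →L[ℝ] EndAmb n),
        adAt (φ x * inv (rStar V α β Lα Lβ (l : OnePoint ℂ) x) * inv (φ x))
          (adAt (φ x * z * inv (φ x)) (adAt (φ x) η)) =
        adAt (ψ x) (adAt (inv (rStar V α β Lα Lβ ((1 : ℂ) : OnePoint ℂ) x)) (adAt z η)) := by
      intro z hz η
      have hφx := hφ x
      have hφix := hφi x
      rw [adAt_adAt ((hφx.mul hz).mul hφix) hφx,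
        adAt_adAt ((hφx.mul hbi).mul hφix) (((hφx.mul hz).mul hφix).mul hφx),
        adAt_adAt hai hz, adAt_adAt (hψu x) (hai.mul hz), ← mul_assoc (ψ x), hψ1]
      congr 1
      calc _ = φ x * inv (rStar V α β Lα Lβ (l : OnePoint ℂ) x) * (inv (φ x) * φ x) * z *
            (inv (φ x) * φ x) := by simp only [mul_assoc]
        _ = _ := by rw [inv_mul_self hφx, mul_one, mul_one]
    rw [backQ, backQ, adForm, adForm, adForm, rStarOneInv, hr1, r0, ri, part10_adAt, part01_adAt,
      part10_qScale, part01_qScale, qScale]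
    simp only [adForm, rStarOneInv]
    rw [part10_adAt_add, part01_adAt_add]
    simp only [adAt_add, adAt_smul, e _ hz, e _ hw]
  · rw [back10, funext ri]
    exact key _ _
  · rw [back01, funext r0]
    exact key _ _

end Backlund

/-! ### The Bäcklund transformation as two one-line steps, and its gauges -/

section Backlund

variable {M : Type*} [TopologicalSpace M] [ChartedSpace ℂ M] {n : ℕ} {V Lα Lβ : Bdl M n}
  {q : EndForm M n} {α β : ℂ}

theorem intertwines_zero_iff {φ : M → EndAmb n} {A : EndForm M n} :
    Intertwines φ A 0 ↔ ∀ x X, dEnd φ x X = φ x * A x X := by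
  have h : ∀ x X, dEnd φ x X + (0 : EndForm M n) x X * φ x = dEnd φ x X := fun x X => by
    rw [Pi.zero_apply, zero_apply, zero_mul, add_zero]
  simp only [Intertwines, h]

theorem div_sub_one_ne_zero (hα : α ≠ -1 ∧ α ≠ 0 ∧ α ≠ 1) : (α - 1) / (α + 1) ≠ 0 :=
  div_ne_zero (sub_ne_zero.2 hα.2.2) fun h => hα.1 (eq_neg_of_add_eq_zero_left h)

namespace IsBacklundParams

theorem transNullα (hL : IsBacklundParams V q α β Lα Lβ) : IsTransNullLine V Lα :=
  ⟨hL.lineα, hL.nullα, hL.transα⟩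

theorem transNullHat (hL : IsBacklundParams V q α β Lα Lβ) (hV : IsSmoothNondeg V) :
    IsTransNullLine V (hatL V α β Lα Lβ) := by
  have ho := hL.transNullα.isOrth_lineBoost hV.nondeg (pScalar_ne_zero hL.ne)
  exact ⟨hL.lineβ.mapB (hL.transNullα.smoothEnd_lineBoost hV _) fun x => (ho x).isUnit,
    fun x => (hL.nullβ x).img (ho x), hL.transβ⟩

theorem isOrth_rStar (hL : IsBacklundParams V q α β Lα Lβ) (hV : IsSmoothNondeg V)
    {μ : OnePoint ℂ} (hα : pScalar α μ ≠ 0) (hβ : pScalar β μ ≠ 0) (x : M) :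
    IsOrth (rStar V α β Lα Lβ μ x) := by
  rw [rStar_eq]
  exact ((hL.transNullHat hV).isOrth_lineBoost hV.nondeg (neg_ne_zero.2 hβ) x).mul
    (hL.transNullα.isOrth_lineBoost hV.nondeg hα x)

theorem smoothEnd_rStar (hL : IsBacklundParams V q α β Lα Lβ) (hV : IsSmoothNondeg V)
    (μ : OnePoint ℂ) : SmoothEnd (rStar V α β Lα Lβ μ) := by
  rw [funext fun x => rStar_eq V α β Lα Lβ μ x]
  exact ((hL.transNullHat hV).smoothEnd_lineBoost hV _).mul
    (hL.transNullα.smoothEnd_lineBoost hV _)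

theorem pScalar_one_ne_zero (hα : α ≠ -1 ∧ α ≠ 0 ∧ α ≠ 1) :
    pScalar α ((1 : ℂ) : OnePoint ℂ) ≠ 0 :=
  pScalar_ne_zero ⟨hα.2.2.symm, fun h => hα.1 (by rw [h, neg_neg])⟩

theorem pScalar_zero (hα : α ≠ 0) : pScalar α ((0 : ℂ) : OnePoint ℂ) = 1 := by
  rw [pScalar_coe, sub_zero, add_zero, div_self hα]

theorem isOrth_rStar_one (hL : IsBacklundParams V q α β Lα Lβ) (hV : IsSmoothNondeg V) (x : M) :
    IsOrth (rStar V α β Lα Lβ ((1 : ℂ) : OnePoint ℂ) x) :=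
  hL.isOrth_rStar hV (pScalar_one_ne_zero hL.α_ne) (pScalar_one_ne_zero hL.β_ne) x

theorem rStarOneInv_eq (hL : IsBacklundParams V q α β Lα Lβ) (hV : IsSmoothNondeg V) (x : M) :
    rStarOneInv V α β Lα Lβ x = lineBoost V Lα ((α - 1) / (α + 1))⁻¹ x *
      lineBoost V (hatL V α β Lα Lβ) (((β - 1) / (β + 1))⁻¹ * -1) x := by
  have h1 := pScalar_one_ne_zero hL.α_ne
  have h2 := neg_ne_zero.2 (pScalar_one_ne_zero hL.β_ne)
  have hα := hL.transNullα
  have hβ := hL.transNullHat hV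
  rw [rStarOneInv, rStar_eq, inv_mul (hβ.isOrth_lineBoost hV.nondeg h2 x).isUnit
    (hα.isOrth_lineBoost hV.nondeg h1 x).isUnit, hα.inv_lineBoost hV.nondeg h1,
    hβ.inv_lineBoost hV.nondeg h2, pScalar_coe, pScalar_coe, inv_neg, mul_neg_one]

/-- The second null line, after the transformation by the first one. -/
theorem lineBoost_step (hL : IsBacklundParams V q α β Lα Lβ) (hV : IsSmoothNondeg V) (c : ℂ)
    (x : M) :
    lineBoost (mapB (lineBoost V Lα ((α - 1) / (α + 1))⁻¹) V)
      (mapB (lineBoost V Lα ((α - 1) / (α + 1))⁻¹) (hatL V α β Lα Lβ)) c x *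
        lineBoost V Lα ((α - 1) / (α + 1))⁻¹ x =
      lineBoost V Lα ((α - 1) / (α + 1))⁻¹ x * lineBoost V (hatL V α β Lα Lβ) c x := by
  have ho := hL.transNullα.isOrth_lineBoost hV.nondeg
    (inv_ne_zero (div_sub_one_ne_zero hL.α_ne))
  rw [lineBoost_mapB ho, mul_assoc _ (inv _), inv_mul_self (ho x).isUnit, mul_one]

/-- The second step boosts along the image of L̂ under the first gauge, which is the conjugate of
the boost along L̂. The extra scalar -1 in q_{β,L̂} does not matter, that boost preserving V. -/
theorem backV_eq (hL : IsBacklundParams V q α β Lα Lβ) (hV : IsSmoothNondeg V) :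
    backV V α β Lα Lβ =
      mapB (lineBoost (mapB (lineBoost V Lα ((α - 1) / (α + 1))⁻¹) V)
        (mapB (lineBoost V Lα ((α - 1) / (α + 1))⁻¹) (hatL V α β Lα Lβ)) ((β - 1) / (β + 1))⁻¹)
        (mapB (lineBoost V Lα ((α - 1) / (α + 1))⁻¹) V) := by
  have hβ := hL.transNullHat hV
  rw [backV, mapB_mapB, funext fun x => hL.rStarOneInv_eq hV x,
    funext fun x => hL.lineBoost_step hV _ x]
  funext x
  simp only [mapB]
  rw [← hβ.lineBoost_mul hV.nondeg, ← mul_assoc, ← img_img, hβ.img_lineBoost_neg_one hV.nondeg]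

/-- Since r*(0) is the L̂-boost by -1 and r*(∞) the L^α-boost by -1, the sign in r*(1)⁻¹ cancels on
q^{1,0} and leaves both involutions on q^{0,1}, as two dressing steps prescribe. -/
theorem backQ_eq (hL : IsBacklundParams V q α β Lα Lβ) (hV : IsSmoothNondeg V) :
    backQ V q α β Lα Lβ =
      adForm (lineBoost (mapB (lineBoost V Lα ((α - 1) / (α + 1))⁻¹) V)
        (mapB (lineBoost V Lα ((α - 1) / (α + 1))⁻¹) (hatL V α β Lα Lβ)) ((β - 1) / (β + 1))⁻¹)
        (dressQ (mapB (lineBoost V Lα ((α - 1) / (α + 1))⁻¹) V)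
          (mapB (lineBoost V Lα ((α - 1) / (α + 1))⁻¹) (hatL V α β Lα Lβ))
          (adForm (lineBoost V Lα ((α - 1) / (α + 1))⁻¹) (dressQ V Lα q))) := by
  have hα := hL.transNullα
  have hβ := hL.transNullHat hV
  have hc := inv_ne_zero (div_sub_one_ne_zero hL.α_ne)
  have hd := inv_ne_zero (div_sub_one_ne_zero hL.β_ne)
  have ho := hα.isOrth_lineBoost hV.nondeg hc
  have hs := hα.smoothEnd_lineBoost hV ((α - 1) / (α + 1))⁻¹
  have hV1 := hV.mapB hs ho
  have h1 := hβ.mapB hs ho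
  have step := fun c x => hL.lineBoost_step hV c x
  funext x
  rw [backQ, adForm, adForm, h1.dressQ_eq hV1.nondeg, adForm, hα.dressQ_eq hV.nondeg, part10_adAt,
    part01_adAt, part10_add, part01_add, part10_adAt, part01_adAt, part10_part10, part10_part01,
    part01_part01, part01_part10, adAt_zero, hL.rStarOneInv_eq hV, rStar_eq, rStar_eq,
    pScalar_infty, pScalar_infty, pScalar_zero hL.α_ne.2.1, pScalar_zero hL.β_ne.2.1, neg_neg,
    hα.lineBoost_one hV.nondeg, hβ.lineBoost_one hV.nondeg, mul_one, one_mul, add_zero, zero_add]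
  have step1 := step ((β - 1) / (β + 1))⁻¹ x
  have step2 := step (-1) x
  have u1 := (ho x).isUnit
  have n1 : (-1 : ℂ) ≠ 0 := by norm_num
  have u2 := (h1.isOrth_lineBoost hV1.nondeg hd x).isUnit
  have u3 := (h1.isOrth_lineBoost hV1.nondeg n1 x).isUnit
  have u4 := (hα.isOrth_lineBoost hV.nondeg n1 x).isUnit
  have u5 := (hβ.isOrth_lineBoost hV.nondeg n1 x).isUnit
  have u6 := (hβ.isOrth_lineBoost hV.nondeg (mul_ne_zero hd n1) x).isUnit
  rw [adAt_add, adAt_add, adAt_adAt (u1.mul u6) u5, adAt_adAt (u1.mul u6) u4, adAt_adAt u2 u1,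
    adAt_adAt u1 u4, adAt_adAt u3 (u1.mul u4), adAt_adAt u2 (u3.mul (u1.mul u4)), step1]
  congr 2
  · rw [mul_assoc, hβ.lineBoost_mul hV.nondeg, mul_assoc, mul_neg_one, neg_neg, mul_one]
  · rw [← mul_assoc (lineBoost _ _ (-1) x), step2, ← hβ.lineBoost_mul hV.nondeg]
    simp only [← mul_assoc]
    rw [step1]

theorem mapB_hatL_eq (hL : IsBacklundParams V q α β Lα Lβ) (hV : IsSmoothNondeg V) :
    mapB (lineBoost V Lα ((α - 1) / (α + 1))⁻¹) (hatL V α β Lα Lβ) =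
      mapB (lineBoost V Lα (((α - 1) / (α + 1))⁻¹ * ((α - β) / (α + β)))) Lβ := by
  rw [hatL, mapB_mapB]
  congr 1
  exact funext fun x => hL.transNullα.lineBoost_mul hV.nondeg _ _ x

theorem isUnit_rStar (hL : IsBacklundParams V q α β Lα Lβ) (hV : IsSmoothNondeg V) {l : ℂ}
    (hlα : l ≠ α ∧ l ≠ -α) (hlβ : l ≠ β ∧ l ≠ -β) (x : M) :
    IsUnit (rStar V α β Lα Lβ ((1 : ℂ) : OnePoint ℂ) x) ∧
      IsUnit (rStar V α β Lα Lβ (l : OnePoint ℂ) x) ∧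
      IsUnit (rStar V α β Lα Lβ ((0 : ℂ) : OnePoint ℂ) x) ∧
      IsUnit (rStar V α β Lα Lβ OnePoint.infty x) := by
  have h1 : (-1 : ℂ) ≠ 0 := by norm_num
  refine ⟨(hL.isOrth_rStar_one hV x).isUnit,
    (hL.isOrth_rStar hV (pScalar_ne_zero hlα) (pScalar_ne_zero hlβ) x).isUnit,
    (hL.isOrth_rStar hV ?_ ?_ x).isUnit, (hL.isOrth_rStar hV (μ := OnePoint.infty) h1 h1 x).isUnit⟩
  · rw [pScalar_zero hL.α_ne.2.1]
    exact one_ne_zero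
  · rw [pScalar_zero hL.β_ne.2.1]
    exact one_ne_zero

variable [IsManifold 𝓘(ℂ) ω M]

/-- The line is p(1)⁻¹p(β)L^β, the image of a d^{β,q}_V-parallel line under the first gauge at μ =
β. Here β ≠ ±α is needed. -/
theorem parallel_step (hL : IsBacklundParams V q α β Lα Lβ) (hV : IsConstrainedHarmonic V q) :
    IsParallel (specConn (mapB (lineBoost V Lα ((α - 1) / (α + 1))⁻¹) V)
      (adForm (lineBoost V Lα ((α - 1) / (α + 1))⁻¹) (dressQ V Lα q)) β)
      (mapB (lineBoost V Lα ((α - 1) / (α + 1))⁻¹) (hatL V α β Lα Lβ)) := by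
  have hS := hV.isSmoothNondeg
  have hα := hL.transNullα
  have hc := inv_ne_zero (div_sub_one_ne_zero hL.α_ne)
  rw [hL.mapB_hatL_eq hS]
  exact hL.parallelβ.mapB hS
    (hS.mapB (hα.smoothEnd_lineBoost hS _) (hα.isOrth_lineBoost hS.nondeg hc))
    (hα.smoothEnd_lineBoost hS _) (fun x => (hα.isOrth_lineBoost hS.nondeg
      (mul_ne_zero hc (pScalar_ne_zero hL.ne)) x).isUnit)
    (hα.intertwines_step hS hV.values hL.α_ne hL.parallelα hL.β_ne.2.1 hL.ne.1 hL.ne.2)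

theorem isConstrainedHarmonic_back (hL : IsBacklundParams V q α β Lα Lβ)
    (hV : IsConstrainedHarmonic V q) :
    IsConstrainedHarmonic (backV V α β Lα Lβ) (backQ V q α β Lα Lβ) := by
  have hS := hV.isSmoothNondeg
  have hα := hL.transNullα
  have hc := inv_ne_zero (div_sub_one_ne_zero hL.α_ne)
  rw [hL.backV_eq hS, hL.backQ_eq hS]
  exact ((hL.transNullHat hS).mapB (hα.smoothEnd_lineBoost hS _)
    (hα.isOrth_lineBoost hS.nondeg hc)).isConstrainedHarmonic_step
    (hα.isConstrainedHarmonic_step hV hL.α_ne hL.parallelα) hL.β_ne (hL.parallel_step hV)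

/-- The two one-line gauges are composed. Moving the second past the first gathers all L̂-boosts,
the two signs cancel, and r*(1)⁻¹r*(μ) remains. -/
theorem intertwines_back (hL : IsBacklundParams V q α β Lα Lβ) (hV : IsConstrainedHarmonic V q)
    {μ : ℂ} (h0 : μ ≠ 0) (hμα : μ ≠ α ∧ μ ≠ -α) (hμβ : μ ≠ β ∧ μ ≠ -β) :
    Intertwines (fun x => rStarOneInv V α β Lα Lβ x * rStar V α β Lα Lβ (μ : OnePoint ℂ) x)
      (connForm V q μ) (connForm (backV V α β Lα Lβ) (backQ V q α β Lα Lβ) μ) := by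
  have hS := hV.isSmoothNondeg
  have hα := hL.transNullα
  have hβ := hL.transNullHat hS
  have hc := inv_ne_zero (div_sub_one_ne_zero hL.α_ne)
  have ho := hα.isOrth_lineBoost hS.nondeg hc
  have hs := hα.smoothEnd_lineBoost hS ((α - 1) / (α + 1))⁻¹
  have hV1 := hα.isConstrainedHarmonic_step hV hL.α_ne hL.parallelα
  have hS1 := hV1.isSmoothNondeg
  have hL1 := hβ.mapB hs ho
  have h1 := hα.intertwines_step hS hV.values hL.α_ne hL.parallelα h0 hμα.1 hμα.2
  have h2 := hL1.intertwines_step hS1 hV1.values hL.β_ne (hL.parallel_step hV) h0 hμβ.1 hμβ.2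
  have h3 := h2.comp (hL1.smoothEnd_lineBoost hS1 _) (hα.smoothEnd_lineBoost hS _) h1
  rw [← hL.backV_eq hS, ← hL.backQ_eq hS] at h3
  convert h3 using 1
  funext x
  rw [hL.rStarOneInv_eq hS, rStar_eq, ← hα.lineBoost_mul hS.nondeg, ← mul_assoc (lineBoost _ _ _ x),
    hL.lineBoost_step hS, mul_assoc, ← mul_assoc (lineBoost V (hatL V α β Lα Lβ) _ x),
    hβ.lineBoost_mul hS.nondeg, mul_assoc _ (-1 : ℂ), neg_one_mul, neg_neg, ← mul_assoc,
    pScalar_coe, pScalar_coe]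

theorem mapB (hL : IsBacklundParams V q α β Lα Lβ) (hV : IsConstrainedHarmonic V q) {l : ℂ}
    (hl0 : l ≠ 0) (hlα : l ≠ α ∧ l ≠ -α) (hlβ : l ≠ β ∧ l ≠ -β) {φ : M → EndAmb n}
    (hφ : IsGauge (specConn V q l) φ) :
    IsBacklundParams (ConstrainedHarmonic.mapB φ V) (adForm φ (qScale l q)) (α / l) (β / l)
      (ConstrainedHarmonic.mapB φ Lα) (ConstrainedHarmonic.mapB φ Lβ) := by
  have hS := hV.isSmoothNondeg
  have hS' := hS.mapB hφ.smooth hφ.orth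
  have hu := fun x => (hφ.orth x).isUnit
  have hα := hL.transNullα.mapB hφ.smooth hφ.orth
  have hβ := (hL.transNullHat hS).mapB hφ.smooth hφ.orth
  -- The forbidden values ±1 of α/l and β/l correspond to l = ±α and l = ±β.
  have hne : ∀ {γ : ℂ}, γ ≠ 0 → l ≠ γ ∧ l ≠ -γ → γ / l ≠ -1 ∧ γ / l ≠ 0 ∧ γ / l ≠ 1 := by
    intro γ h0 hl
    refine ⟨fun h => hl.2 ?_, div_ne_zero h0 hl0, fun h => hl.1 ?_⟩
    · rw [div_eq_iff hl0] at h
      rw [h, neg_one_mul, neg_neg]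
    · rw [div_eq_iff hl0, one_mul] at h
      exact h.symm
  have hI := fun γ : ℂ => by
    have h := intertwines_spectral hS hV.values hφ (γ / l)
    rwa [mul_div_cancel₀ γ hl0] at h
  refine ⟨hne hL.α_ne.2.1 hlα, hne hL.β_ne.2.1 hlβ, ⟨fun h => hL.ne.1 ?_, fun h => hL.ne.2 ?_⟩,
    hα.line, hL.lineβ.mapB hφ.smooth hu, hα.null, fun x => (hL.nullβ x).img (hφ.orth x),
    hL.parallelα.mapB hS hS' hφ.smooth hu (hI α), hL.parallelβ.mapB hS hS' hφ.smooth hu (hI β),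
    hα.trans, ?_⟩
  · exact (div_left_inj' hl0).1 h
  · exact (div_left_inj' hl0).1 (by rw [h, neg_div])
  · rw [hatL_mapB hφ.orth hl0]
    exact hβ.trans

/-- The gauge transformation realising the spectral deformation of the Bäcklund transform. -/
theorem isGauge_back (hL : IsBacklundParams V q α β Lα Lβ) (hV : IsConstrainedHarmonic V q) {l : ℂ}
    (hl0 : l ≠ 0) (hlα : l ≠ α ∧ l ≠ -α) (hlβ : l ≠ β ∧ l ≠ -β) {φ : M → EndAmb n}
    (hφ : IsGauge (specConn V q l) φ) :
    IsGauge (specConn (backV V α β Lα Lβ) (backQ V q α β Lα Lβ) l) fun x =>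
      φ x * (inv (rStar V α β Lα Lβ (l : OnePoint ℂ) x) *
        rStar V α β Lα Lβ ((1 : ℂ) : OnePoint ℂ) x) := by
  have hS := hV.isSmoothNondeg
  have ho := hL.isOrth_rStar hS (pScalar_ne_zero hlα) (pScalar_ne_zero hlβ)
  have ho1 := hL.isOrth_rStar_one hS
  have hs := hL.smoothEnd_rStar hS (l : OnePoint ℂ)
  have hs1 := hL.smoothEnd_rStar hS ((1 : ℂ) : OnePoint ℂ)
  have hu := fun x => (ho x).isUnit
  have hu1 := fun x => (ho1 x).isUnit
  have hsR := (hs1.inv hu1).mul hs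
  have huR := fun x => (isUnit_inv (hu1 x)).mul (hu x)
  have h1 := (hL.intertwines_back hV hl0 hlα hlβ).inv hsR huR
  -- Go back from V* to V by the inverse of r*(1)⁻¹r*(l), then trivialise d^{l,q}_V by φ.
  have h2 := (intertwines_zero_iff.2 ((isGauge_iff hS).1 hφ).2.2).comp hφ.smooth (hsR.inv huR) h1
  have e : ∀ x, inv (inv (rStar V α β Lα Lβ ((1 : ℂ) : OnePoint ℂ) x) *
      rStar V α β Lα Lβ (l : OnePoint ℂ) x) =
      inv (rStar V α β Lα Lβ (l : OnePoint ℂ) x) * rStar V α β Lα Lβ ((1 : ℂ) : OnePoint ℂ) x :=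
    fun x => by rw [inv_mul (isUnit_inv (hu1 x)) (hu x), inv_inv (hu1 x)]
  simp only [e] at h2
  exact (isGauge_iff (hL.isConstrainedHarmonic_back hV).isSmoothNondeg).2
    ⟨hφ.smooth.mul ((hs.inv hu).mul hs1), fun x => (hφ.orth x).mul ((ho x).inv.mul (ho1 x)),
      intertwines_zero_iff.1 h2⟩

end IsBacklundParams

/-- Connection-preserving isometries onto the trivial flat bundle are unique up to a constant. -/
theorem IsGauge.exists_eq_mul [IsManifold 𝓘(ℂ) ω M] [ConnectedSpace M] (hV : IsSmoothNondeg V)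
    {μ : ℂ} {φ ψ : M → EndAmb n} (hφ : IsGauge (specConn V q μ) φ)
    (hψ : IsGauge (specConn V q μ) ψ) : ∃ T : EndAmb n, IsOrth T ∧ ∀ x, φ x = T * ψ x := by
  have hu := fun x => (hψ.orth x).isUnit
  have h1 := intertwines_zero_iff.2 ((isGauge_iff hV).1 hφ).2.2
  have h2 := (intertwines_zero_iff.2 ((isGauge_iff hV).1 hψ).2.2).inv hψ.smooth hu
  have h3 := intertwines_zero_iff.1 (h1.comp hφ.smooth (hψ.smooth.inv hu) h2)
  obtain ⟨x₀⟩ := ConnectedSpace.toNonempty (α := M)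
  -- The section φψ⁻¹ intertwines d with itself, so its derivative vanishes and it equals its value
  -- at x₀ everywhere.
  refine ⟨φ x₀ * inv (ψ x₀), (hφ.orth x₀).mul (hψ.orth x₀).inv, fun x => ?_⟩
  rw [eq_of_mvfderiv_eq_zero (hφ.smooth.mul (hψ.smooth.inv hu)) (fun y => ?_) x₀ x, mul_assoc,
    inv_mul_self (hu x), mul_one]
  ext1 X
  refine (h3 y X).trans ?_
  rw [Pi.zero_apply, zero_apply, mul_zero]

end Backlund

end ConstrainedHarmonic

/-! ### The theorem -/

open ConstrainedHarmonic in
theorem mainTheorem7 {M : Type*} [TopologicalSpace M] [T2Space M] [ConnectedSpace M]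
    [ChartedSpace ℂ M] [IsManifold 𝓘(ℂ) ω M] (n : ℕ) (hn : 3 ≤ n)
    (V : Bdl M n) (q : EndForm M n) (hV : IsConstrainedHarmonic V q)
    (α β : ℂ) (Lα Lβ : Bdl M n) (hL : IsBacklundParams V q α β Lα Lβ)
    (l : ℂ) (hl0 : l ≠ 0) (hlα : l ≠ α ∧ l ≠ -α) (hlβ : l ≠ β ∧ l ≠ -β)
    (φ : M → EndAmb n) (hφ : IsGauge (specConn V q l) φ) :
    IsConstrainedHarmonic (mapB φ V) (adForm φ (qScale l q)) ∧
    IsBacklundParams (mapB φ V) (adForm φ (qScale l q)) (α / l) (β / l)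
      (mapB φ Lα) (mapB φ Lβ) ∧
    IsConstrainedHarmonic (backV V α β Lα Lβ) (backQ V q α β Lα Lβ) ∧
    (∃ ψ : M → EndAmb n,
      IsGauge (specConn (backV V α β Lα Lβ) (backQ V q α β Lα Lβ) l) ψ ∧
      Permutes V q α β Lα Lβ l φ ψ) ∧
    (∀ ψ : M → EndAmb n,
      IsGauge (specConn (backV V α β Lα Lβ) (backQ V q α β Lα Lβ) l) ψ →
      ∃ T : EndAmb n, IsOrth T ∧ Permutes V q α β Lα Lβ l φ (fun x => T * ψ x)) := by
  have hS := hV.isSmoothNondeg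
  have hB := hL.isConstrainedHarmonic_back hV
  have hG := hL.isGauge_back hV hl0 hlα hlβ hφ
  have hu := hL.isUnit_rStar hS hlα hlβ
  refine ⟨hV.spectral hl0 hφ, hL.mapB hV hl0 hlα hlβ hφ, hB,
    ⟨_, hG, Permutes.of_eq hφ.orth hl0 hu fun _ => rfl⟩, fun ψ hψ => ?_⟩
  -- T compares the explicit gauge φ r*(l)⁻¹ r*(1) with the given ψ, so Tψ is that explicit gauge.
  obtain ⟨T, hT, h⟩ := hG.exists_eq_mul hB.isSmoothNondeg hψ
  exact ⟨T, hT, Permutes.of_eq hφ.orth hl0 hu fun x => (h x).symm⟩
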